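/- **Setting.** Points of $\mathbb R^6=\mathbb R^3\times\mathbb R^3$ are written $(x,y)$ in position space and $(k,p)$ in momentum space; $\hat u(k)=(2\pi)^{-n/2}\int e^{-ik\cdot x}u(x)\,dx$ is the unitary Fourier transform on $L^2(\mathbb R^n)$; scalar products are antilinear in the first argument. Let $$L^2_{\rm sym}(\mathbb R^6)=\{\psi\in L^2(\mathbb R^6):\ \psi(x,y)=\psi(-x,y)=\psi(\tfrac12x+y,\tfrac34x-\tfrac12y)\ \text{a.e.}\},$$ and let $H_0=-\Delta_x-\tfrac34\Delta_y$, that is, multiplication by $k^2+\frac34p^2$ in momentum space, on $H^2(\mathbb R^6)$. For $\lambda>0$ and $\xi\in L^2(\mathbb R^3)$ define $G^\lambda\xi,\ \mathcal G^\lambda\xi\in L^2(\mathbb R^6)$ by $$\widehat{G^\lambda\xi}(k,p)=\sqrt{\tfrac2\pi}\,\frac{\hat\xi(p)}{k^2+\frac34p^2+\lambda},\qquad \widehat{\mathcal G^\lambda\xi}(k,p)=\sqrt{\tfrac2\pi}\,\frac{\hat\xi(p)+\hat\xi(k-\frac12p)+\hat\xi(-k-\frac12p)}{k^2+\frac34p^2+\lambda}.$$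 Let $\beta,\gamma\in\mathbb R$ and $\theta:(0,\infty)\to\mathbb R$ be such that $\theta\in L^\infty$, $|\theta(r)-1|\le c\,r$ for some $c>0$ and almost every $r>0$, and $$\gamma>\gamma_c=\frac{\sqrt3}{\pi}\Big(\frac{4\pi}{3\sqrt3}-1\Big).$$ For $\eta,\xi\in H^{1/2}(\mathbb R^3)$ put $$\Phi^\lambda(\eta,\xi)=\int\! dp\,\overline{\hat\eta(p)}\Big(\sqrt{\tfrac34p^2+\lambda}\;\hat\xi(p)-\frac1{\pi^2}\int\! dq\,\frac{\hat\xi(q)}{p^2+q^2+p\cdot q+\lambda}\Big)+\int\! dy\,\Big(\beta+\frac{\gamma}{|y|}\theta(|y|)\Big)\overline{\eta(y)}\,\xi(y).$$ Let $$\mathcal D(F)=\{\psi\in L^2_{\rm sym}(\mathbb R^6):\ \psi=w^\lambda+\mathcal G^\lambda\xi,\ w^\lambda\in H^1(\mathbb R^6),\ \xi\in H^{1/2}(\mathbb R^3)\}$$ and, for $v=w^\lambda_v+\mathcal G^\lambda\xi_v$ and $\psi=w^\lambda+\mathcal G^\lambda\xi$ in $\mathcal D(F)$, $$F(v,\psi)=\int\!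 dk\,dp\,\big(k^2+\tfrac34p^2+\lambda\big)\overline{\hat w_v^\lambda}\,\hat w^\lambda-\lambda(v,\psi)+12\pi\,\Phi^\lambda(\xi_v,\xi).$$ An operator $T$ is *associated* with a form $B$ on a domain $D$ if ($\psi\in\mathcal D(T)$ and $T\psi=f$) holds exactly when $\psi\in D$ and $B(v,\psi)=(v,f)$ for all $v\in D$. **Theorem.** For every $\lambda>0$ the decomposition $\psi=w^\lambda+\mathcal G^\lambda\xi$ of an element of $\mathcal D(F)$ is unique, and there is a self-adjoint operator $H$, bounded from below, in $L^2_{\rm sym}(\mathbb R^6)$ that is associated with $F,\mathcal D(F)$, whichever $\lambda>0$ is used to define the form. Moreover there is $\lambda_0>0$ such that for all $\lambda>\lambda_0$ there is a self-adjoint operator $\Gamma^\lambda$ in $L^2(\mathbb R^3)$, bounded from below by a positive constant, that is associated with $\Phi^\lambda$ on $H^{1/2}(\mathbb R^3)$, and the following hold. 1. (Domain) $$\mathcal D(H)=\Big\{\psi\in\mathcal D(F):\ w^\lambda\in H^2(\mathbb R^6),\ \xi\in\mathcal D(\Gamma^\lambda),\ \Gamma^\lambda\xi=w^\lambda\big|_{\pi_{23}}\Big\},$$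 where $w^\lambda|_{\pi_{23}}=w^\lambda(0,\cdot)$ is the trace on $\pi_{23}=\{x=0\}$, that is, the function with Fourier transform $(2\pi)^{-3/2}\int\hat w^\lambda(k,p)\,dk$. 2. (Action) $H\psi=H_0w^\lambda-\lambda\,\mathcal G^\lambda\xi$ for $\psi\in\mathcal D(H)$. 3. (Resolvent) $\Gamma^\lambda$ and $H+\lambda$ have bounded everywhere defined inverses, and for all $f\in L^2_{\rm sym}(\mathbb R^6)$ $$(H+\lambda)^{-1}f=(H_0+\lambda)^{-1}f+\frac1{4\pi}\,\mathcal G^\lambda(\Gamma^\lambda)^{-1}(G^{\lambda})^{*}f.$$ -/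

import Mathlib

open MeasureTheory
open scoped ENNReal ComplexConjugate

noncomputable section

namespace ThreeBosons

/-! ### The spaces and the unitary Fourier transform -/

/-- `ℝ³` with its Euclidean norm. -/
abbrev R3 : Type := EuclideanSpace ℝ (Fin 3)

/-- `ℝ⁶ = ℝ³ × ℝ³` with its Euclidean norm and Lebesgue measure. In position space a point is a
pair of Jacobi coordinates `(x, y)`, in momentum space a pair `(k, p)`. -/
abbrev R6 : Type := WithLp 2 (R3 × R3)

/-- The complex Hilbert space `L²(E)` with respect to Lebesgue measure. -/
abbrev L2 (E : Type) [NormedAddCommGroup E] [InnerProductSpace ℝ E] [FiniteDimensional ℝ E]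
    [MeasurableSpace E] [BorelSpace E] : Type :=
  Lp ℂ 2 (volume : Measure E)

section Fourier

variable {E : Type} [NormedAddCommGroup E] [InnerProductSpace ℝ E] [FiniteDimensional ℝ E]
  [MeasurableSpace E] [BorelSpace E]

theorem norm_sq_eq_integral (u : L2 E) : ‖u‖ ^ 2 = ∫ x, ‖u x‖ ^ 2 := by
  have h := @inner_self_eq_norm_sq_to_K ℂ (L2 E) _ _ _ u
  rw [L2.inner_def] at h
  have h2 : ∫ x, inner ℂ (u x) (u x) = ((∫ x, ‖u x‖ ^ 2 : ℝ) : ℂ) := by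
    rw [← integral_complex_ofReal]
    congr 1
    ext x
    rw [inner_self_eq_norm_sq_to_K]
    simp
  rw [h2] at h
  have h3 : ((‖u‖ ^ 2 : ℝ) : ℂ) = ((∫ x, ‖u x‖ ^ 2 : ℝ) : ℂ) := by
    rw [h]
    simp
  exact Complex.ofReal_injective h3

theorem memLp_comp_smul {c : ℝ} (hc : 0 < c) {u : E → ℂ} (hu : MemLp u 2 volume) :
    MemLp (fun x => u (c • x)) 2 volume := by
  have h : MemLp u 2 (Measure.map (fun x : E => c • x) volume) := by
    rw [Measure.map_addHaar_smul volume hc.ne']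
    exact hu.smul_measure ENNReal.ofReal_ne_top
  exact h.comp_of_map (measurable_const_smul c).aemeasurable

theorem ae_comp_smul {c : ℝ} (hc : 0 < c) {P : E → Prop} (h : ∀ᵐ x, P x) :
    ∀ᵐ x : E, P (c • x) :=
  (Measure.quasiMeasurePreserving_smul volume hc.ne').ae h

/-- The unitary dilation `u ↦ c^{n/2} u(c ·)` on `L²(E)`, `n = dim E`, as a linear map. -/
def dilationₗ (c : ℝ) (hc : 0 < c) : L2 E →ₗ[ℂ] L2 E where
  toFun u := MemLp.toLp (fun x => ((c ^ ((Module.finrank ℝ E : ℝ) / 2) : ℝ) : ℂ) * u (c • x))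
    ((memLp_comp_smul hc (Lp.memLp u)).const_mul _)
  map_add' u v := by
    rw [← MemLp.toLp_add]
    refine MemLp.toLp_congr _ _ ?_
    filter_upwards [ae_comp_smul hc (Lp.coeFn_add u v)] with x hx
    rw [hx, Pi.add_apply, Pi.add_apply, mul_add]
  map_smul' a u := by
    rw [RingHom.id_apply, ← MemLp.toLp_const_smul]
    refine MemLp.toLp_congr _ _ ?_
    filter_upwards [ae_comp_smul hc (Lp.coeFn_smul a u)] with x hx
    rw [hx, Pi.smul_apply, Pi.smul_apply, smul_eq_mul, smul_eq_mul, mul_left_comm]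

theorem coeFn_dilationₗ (c : ℝ) (hc : 0 < c) (u : L2 E) :
    dilationₗ c hc u =ᵐ[volume]
      fun x => ((c ^ ((Module.finrank ℝ E : ℝ) / 2) : ℝ) : ℂ) * u (c • x) :=
  MemLp.coeFn_toLp ((memLp_comp_smul hc (Lp.memLp u)).const_mul _)

theorem norm_dilationₗ (c : ℝ) (hc : 0 < c) (u : L2 E) : ‖dilationₗ c hc u‖ = ‖u‖ := by
  have h : ‖dilationₗ c hc u‖ ^ 2 = ‖u‖ ^ 2 := by
    rw [norm_sq_eq_integral, norm_sq_eq_integral]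
    have h1 : ∫ x, ‖dilationₗ c hc u x‖ ^ 2
        = ∫ x : E, (c ^ (Module.finrank ℝ E)) * ‖u (c • x)‖ ^ 2 := by
      refine integral_congr_ae ?_
      filter_upwards [coeFn_dilationₗ c hc u] with x hx
      rw [hx, norm_mul, mul_pow, Complex.norm_real, Real.norm_of_nonneg (by positivity),
        ← Real.rpow_natCast, ← Real.rpow_mul hc.le]
      norm_num
    rw [h1, integral_const_mul, Measure.integral_comp_smul volume (fun x => ‖u x‖ ^ 2) c,
      smul_eq_mul, abs_of_pos (by positivity), ← mul_assoc, mul_inv_cancel₀ (by positivity),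
      one_mul]
  exact (sq_eq_sq₀ (norm_nonneg _) (norm_nonneg _)).1 h

theorem dilationₗ_inv (c : ℝ) (hc : 0 < c) (u : L2 E) :
    dilationₗ c hc (dilationₗ c⁻¹ (inv_pos.2 hc) u) = u := by
  refine Lp.ext ?_
  filter_upwards [coeFn_dilationₗ c hc (dilationₗ c⁻¹ (inv_pos.2 hc) u),
    ae_comp_smul hc (coeFn_dilationₗ c⁻¹ (inv_pos.2 hc) u)] with x h1 h2
  rw [h1, h2, smul_smul, inv_mul_cancel₀ hc.ne', one_smul, ← mul_assoc, ← Complex.ofReal_mul,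
    ← Real.mul_rpow hc.le (inv_pos.2 hc).le, mul_inv_cancel₀ hc.ne', Real.one_rpow]
  simp

/-- The unitary dilation `u ↦ c^{n/2} u(c ·)` on `L²(E)`, `n = dim E`. -/
def dilation (c : ℝ) (hc : 0 < c) : L2 E ≃ₗᵢ[ℂ] L2 E :=
  LinearIsometryEquiv.ofSurjective ⟨dilationₗ c hc, norm_dilationₗ c hc⟩
    fun u => ⟨_, dilationₗ_inv c hc u⟩

/-- The unitary Fourier transform on `L²(E)` in the normalization
`û(k) = (2π)^{-n/2} ∫ e^{-i k·x} u(x) dx`, `n = dim E`. It is obtained from Mathlib's transform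
`𝓕 u (κ) = ∫ e^{-2πi κ·x} u(x) dx` by `û(k) = (2π)^{-n/2} (𝓕 u)(k / 2π)`. -/
def ft : L2 E ≃ₗᵢ[ℂ] L2 E :=
  (Lp.fourierTransformₗᵢ E ℂ).trans (dilation (2 * Real.pi)⁻¹ (by positivity))

theorem ft_add_ae (u v : L2 E) : ft (u + v) =ᵐ[volume] fun k => ft u k + ft v k := by
  rw [map_add]
  exact Lp.coeFn_add _ _

theorem ft_smul_ae (a : ℂ) (u : L2 E) : ft (a • u) =ᵐ[volume] fun k => a * ft u k := by
  rw [map_smul]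
  exact Lp.coeFn_smul _ _

theorem ft_zero_ae : ft (0 : L2 E) =ᵐ[volume] fun _ => 0 := by
  rw [map_zero]
  exact Lp.coeFn_zero _ _ _

theorem measurePreserving_of_involutive (T : E →ₗ[ℝ] E) (hT : T ∘ₗ T = LinearMap.id) :
    MeasurePreserving T volume volume := by
  have hdet : LinearMap.det T * LinearMap.det T = 1 := by
    rw [← LinearMap.det_comp, hT, LinearMap.det_id]
  have h0 : LinearMap.det T ≠ 0 := fun h => by simp [h] at hdet
  have habs : |(LinearMap.det T)⁻¹| = 1 := by
    rcases mul_self_eq_one_iff.1 hdet with h | h <;> simp [h]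
  refine ⟨T.continuous_of_finiteDimensional.measurable, ?_⟩
  rw [Measure.map_linearMap_addHaar_eq_smul_addHaar volume h0, habs]
  simp

/-- `u ∈ H^s(E)`, for `u ∈ L²(E)`. -/
def InSobolev (s : ℝ) (u : L2 E) : Prop :=
  TemperedDistribution.MemSobolev s 2 (u : TemperedDistribution E ℂ)

end Fourier

/-! ### Bosonic symmetry -/

theorem R6.ext {z z' : R6} (h1 : z.fst = z'.fst) (h2 : z.snd = z'.snd) : z = z' := by
  refine WithLp.ofLp_injective 2 (Prod.ext ?_ ?_)
  · exact h1
  · exact h2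

/-- `(x, y) ↦ (-x, y)`. -/
def reflection : R6 →ₗ[ℝ] R6 where
  toFun z := WithLp.toLp 2 (-z.fst, z.snd)
  map_add' z z' := R6.ext (by simp; module) (by simp)
  map_smul' a z := R6.ext (by simp) (by simp)

/-- `(x, y) ↦ (x/2 + y, 3x/4 - y/2)`. -/
def exchange : R6 →ₗ[ℝ] R6 where
  toFun z := WithLp.toLp 2
    ((1 / 2 : ℝ) • z.fst + z.snd, (3 / 4 : ℝ) • z.fst - (1 / 2 : ℝ) • z.snd)
  map_add' z z' := R6.ext (by simp; module) (by simp; module)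
  map_smul' a z := R6.ext (by simp; module) (by simp; module)

/-- `(k, p) ↦ (k/2 + 3p/4, k - p/2)`, the transpose of `exchange`. -/
def momentumExchange : R6 →ₗ[ℝ] R6 where
  toFun z := WithLp.toLp 2
    ((1 / 2 : ℝ) • z.fst + (3 / 4 : ℝ) • z.snd, z.fst - (1 / 2 : ℝ) • z.snd)
  map_add' z z' := R6.ext (by simp; module) (by simp; module)
  map_smul' a z := R6.ext (by simp; module) (by simp; module)

theorem measurePreserving_reflection : MeasurePreserving reflection volume volume :=
  measurePreserving_of_involutive _ (LinearMap.ext fun z => R6.ext (by simp [reflection]) (by simp [reflection]))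

theorem measurePreserving_exchange : MeasurePreserving exchange volume volume :=
  measurePreserving_of_involutive _ (LinearMap.ext fun z => R6.ext
    (by simp only [exchange, LinearMap.comp_apply, LinearMap.coe_mk, AddHom.coe_mk, WithLp.toLp_fst,
          WithLp.toLp_snd, LinearMap.id_apply]
        module)
    (by simp only [exchange, LinearMap.comp_apply, LinearMap.coe_mk, AddHom.coe_mk, WithLp.toLp_fst,
          WithLp.toLp_snd, LinearMap.id_apply]
        module))

theorem measurePreserving_momentumExchange : MeasurePreserving momentumExchange volume volume :=
  measurePreserving_of_involutive _ (LinearMap.ext fun z => R6.ext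
    (by simp only [momentumExchange, LinearMap.comp_apply, LinearMap.coe_mk, AddHom.coe_mk, WithLp.toLp_fst,
          WithLp.toLp_snd, LinearMap.id_apply]
        module)
    (by simp only [momentumExchange, LinearMap.comp_apply, LinearMap.coe_mk, AddHom.coe_mk, WithLp.toLp_fst,
          WithLp.toLp_snd, LinearMap.id_apply]
        module))

/-- The bosonic space `L²_sym(ℝ⁶)`: those `ψ ∈ L²(ℝ⁶)` with
`ψ(x, y) = ψ(-x, y) = ψ(x/2 + y, 3x/4 - y/2)` for almost every `(x, y)`. -/
def L2sym : Submodule ℂ (L2 R6) where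
  carrier := {ψ | (∀ᵐ z, ψ (reflection z) = ψ z) ∧ ∀ᵐ z, ψ (exchange z) = ψ z}
  add_mem' := by
    rintro u v ⟨hu1, hu2⟩ ⟨hv1, hv2⟩
    constructor
    · filter_upwards [hu1, hv1, Lp.coeFn_add u v,
        measurePreserving_reflection.quasiMeasurePreserving.ae (Lp.coeFn_add u v)] with z a b c d
      rw [c, d, Pi.add_apply, Pi.add_apply, a, b]
    · filter_upwards [hu2, hv2, Lp.coeFn_add u v,
        measurePreserving_exchange.quasiMeasurePreserving.ae (Lp.coeFn_add u v)] with z a b c d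
      rw [c, d, Pi.add_apply, Pi.add_apply, a, b]
  zero_mem' := by
    have h := Lp.coeFn_zero ℂ 2 (volume : Measure R6)
    constructor
    · filter_upwards [h, measurePreserving_reflection.quasiMeasurePreserving.ae h] with z a b
      rw [a, b, Pi.zero_apply, Pi.zero_apply]
    · filter_upwards [h, measurePreserving_exchange.quasiMeasurePreserving.ae h] with z a b
      rw [a, b, Pi.zero_apply, Pi.zero_apply]
  smul_mem' := by
    rintro t u ⟨hu1, hu2⟩
    constructor
    · filter_upwards [hu1, Lp.coeFn_smul t u,
        measurePreserving_reflection.quasiMeasurePreserving.ae (Lp.coeFn_smul t u)] with z a c d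
      rw [c, d, Pi.smul_apply, Pi.smul_apply, a]
    · filter_upwards [hu2, Lp.coeFn_smul t u,
        measurePreserving_exchange.quasiMeasurePreserving.ae (Lp.coeFn_smul t u)] with z a c d
      rw [c, d, Pi.smul_apply, Pi.smul_apply, a]

theorem isClosed_invariant {T : R6 → R6} (hT : MeasurePreserving T volume volume) :
    IsClosed {ψ : L2 R6 | ∀ᵐ z, ψ (T z) = ψ z} := by
  have h : {ψ : L2 R6 | ∀ᵐ z, ψ (T z) = ψ z} = {ψ | Lp.compMeasurePreserving T hT ψ = ψ} := by
    ext ψ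
    have hc := Lp.coeFn_compMeasurePreserving ψ hT
    constructor
    · intro h
      refine Lp.ext ?_
      filter_upwards [h, hc] with z a b
      rw [b, Function.comp_apply, a]
    · intro h
      rw [Set.mem_ofPred_eq] at h
      rw [h] at hc
      filter_upwards [hc] with z b
      rw [b, Function.comp_apply]
  rw [h]
  exact isClosed_eq (Lp.isometry_compMeasurePreserving hT).continuous continuous_id

theorem isClosed_L2sym : IsClosed (L2sym : Set (L2 R6)) :=
  (isClosed_invariant measurePreserving_reflection).inter
    (isClosed_invariant measurePreserving_exchange)

instance : CompleteSpace L2sym := isClosed_L2sym.completeSpace_coe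

/-! ### The free Hamiltonian -/

/-- The symbol `k² + (3/4) p²` of the free Hamiltonian. -/
def freeSymbol (z : R6) : ℝ := ‖z.fst‖ ^ 2 + 3 / 4 * ‖z.snd‖ ^ 2

theorem continuous_freeSymbol : Continuous freeSymbol := by
  unfold freeSymbol
  fun_prop

theorem freeSymbol_nonneg (z : R6) : 0 ≤ freeSymbol z := by
  unfold freeSymbol
  positivity

/-- The natural domain `{w : (k² + (3/4) p²) ŵ ∈ L²} = H²(ℝ⁶)` of the free Hamiltonian. -/
def freeDomain : Submodule ℂ (L2 R6) where
  carrier := {w | MemLp (fun z => (freeSymbol z : ℂ) * ft w z) 2 volume}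
  add_mem' := by
    intro u v hu hv
    refine (memLp_congr_ae ?_).1 (MemLp.add hu hv)
    filter_upwards [ft_add_ae u v] with z hz
    rw [hz, Pi.add_apply, mul_add]
  zero_mem' := by
    refine (memLp_congr_ae ?_).1 (MemLp.zero' (p := 2) (μ := (volume : Measure R6)))
    filter_upwards [ft_zero_ae (E := R6)] with z hz
    rw [hz, mul_zero]
  smul_mem' := by
    intro a u hu
    refine (memLp_congr_ae ?_).1 (MemLp.const_smul hu a)
    filter_upwards [ft_smul_ae a u] with z hz
    rw [hz, Pi.smul_apply, smul_eq_mul, mul_left_comm]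

theorem memLp_of_mem_freeDomain {w : L2 R6} (hw : w ∈ freeDomain) :
    MemLp (fun z => (freeSymbol z : ℂ) * ft w z) 2 volume := hw

/-- Multiplication of `ŵ` by `k² + (3/4) p²`. -/
def freeMul (w : freeDomain) : L2 R6 :=
  MemLp.toLp (fun z => (freeSymbol z : ℂ) * ft (w : L2 R6) z) (memLp_of_mem_freeDomain w.2)

theorem freeMul_add (u v : freeDomain) : freeMul (u + v) = freeMul u + freeMul v := by
  unfold freeMul
  rw [← MemLp.toLp_add]
  refine MemLp.toLp_congr _ _ ?_
  filter_upwards [ft_add_ae (u : L2 R6) (v : L2 R6)] with z hz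
  rw [Submodule.coe_add, hz, Pi.add_apply, mul_add]

theorem freeMul_smul (a : ℂ) (u : freeDomain) : freeMul (a • u) = a • freeMul u := by
  unfold freeMul
  rw [← MemLp.toLp_const_smul]
  refine MemLp.toLp_congr _ _ ?_
  filter_upwards [ft_smul_ae a (u : L2 R6)] with z hz
  rw [Submodule.coe_smul, hz, Pi.smul_apply, smul_eq_mul, mul_left_comm]

/-- The free Hamiltonian `H₀ = -Δ_x - (3/4) Δ_y` in `L²(ℝ⁶)`, which acts in momentum space as
multiplication by `k² + (3/4) p²`. -/
def H0 : L2 R6 →ₗ.[ℂ] L2 R6 where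
  domain := freeDomain
  toFun :=
    { toFun := fun w => ft.symm (freeMul w)
      map_add' := fun u v => by rw [freeMul_add, map_add]
      map_smul' := fun a u => by rw [freeMul_smul, map_smul, RingHom.id_apply] }

variable {lam : ℝ}

theorem memLp_freeResolvent (hlam : 0 < lam) {u : R6 → ℂ} (hu : MemLp u 2 volume) :
    MemLp (fun z => u z / ((freeSymbol z + lam : ℝ) : ℂ)) 2 volume := by
  have hc : Continuous fun z : R6 => (((freeSymbol z + lam : ℝ) : ℂ))⁻¹ := by
    refine Continuous.inv₀ (by have := continuous_freeSymbol; fun_prop) fun z => ?_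
    have := freeSymbol_nonneg z
    exact_mod_cast (by linarith : freeSymbol z + lam ≠ 0)
  refine MemLp.of_le_mul (c := lam⁻¹) hu ?_ (Filter.Eventually.of_forall fun z => ?_)
  · simp only [div_eq_mul_inv]
    exact hu.1.mul hc.aestronglyMeasurable
  · have := freeSymbol_nonneg z
    rw [norm_div, Complex.norm_real, Real.norm_of_nonneg (by linarith), div_eq_inv_mul]
    gcongr
    linarith

/-- The free resolvent `R₀^λ = (H₀ + λ)⁻¹`, `λ > 0`. -/
def freeResolvent (hlam : 0 < lam) (f : L2 R6) : L2 R6 :=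
  ft.symm (MemLp.toLp _ (memLp_freeResolvent hlam (Lp.memLp (ft f))))

/-! ### Potentials of charges on the coincidence hyperplanes -/

theorem integrable_inv_sq (hlam : 0 < lam) :
    Integrable (fun k : R3 => ((‖k‖ ^ 2 + lam)⁻¹) ^ 2) volume := by
  have h : Integrable (fun k : R3 => (1 + ‖k‖ ^ 2) ^ (-(4 : ℝ) / 2)) volume :=
    integrable_rpow_neg_one_add_norm_sq (by simp; norm_num)
  have hc : Continuous fun k : R3 => ((‖k‖ ^ 2 + lam)⁻¹) ^ 2 := by
    refine (Continuous.inv₀ (by fun_prop) fun k => ?_).pow 2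
    positivity
  refine (h.const_mul ((1 + lam⁻¹) ^ 2)).mono' hc.aestronglyMeasurable
    (Filter.Eventually.of_forall fun k => ?_)
  have e : (1 + ‖k‖ ^ 2 : ℝ) ^ (-(4 : ℝ) / 2) = ((1 + ‖k‖ ^ 2)⁻¹) ^ 2 := by
    rw [show (-(4 : ℝ) / 2) = -((2 : ℕ) : ℝ) by norm_num,
      Real.rpow_neg (by positivity), Real.rpow_natCast, inv_pow]
  rw [e, Real.norm_of_nonneg (by positivity), ← mul_pow]
  gcongr
  rw [← div_eq_mul_inv, inv_le_comm₀ (by positivity) (by positivity), inv_div,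
    div_le_iff₀ (by positivity)]
  have : 0 ≤ lam⁻¹ * ‖k‖ ^ 2 := by positivity
  have h2 : lam * lam⁻¹ = 1 := mul_inv_cancel₀ hlam.ne'
  nlinarith [sq_nonneg ‖k‖]

/-- The function `(k, p) ↦ √(2/π) u(p) / (k² + (3/4) p² + λ)`. -/
def layer (lam : ℝ) (u : R3 → ℂ) (z : R6) : ℂ :=
  (Real.sqrt (2 / Real.pi) : ℂ) * u z.snd / ((freeSymbol z + lam : ℝ) : ℂ)

theorem norm_layer_sq_le (hlam : 0 < lam) (u : R3 → ℂ) (z : R6) :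
    ‖layer lam u z‖ ^ 2 ≤ 2 / Real.pi * ((‖z.fst‖ ^ 2 + lam)⁻¹ ^ 2 * ‖u z.snd‖ ^ 2) := by
  have h0 := freeSymbol_nonneg z
  have h1 : ‖layer lam u z‖ =
      Real.sqrt (2 / Real.pi) * ((freeSymbol z + lam)⁻¹ * ‖u z.snd‖) := by
    rw [layer, norm_div, norm_mul, Complex.norm_real, Complex.norm_real,
      Real.norm_of_nonneg (by positivity), Real.norm_of_nonneg (by positivity)]
    ring
  rw [h1, mul_pow, mul_pow, Real.sq_sqrt (by positivity)]
  gcongr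
  unfold freeSymbol
  nlinarith [sq_nonneg ‖z.snd‖]

theorem integrable_layer_bound (hlam : 0 < lam) {u : R3 → ℂ} (hu : MemLp u 2 volume) :
    Integrable (fun z : R6 => (‖z.fst‖ ^ 2 + lam)⁻¹ ^ 2 * ‖u z.snd‖ ^ 2) volume := by
  have h := (integrable_inv_sq hlam).mul_prod ((memLp_two_iff_integrable_sq_norm hu.1).1 hu)
  exact (WithLp.volume_preserving_ofLp R3 R3).integrable_comp_of_integrable h

theorem memLp_layer (hlam : 0 < lam) {u : R3 → ℂ} (hu : MemLp u 2 volume) :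
    MemLp (layer lam u) 2 volume := by
  have hm : AEStronglyMeasurable (layer lam u) volume := by
    have h1 : AEStronglyMeasurable (fun z : R6 => u z.snd) volume :=
      (hu.1.comp_snd (μ := (volume : Measure R3))).comp_measurePreserving
        (WithLp.volume_preserving_ofLp R3 R3)
    have hc : Continuous fun z : R6 => (((freeSymbol z + lam : ℝ) : ℂ))⁻¹ := by
      refine Continuous.inv₀ (by have := continuous_freeSymbol; fun_prop) fun z => ?_
      have := freeSymbol_nonneg z
      exact_mod_cast (by linarith : freeSymbol z + lam ≠ 0)
    exact (h1.const_mul _).mul hc.aestronglyMeasurable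
  rw [memLp_two_iff_integrable_sq_norm hm]
  refine ((integrable_layer_bound hlam hu).const_mul (2 / Real.pi)).mono' (hm.norm.pow 2)
    (Filter.Eventually.of_forall fun z => ?_)
  rw [Real.norm_of_nonneg (by positivity)]
  exact norm_layer_sq_le hlam u z

theorem ae_comp_snd {P : R3 → Prop} (h : ∀ᵐ p, P p) : ∀ᵐ z : R6, P z.snd :=
  (Measure.quasiMeasurePreserving_snd.comp
    (WithLp.volume_preserving_ofLp R3 R3).quasiMeasurePreserving).ae h

/-- `layer` as a map between `L²` spaces. -/
def layerLp (hlam : 0 < lam) (u : L2 R3) : L2 R6 :=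
  MemLp.toLp (layer lam u) (memLp_layer hlam (Lp.memLp u))

theorem coeFn_layerLp (hlam : 0 < lam) (u : L2 R3) :
    layerLp hlam u =ᵐ[volume] layer lam u :=
  MemLp.coeFn_toLp (memLp_layer hlam (Lp.memLp u))

theorem layerLp_add (hlam : 0 < lam) (u v : L2 R3) :
    layerLp hlam (u + v) = layerLp hlam u + layerLp hlam v := by
  unfold layerLp
  rw [← MemLp.toLp_add]
  refine MemLp.toLp_congr _ _ ?_
  filter_upwards [ae_comp_snd (Lp.coeFn_add u v)] with z hz
  rw [Pi.add_apply, layer, layer, layer, hz, Pi.add_apply]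
  ring

theorem layerLp_smul (hlam : 0 < lam) (a : ℂ) (u : L2 R3) :
    layerLp hlam (a • u) = a • layerLp hlam u := by
  unfold layerLp
  rw [← MemLp.toLp_const_smul]
  refine MemLp.toLp_congr _ _ ?_
  filter_upwards [ae_comp_snd (Lp.coeFn_smul a u)] with z hz
  rw [Pi.smul_apply, layer, layer, hz, Pi.smul_apply, smul_eq_mul, smul_eq_mul]
  ring

theorem norm_layerLp_le (hlam : 0 < lam) (u : L2 R3) :
    ‖layerLp hlam u‖ ≤
      Real.sqrt (2 / Real.pi * ∫ k : R3, ((‖k‖ ^ 2 + lam)⁻¹) ^ 2) * ‖u‖ := by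
  have hA : 0 ≤ ∫ k : R3, ((‖k‖ ^ 2 + lam)⁻¹) ^ 2 := integral_nonneg fun k => by positivity
  have hu := Lp.memLp u
  have hb := integrable_layer_bound hlam hu
  have hprod : ∫ z : R6, (‖z.fst‖ ^ 2 + lam)⁻¹ ^ 2 * ‖u z.snd‖ ^ 2 =
      (∫ k : R3, ((‖k‖ ^ 2 + lam)⁻¹) ^ 2) * ∫ p : R3, ‖u p‖ ^ 2 := by
    rw [← integral_prod_mul]
    exact (WithLp.volume_preserving_ofLp R3 R3).integral_comp
      (MeasurableEquiv.toLp 2 (R3 × R3)).symm.measurableEmbedding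
      (fun w : R3 × R3 => (‖w.1‖ ^ 2 + lam)⁻¹ ^ 2 * ‖u w.2‖ ^ 2)
  have hmain : ‖layerLp hlam u‖ ^ 2 ≤
      2 / Real.pi * ((∫ k : R3, ((‖k‖ ^ 2 + lam)⁻¹) ^ 2) * ‖u‖ ^ 2) := by
    rw [norm_sq_eq_integral u, ← hprod, norm_sq_eq_integral, ← integral_const_mul]
    refine integral_mono_of_nonneg (Filter.Eventually.of_forall fun z => by positivity)
      (hb.const_mul _) ?_
    filter_upwards [coeFn_layerLp hlam u] with z hz
    rw [hz]
    exact norm_layer_sq_le hlam _ z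
  refine (sq_le_sq₀ (norm_nonneg _) (by positivity)).1 ?_
  rw [mul_pow, Real.sq_sqrt (by positivity), mul_assoc]
  exact hmain

/-- The operator `G^λ = 𝒢₂₃^λ : L²(ℝ³) → L²(ℝ⁶)`, `λ > 0`, given in momentum space by
`ξ̂ ↦ √(2/π) ξ̂(p) / (k² + (3/4) p² + λ)`. -/
def G23 (hlam : 0 < lam) : L2 R3 →L[ℂ] L2 R6 :=
  LinearMap.mkContinuous
    { toFun := fun ξ => ft.symm (layerLp hlam (ft ξ))
      map_add' := fun u v => by rw [map_add, layerLp_add, map_add]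
      map_smul' := fun a u => by rw [map_smul, layerLp_smul, map_smul, RingHom.id_apply] }
    (Real.sqrt (2 / Real.pi * ∫ k : R3, ((‖k‖ ^ 2 + lam)⁻¹) ^ 2))
    fun ξ => by
      have h := norm_layerLp_le hlam (ft ξ)
      rw [LinearIsometryEquiv.norm_map] at h
      simpa using h

/-- The potential of the three charges in momentum space,
`(k, p) ↦ √(2/π) (u(p) + u(k - p/2) + u(-k - p/2)) / (k² + (3/4) p² + λ)`. -/
def potentialFun (lam : ℝ) (u : R3 → ℂ) (z : R6) : ℂ :=
  (Real.sqrt (2 / Real.pi) : ℂ) *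
    (u z.snd + u (z.fst - (1 / 2 : ℝ) • z.snd) + u (-z.fst - (1 / 2 : ℝ) • z.snd)) /
    ((freeSymbol z + lam : ℝ) : ℂ)

theorem freeSymbol_momentumExchange (z : R6) :
    freeSymbol (momentumExchange z) = freeSymbol z := by
  simp only [freeSymbol, momentumExchange, LinearMap.coe_mk, AddHom.coe_mk, WithLp.toLp_fst,
    WithLp.toLp_snd]
  rw [norm_add_sq_real, norm_sub_sq_real, norm_smul, norm_smul, norm_smul]
  simp only [inner_smul_left, inner_smul_right, mul_pow]
  norm_num
  ring

theorem freeSymbol_reflection (z : R6) : freeSymbol (reflection z) = freeSymbol z := by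
  simp [freeSymbol, reflection]

theorem memLp_potentialFun (hlam : 0 < lam) {u : R3 → ℂ} (hu : MemLp u 2 volume) :
    MemLp (potentialFun lam u) 2 volume := by
  have h1 := memLp_layer hlam hu
  have h2 := h1.comp_measurePreserving measurePreserving_momentumExchange
  have h3 := h2.comp_measurePreserving measurePreserving_reflection
  have e : potentialFun lam u = layer lam u + layer lam u ∘ momentumExchange +
      (layer lam u ∘ momentumExchange) ∘ reflection := by
    funext z
    simp only [Pi.add_apply, Function.comp_apply, layer, freeSymbol_momentumExchange,
      freeSymbol_reflection, potentialFun]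
    simp only [momentumExchange, reflection, LinearMap.coe_mk, AddHom.coe_mk, WithLp.toLp_fst,
      WithLp.toLp_snd]
    ring
  rw [e]
  exact (h1.add h2).add h3

/-- The potential `𝒢^λ ξ ∈ L²(ℝ⁶)` produced by the charge `ξ ∈ L²(ℝ³)` placed on the three
coincidence hyperplanes, `λ > 0`. -/
def potential (hlam : 0 < lam) (ξ : L2 R3) : L2 R6 :=
  ft.symm (MemLp.toLp _ (memLp_potentialFun hlam (Lp.memLp (ft ξ))))

/-- `τ ∈ L²(ℝ³)` is the trace `w(0, ·)` of `w ∈ H²(ℝ⁶)` on `π₂₃ = {x = 0}`: by Fourier inversion in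
the first variable, `τ̂(p) = (2π)^{-3/2} ∫ ŵ(k, p) dk`. -/
def IsTrace23 (w : L2 R6) (τ : L2 R3) : Prop :=
  ∀ᵐ p : R3, ft τ p =
    (((2 * Real.pi) ^ (-(3 / 2) : ℝ) : ℝ) : ℂ) * ∫ k : R3, ft w (WithLp.toLp 2 (k, p))

/-! ### The quadratic forms (as sesquilinear forms, antilinear in the first argument) -/

/-- The hypothesis on the cut-off: `θ ∈ L^∞(ℝ⁺)` and `|θ(r) - 1| ≤ c r` for some `c > 0`. -/
def CutoffHypothesis (θ : ℝ → ℝ) : Prop :=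
  MemLp θ ∞ (volume.restrict (Set.Ioi 0)) ∧
    ∃ c > 0, ∀ᵐ r ∂(volume.restrict (Set.Ioi (0 : ℝ))), |θ r - 1| ≤ c * r

/-- The threshold `γ_c = (√3/π) (4π/(3√3) - 1)`. -/
def gammaC : ℝ :=
  Real.sqrt 3 / Real.pi * (4 * Real.pi / (3 * Real.sqrt 3) - 1)

/-- The form `Φ^λ(η, ξ)` on `H^{1/2}(ℝ³)`. The last integral is `(η, Γ_reg ξ)`, `Γ_reg` being the
operator of multiplication by `β + γ θ(y) / y` in position space. -/
def PhiForm (β γ : ℝ) (θ : ℝ → ℝ) (lam : ℝ) (η ξ : L2 R3) : ℂ :=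
  (∫ p : R3, conj (ft η p) *
    ((Real.sqrt (3 / 4 * ‖p‖ ^ 2 + lam) : ℂ) * ft ξ p
      - 1 / (Real.pi : ℂ) ^ 2 *
        ∫ q : R3, ft ξ q / ((‖p‖ ^ 2 + ‖q‖ ^ 2 + inner ℝ p q + lam : ℝ) : ℂ)))
  + ∫ y : R3, conj (η y) * (((β + γ / ‖y‖ * θ ‖y‖ : ℝ) : ℂ) * ξ y)

/-- The form `𝓕^λ(v, w) = ∫ (k² + (3/4) p² + λ) conj(v̂) ŵ` on `H¹(ℝ⁶)`. -/
def freeForm (lam : ℝ) (v w : L2 R6) : ℂ :=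
  ∫ z : R6, ((freeSymbol z + lam : ℝ) : ℂ) * (conj (ft v z) * ft w z)

/-- `ψ = w + 𝒢^λ ξ` with `w ∈ H¹(ℝ⁶)` and `ξ ∈ H^{1/2}(ℝ³)`. -/
def IsDecomposition (hlam : 0 < lam) (ψ w : L2 R6) (ξ : L2 R3) : Prop :=
  InSobolev 1 w ∧ InSobolev (1 / 2) ξ ∧ ψ = w + potential hlam ξ

/-- The form domain `𝒟(F)`, as a subset of `L²_sym(ℝ⁶)`. -/
def formDomain (hlam : 0 < lam) : Set L2sym :=
  {ψ | ∃ w ξ, IsDecomposition hlam ψ w ξ}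

/-- The charge `ξ` in the decomposition `ψ = w^λ + 𝒢^λ ξ` of `ψ ∈ 𝒟(F)`, which is unique. -/
def charge (hlam : 0 < lam) (ψ : L2sym) : L2 R3 :=
  Classical.epsilon fun ξ => IsDecomposition hlam ψ (ψ - potential hlam ξ) ξ

/-- The regular part `w^λ` in the decomposition `ψ = w^λ + 𝒢^λ ξ` of `ψ ∈ 𝒟(F)`. -/
def regularPart (hlam : 0 < lam) (ψ : L2sym) : L2 R6 :=
  ψ - potential hlam (charge hlam ψ)

/-- The form `F(v, ψ) = 𝓕^λ(w_v^λ, w^λ) - λ (v, ψ) + 12π Φ^λ(ξ_v, ξ)` on `𝒟(F)`. -/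
def energyForm (β γ : ℝ) (θ : ℝ → ℝ) (hlam : 0 < lam) (v ψ : L2sym) : ℂ :=
  freeForm lam (regularPart hlam v) (regularPart hlam ψ) - (lam : ℂ) * inner ℂ v ψ
    + 12 * (Real.pi : ℂ) * PhiForm β γ θ lam (charge hlam v) (charge hlam ψ)

/-! ### Operators and forms -/

section Operators

variable {K : Type} [NormedAddCommGroup K] [InnerProductSpace ℂ K]

/-- `T` is the operator associated with the form `B` on the domain `D`: a vector `ψ` is in the domain
of `T` with `T ψ = f` if and only if `ψ ∈ D` and `B(v, ψ) = (v, f)` for all `v ∈ D`. -/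
def IsOperatorOfForm (D : Set K) (B : K → K → ℂ) (T : K →ₗ.[ℂ] K) : Prop :=
  ∀ ψ f : K, (ψ, f) ∈ T.graph ↔ ψ ∈ D ∧ ∀ v ∈ D, B v ψ = inner ℂ v f

/-- `m ‖ψ‖² ≤ (ψ, T ψ)` for all `ψ` in the domain of `T`. -/
def IsBoundedBelowBy (T : K →ₗ.[ℂ] K) (m : ℝ) : Prop :=
  ∀ ψ : T.domain, m * ‖(ψ : K)‖ ^ 2 ≤ (inner ℂ (ψ : K) (T ψ)).re

/-- `R` is the bounded inverse of `T + μ`, a bijection of the domain of `T` onto the space. -/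
def IsBoundedInverse (T : K →ₗ.[ℂ] K) (μ : ℝ) (R : K →L[ℂ] K) : Prop :=
  (∀ f : K, ∃ h : R f ∈ T.domain, T ⟨R f, h⟩ + (μ : ℂ) • R f = f) ∧
    ∀ ψ : T.domain, R (T ψ + (μ : ℂ) • (ψ : K)) = ψ

end Operators

end ThreeBosons

end

open ThreeBosons

/-! For ψ = w + 𝒢^λ ξ the form F(ψ, ψ) + λ‖ψ‖² is the free energy of w, at least λ‖w‖², plus 12π
Φ^λ(ξ, ξ). Everything therefore rests on the coercivity of Φ^λ on H^{1/2} for large λ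
(`PhiForm_coercive`); the operators then come from Lax–Milgram and are handled through their
inverses (`SolvableForm`).

Coercivity. The diagonal part of Φ^λ has the symbol √(3p²/4 + λ), which grows like (√3/2)|p|. The
exchange term X = π⁻² ∬ conj ξ̂(p) ξ̂(q) / (Q(p, q) + λ), with Q(p, q) = p² + q² + p·q, enters with
a minus sign and is bounded twice by Schur's test. In momentum space the weight |q|⁻² gives |X| ≤
(2π/3) ∫ |p| |ξ̂|² (`schur_momentum`). In position space, 1/(Q + λ) is written as a Laplace
transform of Gaussians; this dominates X by the kernel √3 π⁻² Q(x, y)⁻², and the weight 1/|y| gives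
|X| ≤ (4/3) ∫ |ξ|²/|x| (`schur_position`, `enorm_integral_div_pairForm_le_coulomb`). A share t of X
is charged to the repulsion γ/|y| and the share 1 - t to the kinetic part. The first is affordable
for t ≤ 3γ/4, the second for (1 - t) 2π/3 < √3/2; with t = 3γ/4 the latter says γ > 4/3 - √3/π =
γ_c. The errors due to β and to θ - 1 are bounded and are absorbed by λ. Kato's inequality
(`lintegral_coulomb_le`) keeps all terms finite on H^{1/2}.

Resolvent. The vector with regular part R₀f, R₀ = (H₀ + λ)⁻¹, and charge (4π)⁻¹ (Γ^λ)⁻¹ G* f solves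
F(v, ·) + λ(v, ·) = (v, f): the free form of R₀f against w_v is (w_v, f), and 12π · (4π)⁻¹ = 3
counts the coincidence planes, which contribute equally against a symmetric f
(`energyForm_resolventMap`). The range of this map is the stated domain, because (4π)⁻¹ G* f is the
trace of R₀f on x = 0 (`isTrace23_freeResolvent_iff`).

Uniqueness and independence of λ. A potential lies in H¹ only if its charge vanishes, because ∫
dk/(k² + c) diverges in three dimensions (`eq_zero_of_inSobolev_potential`). The forms for λ and μ
agree by the resolvent identity for potentials together with 12π (Φ^μ - Φ^λ)(η, ξ) = (μ - λ)(𝒢^λ η,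
𝒢^μ ξ) (`PhiForm_sub_PhiForm`). -/

open MeasureTheory
open scoped ENNReal ComplexConjugate

noncomputable section

namespace ThreeBosons

/-! ### Operators with a given resolvent, and operators of coercive forms -/

section Abstract

variable {K : Type} [NormedAddCommGroup K] [InnerProductSpace ℂ K]

/-- The operator `R⁻¹ - μ` for an injective bounded operator `R`. -/
def opOfResolvent (R : K →L[ℂ] K) (hR : Function.Injective R) (μ : ℝ) : K →ₗ.[ℂ] K where
  domain := LinearMap.range (R : K →ₗ[ℂ] K)
  toFun := ((LinearEquiv.ofInjective (R : K →ₗ[ℂ] K) hR).symm : _ →ₗ[ℂ] K) -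
    (μ : ℂ) • (LinearMap.range (R : K →ₗ[ℂ] K)).subtype

theorem mem_domain_opOfResolvent (R : K →L[ℂ] K) (hR : Function.Injective R) (μ : ℝ) (f : K) :
    R f ∈ (opOfResolvent R hR μ).domain := ⟨f, rfl⟩

theorem opOfResolvent_apply (R : K →L[ℂ] K) (hR : Function.Injective R) (μ : ℝ) (f : K)
    (h : R f ∈ (opOfResolvent R hR μ).domain) :
    opOfResolvent R hR μ ⟨R f, h⟩ = f - (μ : ℂ) • R f := by
  have e : (LinearEquiv.ofInjective (R : K →ₗ[ℂ] K) hR).symm ⟨R f, h⟩ = f := by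
    rw [LinearEquiv.symm_apply_eq]
    rfl
  change (LinearEquiv.ofInjective (R : K →ₗ[ℂ] K) hR).symm ⟨R f, h⟩ - (μ : ℂ) • R f = _
  rw [e]

theorem mem_graph_opOfResolvent (R : K →L[ℂ] K) (hR : Function.Injective R) (μ : ℝ) (ψ f : K) :
    (ψ, f) ∈ (opOfResolvent R hR μ).graph ↔ ψ = R (f + (μ : ℂ) • ψ) := by
  rw [LinearPMap.mem_graph_iff]
  constructor
  · rintro ⟨⟨y, g, rfl⟩, h1, h2⟩
    have h3 := opOfResolvent_apply R hR μ g ⟨g, rfl⟩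
    simp only [ContinuousLinearMap.coe_coe] at h1 h2 h3
    rw [h3] at h2
    rw [← h1, ← h2]
    congr 1
    abel
  · intro h
    refine ⟨⟨R (f + (μ : ℂ) • ψ), mem_domain_opOfResolvent R hR μ _⟩, h.symm, ?_⟩
    rw [opOfResolvent_apply, ← h]
    simp

theorem isBoundedInverse_opOfResolvent (R : K →L[ℂ] K) (hR : Function.Injective R) (μ : ℝ) :
    IsBoundedInverse (opOfResolvent R hR μ) μ R := by
  constructor
  · intro f
    refine ⟨mem_domain_opOfResolvent R hR μ f, ?_⟩
    rw [opOfResolvent_apply]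
    simp
  · rintro ⟨_, g, rfl⟩
    have h3 := opOfResolvent_apply R hR μ g ⟨g, rfl⟩
    simp only [ContinuousLinearMap.coe_coe] at h3 ⊢
    rw [h3]
    simp

/-- The symmetry of R makes R⁻¹ - μ formally self-adjoint, and its adjoint has no larger domain: if
y lies in the adjoint domain, then testing against R f shows that y itself is a value of R. -/
theorem isSelfAdjoint_opOfResolvent [CompleteSpace K] (R : K →L[ℂ] K)
    (hR : Function.Injective R) (μ : ℝ) (hsymm : ∀ f g : K, inner ℂ (R f) g = inner ℂ f (R g)) :
    IsSelfAdjoint (opOfResolvent R hR μ) := by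
  have hd : Dense ((opOfResolvent R hR μ).domain : Set K) := by
    rw [Submodule.dense_iff_topologicalClosure_eq_top, Submodule.topologicalClosure_eq_top_iff,
      Submodule.eq_bot_iff]
    intro y hy
    -- A vector y orthogonal to the range is orthogonal to R (R y), so ‖R y‖² = 0.
    apply hR
    rw [map_zero, ← inner_self_eq_zero (𝕜 := ℂ), hsymm]
    exact (Submodule.mem_orthogonal' _ _).1 hy _ ⟨R y, rfl⟩
  have hform : (opOfResolvent R hR μ).IsFormalAdjoint (opOfResolvent R hR μ) := by
    rintro ⟨_, f, rfl⟩ ⟨_, g, rfl⟩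
    have h1 := opOfResolvent_apply R hR μ f ⟨f, rfl⟩
    have h2 := opOfResolvent_apply R hR μ g ⟨g, rfl⟩
    simp only [ContinuousLinearMap.coe_coe] at h1 h2 ⊢
    refine (congrArg (inner ℂ · (R g)) h1).trans (Eq.trans ?_
      (congrArg (inner ℂ (R f)) h2).symm)
    rw [inner_sub_left, inner_sub_right, hsymm f g, inner_smul_left, inner_smul_right,
      Complex.conj_ofReal]
  rw [LinearPMap.isSelfAdjoint_def]
  have hle := LinearPMap.IsFormalAdjoint.le_adjoint hd hform
  refine (LinearPMap.eq_of_le_of_domain_eq hle (le_antisymm hle.1 ?_)).symm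
  intro y hy
  -- If y is in the domain of the adjoint T*, its preimage under R has to be T* y + μ y.
  refine ⟨(opOfResolvent R hR μ).adjoint ⟨y, hy⟩ + (μ : ℂ) • y, ?_⟩
  refine ext_inner_right ℂ fun f => ?_
  have h1 := LinearPMap.adjoint_isFormalAdjoint hd ⟨y, hy⟩ ⟨R f, mem_domain_opOfResolvent R hR μ f⟩
  rw [opOfResolvent_apply, inner_sub_right, inner_smul_right] at h1
  rw [ContinuousLinearMap.coe_coe, hsymm, inner_add_left, inner_smul_left, Complex.conj_ofReal]
  refine (congrArg (· + _) h1).trans ?_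
  ring

/-- A Hermitian form `B` on `D` such that `B + μ` is coercive, together with a solution operator
`R` of the equation `B(v, R f) + μ (v, R f) = (v, f)`. -/
structure SolvableForm (D : Set K) (B : K → K → ℂ) (μ c : ℝ) (R : K → K) : Prop where
  sub_mem : ∀ u ∈ D, ∀ v ∈ D, u - v ∈ D
  herm : ∀ u ∈ D, ∀ v ∈ D, B v u = conj (B u v)
  sub_right : ∀ v ∈ D, ∀ a ∈ D, ∀ b ∈ D, B v (a - b) = B v a - B v b
  coercive : ∀ v ∈ D, c * ‖v‖ ^ 2 ≤ (B v v).re + μ * ‖v‖ ^ 2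
  pos : 0 < c
  mem : ∀ f, R f ∈ D
  solve : ∀ v ∈ D, ∀ f, B v (R f) + μ * inner ℂ v (R f) = inner ℂ v f
  injective : Function.Injective R

namespace SolvableForm

variable {D : Set K} {B : K → K → ℂ} {μ c : ℝ} {R : K → K}

/-- Both sides equal the Hermitian expression B + μ evaluated at the pair R f, R g. -/
theorem symm (h : SolvableForm D B μ c R) (f g : K) : inner ℂ (R f) g = inner ℂ f (R g) := by
  have h1 := h.solve (R f) (h.mem f) g
  have h2 := h.solve (R g) (h.mem g) f
  have h3 := h.herm (R f) (h.mem f) (R g) (h.mem g)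
  rw [← h1, ← inner_conj_symm f, ← h2, h3, map_add, map_mul, Complex.conj_conj, inner_conj_symm,
    Complex.conj_ofReal]

theorem bound (h : SolvableForm D B μ c R) (f : K) : ‖R f‖ ≤ c⁻¹ * ‖f‖ := by
  have h1 := h.coercive (R f) (h.mem f)
  have h2 := congrArg Complex.re (h.solve (R f) (h.mem f) f)
  rw [inner_self_eq_norm_sq_to_K] at h2
  have h3 : ((μ : ℂ) * ((‖R f‖ : ℝ) : ℂ) ^ 2).re = μ * ‖R f‖ ^ 2 := by
    rw [← Complex.ofReal_pow, ← Complex.ofReal_mul, Complex.ofReal_re]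
  have h4 : (inner ℂ (R f) f).re ≤ ‖R f‖ * ‖f‖ := re_inner_le_norm (𝕜 := ℂ) (R f) f
  have h5 : c * ‖R f‖ ^ 2 ≤ ‖R f‖ * ‖f‖ := by
    rw [Complex.add_re] at h2
    have h6 : ((μ : ℂ) * (RCLike.ofReal ‖R f‖ : ℂ) ^ 2).re = μ * ‖R f‖ ^ 2 := h3
    linarith
  rw [inv_mul_eq_div, le_div_iff₀ h.pos]
  rcases (norm_nonneg (R f)).eq_or_lt with h0 | h0
  · rw [← h0, zero_mul]; exact norm_nonneg _
  · nlinarith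

/-- The solution operator as a bounded operator. -/
def solution (h : SolvableForm D B μ c R) : K →L[ℂ] K :=
  LinearMap.mkContinuous
    { toFun := R
      -- Linearity of R is not part of the hypotheses; it follows from symmetry, since R is moved to
      -- the other argument.
      map_add' := fun f g => ext_inner_right ℂ fun k => by
        rw [h.symm, inner_add_left, inner_add_left, h.symm, h.symm]
      map_smul' := fun a f => ext_inner_right ℂ fun k => by
        rw [h.symm, inner_smul_left, RingHom.id_apply, inner_smul_left, h.symm] }
    c⁻¹ h.bound

/-- The operator of the form `B`. -/
def operator (h : SolvableForm D B μ c R) : K →ₗ.[ℂ] K :=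
  opOfResolvent h.solution h.injective μ

theorem mem_graph (h : SolvableForm D B μ c R) (ψ f : K) :
    (ψ, f) ∈ h.operator.graph ↔ ψ = R (f + (μ : ℂ) • ψ) :=
  mem_graph_opOfResolvent _ _ _ _ _

theorem isBoundedInverse (h : SolvableForm D B μ c R) :
    IsBoundedInverse h.operator μ h.solution :=
  isBoundedInverse_opOfResolvent _ _ _

theorem isSelfAdjoint [CompleteSpace K] (h : SolvableForm D B μ c R) :
    IsSelfAdjoint h.operator :=
  isSelfAdjoint_opOfResolvent _ _ _ h.symm

/-- A solution ψ of B(v, ψ) = (v, f) can differ from R (f + μψ) only by a vector on which B + μ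
vanishes against itself, and coercivity makes that vector zero. -/
theorem isOperatorOfForm (h : SolvableForm D B μ c R) : IsOperatorOfForm D B h.operator := by
  intro ψ f
  rw [h.mem_graph]
  constructor
  · intro hψ
    have hm : ψ ∈ D := by rw [hψ]; exact h.mem _
    refine ⟨hm, fun v hv => ?_⟩
    have h1 := h.solve v hv (f + (μ : ℂ) • ψ)
    rw [← hψ, inner_add_right, inner_smul_right] at h1
    exact add_right_cancel h1
  · rintro ⟨hψ, hB⟩
    set ψ' := R (f + (μ : ℂ) • ψ) with hψ'
    have hm : ψ' ∈ D := h.mem _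
    have hd := h.sub_mem ψ hψ ψ' hm
    have h1 := h.solve _ hd (f + (μ : ℂ) • ψ)
    have h2 := h.sub_right _ hd _ hψ _ hm
    have h3 := h.coercive _ hd
    rw [← hψ', inner_add_right, inner_smul_right, ← hB _ hd] at h1
    have h4 : B (ψ - ψ') (ψ - ψ') = -((μ : ℂ) * inner ℂ (ψ - ψ') (ψ - ψ')) := by
      rw [h2]
      conv_rhs => rw [inner_sub_right]
      linear_combination -h1
    rw [h4, inner_self_eq_norm_sq_to_K] at h3
    have h6 : ((μ : ℂ) * (RCLike.ofReal ‖ψ - ψ'‖ : ℂ) ^ 2).re = μ * ‖ψ - ψ'‖ ^ 2 := by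
      change ((μ : ℂ) * ((‖ψ - ψ'‖ : ℝ) : ℂ) ^ 2).re = _
      rw [← Complex.ofReal_pow, ← Complex.ofReal_mul, Complex.ofReal_re]
    rw [Complex.neg_re, h6, neg_add_cancel] at h3
    have h5 := h.pos
    have h7 : ‖ψ - ψ'‖ = 0 := by
      by_contra hne
      have : 0 < ‖ψ - ψ'‖ ^ 2 := by positivity
      nlinarith
    exact sub_eq_zero.1 (norm_eq_zero.1 h7)

theorem isBoundedBelowBy (h : SolvableForm D B μ c R) :
    IsBoundedBelowBy h.operator (c - μ) := by
  intro ψ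
  obtain ⟨hD, hB⟩ := (h.isOperatorOfForm ψ (h.operator ψ)).1 (LinearPMap.mem_graph _ ψ)
  have h1 := h.coercive _ hD
  rw [hB _ hD] at h1
  linarith

end SolvableForm

/-- Lax–Milgram for a bounded operator with coercive real part. -/
theorem exists_solution_of_coercive [CompleteSpace K] (A : K →L[ℂ] K) {c : ℝ} (hc : 0 < c)
    (h : ∀ u, c * ‖u‖ ^ 2 ≤ (inner ℂ u (A u)).re) (f : K) : ∃ u, A u = f := by
  have hu : IsUnit A := by
    refine ContinuousLinearMap.isUnit_of_forall_le_norm_inner_map A (c := ⟨c, hc.le⟩) hc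
      fun u => ?_
    rw [norm_inner_symm]
    calc ‖u‖ ^ 2 * c = c * ‖u‖ ^ 2 := mul_comm _ _
      _ ≤ _ := h u
      _ ≤ _ := Complex.re_le_norm _
  exact (ContinuousLinearMap.isUnit_iff_bijective.1 hu).2 f

/-- Identifies the operators constructed from the resolvents at different values of λ. -/
theorem eq_of_isOperatorOfForm {D : Set K} {B : K → K → ℂ} {T T' : K →ₗ.[ℂ] K}
    (h : IsOperatorOfForm D B T) (h' : IsOperatorOfForm D B T') : T = T' :=
  LinearPMap.eq_of_eq_graph (by
    ext ⟨ψ, f⟩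
    rw [h ψ f, h' ψ f])

end Abstract

/-! ### The Fourier transform on `L²` -/

section FourierLemmas

open FourierTransform TemperedDistribution
open scoped SchwartzMap

variable {E : Type} [NormedAddCommGroup E] [InnerProductSpace ℝ E] [FiniteDimensional ℝ E]
  [MeasurableSpace E] [BorelSpace E]

theorem inner_eq_integral (u v : L2 E) : inner ℂ u v = ∫ x, conj (u x) * v x := by
  rw [L2.inner_def]
  congr 1
  ext x
  rw [RCLike.inner_apply, mul_comm]

theorem ft_eq (u : L2 E) :
    ft u = dilationₗ (2 * Real.pi)⁻¹ (by positivity) (Lp.fourierTransformₗᵢ E ℂ u) := rfl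

theorem ft_symm_eq (u : L2 E) :
    ft.symm u = (Lp.fourierTransformₗᵢ E ℂ).symm
      (dilationₗ (2 * Real.pi)⁻¹⁻¹ (by positivity) u) := by
  rw [LinearIsometryEquiv.symm_apply_eq, ft_eq, LinearIsometryEquiv.apply_symm_apply]
  exact (dilationₗ_inv _ _ _).symm

theorem inner_ft (u v : L2 E) : inner ℂ (ft u) (ft v) = inner ℂ u v :=
  LinearIsometryEquiv.inner_map_map _ _ _

/-- On L¹ ∩ L² the abstract inverse transform and the Fourier integral agree: tested against a
smooth compactly supported function, both move the transform onto the test function, one by its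
definition on distributions and the other by Fubini. -/
theorem fourierInv_toLp_ae {g : E → ℂ} (h1 : Integrable g) (h2 : MemLp g 2 volume) :
    ((Lp.fourierTransformₗᵢ E ℂ).symm h2.toLp : L2 E) =ᵐ[volume] 𝓕⁻ g := by
  have hcont : Continuous (𝓕⁻ g) :=
    VectorFourier.fourierIntegral_continuous Real.continuous_fourierChar
      (by simp only [LinearMap.neg_apply, innerₗ_apply_apply]; fun_prop) h1
  have hl : LocallyIntegrable
      (fun x => ((Lp.fourierTransformₗᵢ E ℂ).symm h2.toLp : L2 E) x - 𝓕⁻ g x) volume :=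
    ((Lp.memLp _).locallyIntegrable (by norm_num)).sub hcont.locallyIntegrable
  suffices h : (fun x => ((Lp.fourierTransformₗᵢ E ℂ).symm h2.toLp : L2 E) x - 𝓕⁻ g x)
      =ᵐ[volume] 0 by
    filter_upwards [h] with x hx
    exact sub_eq_zero.1 hx
  refine ae_eq_zero_of_integral_contDiff_smul_eq_zero hl fun φ hφ hc => ?_
  have hc1 : HasCompactSupport (Complex.ofRealCLM ∘ φ) := hc.comp_left rfl
  have hφ1 : ContDiff ℝ ((⊤ : ℕ∞) : WithTop ℕ∞) (Complex.ofRealCLM ∘ φ) :=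
    Complex.ofRealCLM.contDiff.comp hφ
  set Φ : 𝓢(E, ℂ) := hc1.toSchwartzMap hφ1 with hΦ
  have hΦx : ∀ x, Φ x = (φ x : ℂ) := fun x => rfl
  have e1 : ∫ x, Φ x • ((Lp.fourierTransformₗᵢ E ℂ).symm h2.toLp : L2 E) x
      = ∫ x, (𝓕⁻ Φ) x • g x := by
    have h3 := DFunLike.congr_fun (Lp.fourierInv_toTemperedDistribution_eq (h2.toLp)) Φ
    rw [Lp.toTemperedDistribution_apply] at h3
    refine h3.symm.trans ?_
    rw [TemperedDistribution.fourierInv_apply, Lp.toTemperedDistribution_apply]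
    refine integral_congr_ae ?_
    filter_upwards [h2.coeFn_toLp] with x hx
    rw [hx]
  have e2 : ∫ x, (𝓕⁻ Φ) x • g x = ∫ x, Φ x • 𝓕⁻ g x := by
    have h3 := VectorFourier.integral_fourierIntegral_smul_eq_flip (e := Real.fourierChar)
      (μ := (volume : Measure E)) (ν := (volume : Measure E)) (L := -innerₗ E) (f := Φ) (g := g)
      Real.continuous_fourierChar
      (by simp only [LinearMap.neg_apply, innerₗ_apply_apply]; fun_prop) Φ.integrable h1
    rw [SchwartzMap.fourierInv_coe]
    refine h3.trans ?_
    congr 1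
    ext x
    congr 1
    rw [show (-innerₗ E).flip = -innerₗ E by ext a b; simp [real_inner_comm]]
    rfl
  have i1 : Integrable fun x => φ x • ((Lp.fourierTransformₗᵢ E ℂ).symm h2.toLp : L2 E) x :=
    ((Lp.memLp _).locallyIntegrable (by norm_num)).integrable_smul_left_of_hasCompactSupport
      hφ.continuous hc
  have i2 : Integrable fun x => φ x • 𝓕⁻ g x :=
    hcont.locallyIntegrable.integrable_smul_left_of_hasCompactSupport hφ.continuous hc
  simp only [smul_sub]
  rw [integral_sub i1 i2, sub_eq_zero]
  simpa [hΦx] using e1.trans e2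

/-- The inverse of the unitary dilation contributes (2π)^{n/2} and the substitution in the integral
contributes (2π)^{-n}. -/
theorem ft_symm_toLp_ae {g : E → ℂ} (h1 : Integrable g) (h2 : MemLp g 2 volume) :
    (ft.symm h2.toLp : L2 E) =ᵐ[volume] fun x =>
      (((2 * Real.pi) ^ (-((Module.finrank ℝ E : ℝ) / 2)) : ℝ) : ℂ) *
        ∫ p, Complex.exp (Complex.I * (inner ℝ p x : ℝ)) * g p := by
  have hpi : (0 : ℝ) < 2 * Real.pi := by positivity
  set c : ℝ := (2 * Real.pi)⁻¹⁻¹ with hc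
  have hcpi : c = 2 * Real.pi := inv_inv _
  have hc0 : 0 < c := by rw [hcpi]; exact hpi
  set g' : E → ℂ := fun x => ((c ^ ((Module.finrank ℝ E : ℝ) / 2) : ℝ) : ℂ) * g (c • x) with hg'
  have h1' : Integrable g' := (h1.comp_smul hc0.ne').const_mul _
  have h2' : MemLp g' 2 volume := (memLp_comp_smul hc0 h2).const_mul _
  have e : dilationₗ c hc0 h2.toLp = h2'.toLp := by
    refine Lp.ext ?_
    filter_upwards [coeFn_dilationₗ c hc0 h2.toLp, h2'.coeFn_toLp,
      ae_comp_smul hc0 h2.coeFn_toLp] with x a1 a2 a3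
    rw [a1, a2, a3]
  rw [ft_symm_eq, e]
  filter_upwards [fourierInv_toLp_ae h1' h2'] with x hx
  rw [hx, Real.fourierInv_eq']
  have h3 := Measure.integral_comp_smul (volume : Measure E)
    (fun p => Complex.exp (Complex.I * (inner ℝ p x : ℝ)) * g p) c
  have h4 : ∀ v : E, Complex.exp ((↑(2 * Real.pi * inner ℝ v x) * Complex.I)) • g' v =
      ((c ^ ((Module.finrank ℝ E : ℝ) / 2) : ℝ) : ℂ) *
        (Complex.exp (Complex.I * (inner ℝ (c • v) x : ℝ)) * g (c • v)) := by
    intro v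
    rw [hg', inner_smul_left, hcpi, smul_eq_mul]
    simp only [conj_trivial]
    rw [mul_comm Complex.I]
    ring
  simp_rw [h4]
  rw [integral_const_mul, h3, Complex.real_smul, ← mul_assoc, ← Complex.ofReal_mul]
  congr 2
  rw [abs_of_pos (by positivity), hcpi, Real.rpow_neg hpi.le, ← div_eq_mul_inv,
    div_eq_iff (by positivity), inv_mul_eq_div, eq_div_iff (by positivity), ← Real.rpow_add hpi]
  rw [add_halves, Real.rpow_natCast]

/-- The transform of `ψ ∘ T`, for `T` a linear involution. -/
theorem ft_symm_compMeasurePreserving (T T' : E →ₗ[ℝ] E) (hT : T ∘ₗ T = LinearMap.id)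
    (hT' : T' ∘ₗ T' = LinearMap.id) (hadj : ∀ x y, inner ℝ (T x) y = inner ℝ x (T' y))
    (u : L2 E) :
    ft.symm (Lp.compMeasurePreserving T' (measurePreserving_of_involutive T' hT') u) =
      Lp.compMeasurePreserving T (measurePreserving_of_involutive T hT) (ft.symm u) := by
  have hmp := measurePreserving_of_involutive T hT
  have hmp' := measurePreserving_of_involutive T' hT'
  -- Both sides are continuous in u, so Schwartz functions suffice. For them the inverse transform
  -- is an integral, and the substitution by T' moves its transpose T onto x.
  refine DenseRange.induction_on (p := fun u : L2 E =>
    ft.symm (Lp.compMeasurePreserving T' (measurePreserving_of_involutive T' hT') u) =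
      Lp.compMeasurePreserving T (measurePreserving_of_involutive T hT) (ft.symm u))
    (SchwartzMap.denseRange_toLpCLM (F := ℂ) (p := 2) (μ := (volume : Measure E))
      ENNReal.ofNat_ne_top) u ?_ ?_
  · exact isClosed_eq
      (ft.symm.continuous.comp (Lp.isometry_compMeasurePreserving hmp').continuous)
      ((Lp.isometry_compMeasurePreserving hmp).continuous.comp ft.symm.continuous)
  · intro φ
    have hφ : MemLp φ 2 volume := φ.memLp 2 volume
    have hφ1 : Integrable φ := φ.integrable
    have hme : MeasurableEmbedding T' := by
      refine (MeasurableEquiv.mk ⟨T', T', fun x => ?_, fun x => ?_⟩ ?_ ?_).measurableEmbedding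
      · exact LinearMap.congr_fun hT' x
      · exact LinearMap.congr_fun hT' x
      · exact hmp'.measurable
      · exact hmp'.measurable
    have h2 : MemLp (φ ∘ T') 2 volume := hφ.comp_measurePreserving hmp'
    have h1 : Integrable (φ ∘ T') := (hmp'.integrable_comp_emb hme).2 hφ1
    have e : Lp.compMeasurePreserving T' hmp' (SchwartzMap.toLpCLM ℝ ℂ 2 volume φ) = h2.toLp := by
      exact Lp.toLp_compMeasurePreserving hφ hmp'
    rw [e]
    have e0 : (SchwartzMap.toLpCLM ℝ ℂ 2 volume φ : L2 E) = hφ.toLp := rfl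
    rw [e0]
    refine Lp.ext ?_
    have h3 := ft_symm_toLp_ae hφ1 hφ
    filter_upwards [ft_symm_toLp_ae h1 h2, Lp.coeFn_compMeasurePreserving (ft.symm hφ.toLp) hmp,
      hmp.quasiMeasurePreserving.ae h3] with x a1 a2 a3
    rw [a1, a2, Function.comp_apply, a3]
    congr 1
    rw [← hmp'.integral_comp hme]
    congr 1
    ext p
    have : T' (T' p) = p := LinearMap.congr_fun hT' p
    rw [Function.comp_apply, this, real_inner_comm x (T' p), ← hadj x p, real_inner_comm p]

end FourierLemmas

/-! ### Bessel weights -/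

section Bessel

variable {E : Type} [NormedAddCommGroup E]

/-- The Bessel weight `(1 + |k|²)^{s/2}`. -/
def bessel (s : ℝ) (k : E) : ℝ := (1 + ‖k‖ ^ 2) ^ (s / 2)

theorem bessel_pos (s : ℝ) (k : E) : 0 < bessel s k := by
  unfold bessel
  positivity

theorem continuous_bessel (s : ℝ) : Continuous (bessel s : E → ℝ) := by
  unfold bessel
  refine Continuous.rpow_const (by fun_prop) fun k => Or.inl ?_
  positivity

theorem bessel_mul_bessel_neg (s : ℝ) (k : E) : bessel s k * bessel (-s) k = 1 := by
  unfold bessel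
  rw [← Real.rpow_add (by positivity), show s / 2 + -s / 2 = 0 by ring, Real.rpow_zero]

theorem bessel_neg_le_one {s : ℝ} (hs : 0 ≤ s) (k : E) : bessel (-s) k ≤ 1 := by
  unfold bessel
  refine Real.rpow_le_one_of_one_le_of_nonpos ?_ (by linarith)
  nlinarith [sq_nonneg ‖k‖]

/-- The weights in k and in 2πk are comparable, so the two normalizations of the Fourier transform
define the same Sobolev spaces. -/
theorem bessel_smul_le [NormedSpace ℝ E] {s : ℝ} (hs : 0 ≤ s) {c : ℝ} (h1 : 1 ≤ c) (k : E) :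
    bessel s k ≤ bessel s (c • k) ∧ bessel s (c • k) ≤ c ^ s * bessel s k := by
  have h0 : (0 : ℝ) ≤ s / 2 := by linarith
  have hc : 0 ≤ c := by linarith
  have hn : ‖c • k‖ ^ 2 = c ^ 2 * ‖k‖ ^ 2 := by
    rw [norm_smul, mul_pow, Real.norm_of_nonneg hc]
  have hc2 : 1 ≤ c ^ 2 := one_le_pow₀ h1
  unfold bessel
  constructor
  · refine Real.rpow_le_rpow (by positivity) ?_ h0
    rw [hn]
    nlinarith [sq_nonneg ‖k‖]
  · have e : c ^ s = (c ^ 2) ^ (s / 2) := by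
      rw [← Real.rpow_natCast c 2, ← Real.rpow_mul hc]
      congr 1
      push_cast
      ring
    rw [e, ← Real.mul_rpow (by positivity) (by positivity)]
    refine Real.rpow_le_rpow (by positivity) ?_ h0
    rw [hn]
    nlinarith [sq_nonneg ‖k‖]

end Bessel

/-! ### Sobolev spaces and Gaussians under the Fourier transform -/

section SobolevFourier

open FourierTransform TemperedDistribution
open scoped SchwartzMap

variable {E : Type} [NormedAddCommGroup E] [InnerProductSpace ℝ E] [FiniteDimensional ℝ E]
  [MeasurableSpace E] [BorelSpace E]

theorem memLp_mul_of_le {f : E → ℂ} {g h : E → ℝ} (hf : AEStronglyMeasurable f volume)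
    (hg : AEStronglyMeasurable g volume) {C : ℝ} (hle : ∀ x, |g x| ≤ C * |h x|)
    (hm : MemLp (fun x => (h x : ℂ) * f x) 2 volume) :
    MemLp (fun x => (g x : ℂ) * f x) 2 volume := by
  refine hm.of_le_mul (c := C) ?_ (Filter.Eventually.of_forall fun x => ?_)
  · exact (Complex.continuous_ofReal.comp_aestronglyMeasurable hg).mul hf
  · rw [norm_mul, norm_mul, Complex.norm_real, Complex.norm_real, ← mul_assoc]
    exact mul_le_mul_of_nonneg_right (hle x) (norm_nonneg _)

/-- The distributional condition becomes a pointwise one by dividing by the weight: its inverse is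
bounded, hence acts on L², and L² embeds injectively into the tempered distributions. -/
theorem inSobolev_iff_fourier {s : ℝ} (hs : 0 ≤ s) (u : L2 E) :
    InSobolev s u ↔
      MemLp (fun k => (bessel s k : ℂ) * (Lp.fourierTransformₗᵢ E ℂ u : L2 E) k) 2 volume := by
  set v : L2 E := Lp.fourierTransformₗᵢ E ℂ u with hv
  have hw : (fun x : E => ((bessel s x : ℝ) : ℂ)).HasTemperateGrowth := by
    unfold bessel; fun_prop
  have hw' : (fun x : E => ((bessel (-s) x : ℝ) : ℂ)).HasTemperateGrowth := by
    unfold bessel; fun_prop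
  have hm' : MemLp (fun x : E => ((bessel (-s) x : ℝ) : ℂ)) ∞ volume := by
    refine memLp_top_of_bound hw'.1.continuous.aestronglyMeasurable 1
      (Filter.Eventually.of_forall fun x => ?_)
    rw [Complex.norm_real, Real.norm_of_nonneg (bessel_pos _ _).le]
    exact bessel_neg_le_one hs x
  have hone : (fun x : E => ((bessel s x : ℝ) : ℂ)) * (fun x : E => ((bessel (-s) x : ℝ) : ℂ))
      = fun _ => 1 := by
    funext x
    rw [Pi.mul_apply, ← Complex.ofReal_mul, bessel_mul_bessel_neg, Complex.ofReal_one]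
  have hF : 𝓕 (u : 𝓢'(E, ℂ)) = (v : 𝓢'(E, ℂ)) := Lp.fourier_toTemperedDistribution_eq u
  unfold InSobolev
  rw [memSobolev_iff_exists_smulLeftCLM_fourier, hF]
  change (∃ f' : L2 E, smulLeftCLM ℂ (fun x : E => ((bessel s x : ℝ) : ℂ)) (v : 𝓢'(E, ℂ)) =
    (f' : 𝓢'(E, ℂ))) ↔ _
  constructor
  · rintro ⟨f', hf'⟩
    have h1 : (((hm'.toLp _) • f' : L2 E) : 𝓢'(E, ℂ)) = (v : 𝓢'(E, ℂ)) := by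
      rw [Lp.toTemperedDistribution_smul_eq hw', ← hf', smulLeftCLM_smulLeftCLM_apply hw hw',
        hone, smulLeftCLM_const, one_smul]
    have h2 : (hm'.toLp _) • f' = v :=
      LinearMap.ker_eq_bot.1 (Lp.ker_toTemperedDistributionCLM_eq_bot (F := ℂ)
        (μ := (volume : Measure E)) (p := 2)) h1
    refine (memLp_congr_ae ?_).1 (Lp.memLp f')
    have h3 := Lp.coeFn_lpSMul (r := 2) (hm'.toLp _) f'
    rw [h2] at h3
    filter_upwards [h3, hm'.coeFn_toLp] with x a1 a2
    have := bessel_mul_bessel_neg s x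
    rw [a1, Pi.smul_apply', a2, smul_eq_mul, ← mul_assoc, ← Complex.ofReal_mul, this,
      Complex.ofReal_one, one_mul]
  · intro hm
    refine ⟨hm.toLp, ?_⟩
    have h1 : (hm'.toLp _) • hm.toLp = v := by
      refine Lp.ext ?_
      filter_upwards [Lp.coeFn_lpSMul (r := 2) (hm'.toLp _) hm.toLp, hm'.coeFn_toLp,
        hm.coeFn_toLp] with x a1 a2 a3
      have := bessel_mul_bessel_neg s x
      rw [a1, Pi.smul_apply', a2, a3, smul_eq_mul, ← mul_assoc, ← Complex.ofReal_mul,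
        mul_comm (bessel (-s) x), this, Complex.ofReal_one, one_mul]
    conv_lhs => rw [← h1]
    rw [Lp.toTemperedDistribution_smul_eq hw', smulLeftCLM_smulLeftCLM_apply hw' hw,
      mul_comm, hone, smulLeftCLM_const, one_smul]

/-- Sobolev spaces in terms of the unitary Fourier transform. -/
theorem inSobolev_iff {s : ℝ} (hs : 0 ≤ s) (u : L2 E) :
    InSobolev s u ↔ MemLp (fun k => (bessel s k : ℂ) * ft u k) 2 volume := by
  have hpi : (0 : ℝ) < 2 * Real.pi := by positivity
  have h1pi : (1 : ℝ) ≤ 2 * Real.pi := by linarith [Real.pi_gt_three]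
  rw [inSobolev_iff_fourier hs]
  set v : L2 E := Lp.fourierTransformₗᵢ E ℂ u with hv
  set a : ℝ := (2 * Real.pi)⁻¹ ^ ((Module.finrank ℝ E : ℝ) / 2) with ha
  have ha0 : (a : ℂ) ≠ 0 := by
    rw [Complex.ofReal_ne_zero, ha]
    positivity
  have hft : ft u =ᵐ[volume] fun k => (a : ℂ) * v ((2 * Real.pi)⁻¹ • k) :=
    coeFn_dilationₗ _ (inv_pos.2 hpi) v
  have hvm : AEStronglyMeasurable v volume := (Lp.memLp v).1
  have hb : ∀ c : ℝ, AEStronglyMeasurable (fun k : E => bessel s (c • k)) volume := fun c =>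
    ((continuous_bessel s).comp (continuous_const_smul c)).aestronglyMeasurable
  have hb1 : AEStronglyMeasurable (bessel s : E → ℝ) volume :=
    (continuous_bessel s).aestronglyMeasurable
  have habs : ∀ k : E, |bessel s k| = bessel s k := fun k => abs_of_pos (bessel_pos s k)
  constructor
  · intro h
    have h1 : MemLp (fun k => ((bessel s ((2 * Real.pi) • k) : ℝ) : ℂ) * v k) 2 volume :=
      memLp_mul_of_le hvm (hb _) (C := (2 * Real.pi) ^ s)
        (fun k => by rw [habs, habs]; exact (bessel_smul_le hs h1pi k).2) h
    have h2 := (memLp_comp_smul (inv_pos.2 hpi) h1).const_mul (a : ℂ)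
    refine (memLp_congr_ae ?_).1 h2
    filter_upwards [hft] with k hk
    rw [hk, smul_smul, mul_inv_cancel₀ hpi.ne', one_smul]
    ring
  · intro h
    have h1 := (memLp_comp_smul hpi h).const_mul (a : ℂ)⁻¹
    have h2 : MemLp (fun k => ((bessel s ((2 * Real.pi) • k) : ℝ) : ℂ) * v k) 2 volume := by
      refine (memLp_congr_ae ?_).1 h1
      filter_upwards [ae_comp_smul hpi hft] with k hk
      rw [hk, smul_smul, inv_mul_cancel₀ hpi.ne', one_smul]
      field_simp
    exact memLp_mul_of_le hvm hb1 (C := 1) (h := fun k => bessel s ((2 * Real.pi) • k))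
      (fun k => by rw [habs, habs, one_mul]; exact (bessel_smul_le hs h1pi k).1) h2

/-- The Fourier transform of a Gaussian, in weak form. -/
theorem integral_ft_mul_gaussian (ξ : L2 R3) {t : ℝ} (ht : 0 < t) (z : R3) :
    ∫ p, ft ξ p * Complex.exp (-(t / 2 : ℝ) * ‖p‖ ^ 2 - Complex.I * (inner ℝ p z : ℝ)) =
      ((t ^ (-(3 / 2) : ℝ) : ℝ) : ℂ) * ∫ y, ξ y * (Real.exp (-‖y + z‖ ^ 2 / (2 * t)) : ℂ) := by
  have hre : 0 < (((t / 2 : ℝ) : ℂ)).re := by simpa using ht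
  set g : R3 → ℂ := fun p =>
    Complex.exp (-(t / 2 : ℝ) * ‖p‖ ^ 2 + Complex.I * (inner ℝ z p : ℝ)) with hg
  have hgc : Continuous g := by rw [hg]; fun_prop
  have hgn : ∀ p, ‖g p‖ = Real.exp (-(t / 2) * ‖p‖ ^ 2) := by
    intro p
    rw [hg, Complex.norm_exp]
    congr 1
    simp [← Complex.ofReal_pow]
  have hint : ∀ b : ℝ, 0 < b → Integrable fun p : R3 => Real.exp (-b * ‖p‖ ^ 2) := by
    intro b hb
    have h := (GaussianFourier.integrable_cexp_neg_mul_sq_norm_add (V := R3) (b := (b : ℂ))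
      (by simpa using hb) 0 0).norm
    refine h.congr (Filter.Eventually.of_forall fun p => ?_)
    simp [Complex.norm_exp, ← Complex.ofReal_pow]
  have h1 : Integrable g := (hint _ (by positivity)).mono' hgc.aestronglyMeasurable
    (Filter.Eventually.of_forall fun p => (hgn p).le)
  have h2 : MemLp g 2 volume := by
    rw [memLp_two_iff_integrable_sq_norm hgc.aestronglyMeasurable]
    refine (hint t ht).congr (Filter.Eventually.of_forall fun p => ?_)
    simp only
    rw [hgn, ← Real.exp_nat_mul]
    congr 1
    push_cast
    ring
  -- The integral is a scalar product with a modulated Gaussian g; Parseval replaces g by its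
  -- inverse transform, a Gaussian centred at -z.
  have e1 : ∫ p, ft ξ p * Complex.exp (-(t / 2 : ℝ) * ‖p‖ ^ 2 - Complex.I * (inner ℝ p z : ℝ)) =
      inner ℂ h2.toLp (ft ξ) := by
    rw [inner_eq_integral]
    refine integral_congr_ae ?_
    filter_upwards [h2.coeFn_toLp] with p hp
    rw [hp, mul_comm, hg, ← Complex.exp_conj]
    congr 2
    simp [← Complex.ofReal_pow, real_inner_comm, sub_eq_add_neg, map_ofNat]
  rw [e1, ← inner_ft, ← LinearIsometryEquiv.apply_symm_apply ft h2.toLp, inner_ft, inner_ft,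
    inner_eq_integral, ← integral_const_mul]
  refine integral_congr_ae ?_
  filter_upwards [ft_symm_toLp_ae h1 h2] with y hy
  rw [hy]
  have e2 : ∫ p, Complex.exp (Complex.I * (inner ℝ p y : ℝ)) * g p =
      ∫ p : R3, Complex.exp (-(t / 2 : ℝ) * ‖p‖ ^ 2 + Complex.I * (inner ℝ (y + z) p : ℝ)) := by
    congr 1
    ext p
    rw [hg, ← Complex.exp_add]
    congr 1
    rw [inner_add_left, real_inner_comm]
    push_cast
    ring
  have e3 := GaussianFourier.integral_cexp_neg_mul_sq_norm_add hre Complex.I (y + z)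
  rw [e2, e3]
  have e4 : Complex.exp (Complex.I ^ 2 * (‖y + z‖ : ℂ) ^ 2 / (4 * ((t / 2 : ℝ) : ℂ))) =
      (Real.exp (-‖y + z‖ ^ 2 / (2 * t)) : ℂ) := by
    rw [Complex.ofReal_exp]
    congr 1
    rw [Complex.I_sq]
    push_cast
    field_simp
    ring
  have e5 : ((Real.pi : ℂ) / ((t / 2 : ℝ) : ℂ)) ^ ((Module.finrank ℝ R3 : ℂ) / 2) =
      (((2 * Real.pi / t) ^ (3 / 2 : ℝ) : ℝ) : ℂ) := by
    rw [Complex.ofReal_cpow (by positivity)]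
    congr 1
    · push_cast
      field_simp
    · simp
  rw [e4, e5, map_mul, map_mul, Complex.conj_ofReal, Complex.conj_ofReal, Complex.conj_ofReal]
  have e6 : (2 * Real.pi) ^ (-((Module.finrank ℝ R3 : ℝ) / 2)) * (2 * Real.pi / t) ^ (3 / 2 : ℝ) =
      t ^ (-(3 / 2) : ℝ) := by
    rw [Real.div_rpow (by positivity) ht.le, Real.rpow_neg ht.le, Real.rpow_neg (by positivity)]
    have : ((Module.finrank ℝ R3 : ℝ) / 2) = 3 / 2 := by simp
    rw [this]
    field_simp
  rw [← mul_assoc, ← Complex.ofReal_mul, e6]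
  ring

end SobolevFourier

/-! ### Schur's test and some explicit integrals -/

section Integrals

open Set Filter Topology

/-- The difference of the two sides is (a√u - b/√u)². Schur's test uses it with u = h(y)/h(x). -/
theorem two_mul_mul_le_weighted (a b u : ℝ≥0∞) (h0 : u ≠ 0) (h1 : u ≠ ∞) :
    2 * (a * b) ≤ a ^ 2 * u + b ^ 2 * u⁻¹ := by
  have hu : u⁻¹ ≠ 0 := ENNReal.inv_ne_zero.2 h1
  have hu' : u⁻¹ ≠ ∞ := ENNReal.inv_ne_top.2 h0
  rcases eq_or_ne a ∞ with rfl | ha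
  · simp [ENNReal.top_mul h0]
  rcases eq_or_ne b ∞ with rfl | hb
  · simp [ENNReal.top_mul hu]
  rw [← ENNReal.toReal_le_toReal (by finiteness) (by finiteness),
    ENNReal.toReal_add (by finiteness) (by finiteness)]
  simp only [ENNReal.toReal_mul, ENNReal.toReal_pow, ENNReal.toReal_inv, ENNReal.toReal_ofNat]
  have hpos : 0 < u.toReal := ENNReal.toReal_pos h0 h1
  set x := a.toReal
  set y := b.toReal
  set r := u.toReal
  have key : x ^ 2 * r + y ^ 2 * r⁻¹ - 2 * (x * y) = r⁻¹ * (x * r - y) ^ 2 := by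
    field_simp
    ring
  have : 0 ≤ r⁻¹ * (x * r - y) ^ 2 := by positivity
  linarith

/-- Schur's test for a symmetric nonnegative kernel. -/
theorem schur_test {X : Type} [MeasurableSpace X] {μ : Measure X} [SFinite μ]
    {k : X → X → ℝ≥0∞} (hk : Measurable (Function.uncurry k)) (hsymm : ∀ x y, k x y = k y x)
    {h W : X → ℝ≥0∞} (hh : Measurable h) (h0 : ∀ᵐ x ∂μ, h x ≠ 0) (h1 : ∀ᵐ x ∂μ, h x ≠ ∞)
    (hW : ∀ᵐ x ∂μ, ∫⁻ y, k x y * h y ∂μ ≤ W x * h x)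
    {f g : X → ℝ≥0∞} (hf : AEMeasurable f μ) (hg : AEMeasurable g μ) :
    2 * ∫⁻ x, ∫⁻ y, k x y * (f x * g y) ∂μ ∂μ ≤
      ∫⁻ x, W x * f x ^ 2 ∂μ + ∫⁻ x, W x * g x ^ 2 ∂μ := by
  -- After the weighted inequality each half contains a single function, and the hypothesis on the
  -- weight integrates out the other variable.
  have hone : ∀ u : X → ℝ≥0∞, AEMeasurable u μ →
      ∫⁻ x, ∫⁻ y, k x y * (u x ^ 2 * (h y / h x)) ∂μ ∂μ ≤ ∫⁻ x, W x * u x ^ 2 ∂μ := by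
    intro u hu
    refine lintegral_mono_ae ?_
    filter_upwards [h0, h1, hW] with x a0 a1 aW
    have e : ∀ y, k x y * (u x ^ 2 * (h y / h x)) = (u x ^ 2 / h x) * (k x y * h y) := by
      intro y
      rw [div_eq_mul_inv, div_eq_mul_inv]
      ring
    simp_rw [e]
    have hm : Measurable fun y => k x y * h y := (hk.comp measurable_prodMk_left).mul hh
    rw [lintegral_const_mul _ hm]
    calc u x ^ 2 / h x * ∫⁻ y, k x y * h y ∂μ ≤ u x ^ 2 / h x * (W x * h x) := by gcongr
      _ = W x * u x ^ 2 * ((h x)⁻¹ * h x) := by rw [div_eq_mul_inv]; ring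
      _ = _ := by rw [ENNReal.inv_mul_cancel a0 a1, mul_one]
  have m1 : AEMeasurable (fun z : X × X => k z.1 z.2 * (f z.1 ^ 2 * (h z.2 / h z.1)))
      (μ.prod μ) :=
    hk.aemeasurable.mul ((hf.comp_fst.pow_const 2).mul
      (((hh.comp measurable_snd).fun_div (hh.comp measurable_fst)).aemeasurable))
  have m2 : AEMeasurable (fun z : X × X => k z.1 z.2 * (g z.2 ^ 2 * (h z.1 / h z.2)))
      (μ.prod μ) :=
    hk.aemeasurable.mul ((hg.comp_snd.pow_const 2).mul
      (((hh.comp measurable_fst).fun_div (hh.comp measurable_snd)).aemeasurable))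
  calc 2 * ∫⁻ x, ∫⁻ y, k x y * (f x * g y) ∂μ ∂μ
      = ∫⁻ x, ∫⁻ y, 2 * (k x y * (f x * g y)) ∂μ ∂μ := by
        rw [← lintegral_const_mul' _ _ (by norm_num)]
        congr 1
        ext x
        rw [lintegral_const_mul' _ _ (by norm_num)]
    _ ≤ ∫⁻ x, ∫⁻ y, (k x y * (f x ^ 2 * (h y / h x)) + k x y * (g y ^ 2 * (h x / h y))) ∂μ ∂μ := by
        refine lintegral_mono_ae ?_
        filter_upwards [h0, h1] with x a0 a1
        refine lintegral_mono_ae ?_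
        filter_upwards [h0, h1] with y b0 b1
        have h3 := two_mul_mul_le_weighted (f x) (g y) (h y / h x)
          (ENNReal.div_ne_zero.2 ⟨b0, a1⟩) (ENNReal.div_ne_top b1 a0)
        rw [ENNReal.inv_div (Or.inl a1) (Or.inl a0)] at h3
        calc 2 * (k x y * (f x * g y)) = k x y * (2 * (f x * g y)) := by ring
          _ ≤ k x y * (f x ^ 2 * (h y / h x) + g y ^ 2 * (h x / h y)) := by gcongr
          _ = _ := mul_add _ _ _
    _ = ∫⁻ x, ∫⁻ y, k x y * (f x ^ 2 * (h y / h x)) ∂μ ∂μ +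
        ∫⁻ x, ∫⁻ y, k x y * (g y ^ 2 * (h x / h y)) ∂μ ∂μ := by
        rw [← lintegral_prod (fun z : X × X => k z.1 z.2 * (f z.1 ^ 2 * (h z.2 / h z.1))) m1,
          ← lintegral_prod (fun z : X × X => k z.1 z.2 * (g z.2 ^ 2 * (h z.1 / h z.2))) m2,
          ← lintegral_add_left' m1]
        exact (lintegral_prod _ (m1.add m2)).symm
    _ ≤ _ := by
        refine add_le_add (hone f hf) ?_
        -- The half containing g reduces to the first one by Tonelli and the symmetry of the kernel.
        rw [lintegral_lintegral_swap m2]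
        refine le_trans (le_of_eq ?_) (hone g hg)
        refine lintegral_congr fun x => lintegral_congr fun y => ?_
        rw [hsymm y x]

theorem radial_integral {f G : ℝ → ℝ} {l : ℝ} (hc : ContinuousWithinAt G (Ici 0) 0)
    (hG : ∀ y ∈ Ioi (0 : ℝ), HasDerivAt G (y ^ 2 * f y) y) (hf : ∀ y ∈ Ioi (0 : ℝ), 0 ≤ f y)
    (hl : Tendsto G atTop (𝓝 l)) :
    Integrable (fun q : R3 => f ‖q‖) ∧ ∫ q : R3, f ‖q‖ = 4 * Real.pi * (l - G 0) := by
  have h0 : ∀ y ∈ Ioi (0 : ℝ), 0 ≤ y ^ 2 * f y := fun y hy => mul_nonneg (sq_nonneg _) (hf y hy)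
  have hd : Module.finrank ℝ R3 = 3 := by simp
  constructor
  · rw [integrable_fun_norm_addHaar, hd]
    exact integrableOn_Ioi_deriv_of_nonneg hc hG h0 hl
  · rw [integral_fun_norm_addHaar, hd]
    have h1 := integral_Ioi_of_hasDerivAt_of_nonneg hc hG h0 hl
    simp only [Nat.add_one_sub_one, smul_eq_mul, Measure.real,
      EuclideanSpace.volume_ball_fin_three] at h1 ⊢
    rw [h1]
    simp only [ENNReal.ofReal_one, one_pow, one_mul, nsmul_eq_mul]
    rw [ENNReal.toReal_ofReal (by positivity)]
    push_cast
    ring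

theorem lintegral_of_integral {X : Type} [MeasurableSpace X] {μ : Measure X} {f : X → ℝ} {c : ℝ}
    (h : Integrable f μ ∧ ∫ x, f x ∂μ = c) (h0 : ∀ x, 0 ≤ f x) :
    ∫⁻ x, ENNReal.ofReal (f x) ∂μ = ENNReal.ofReal c := by
  rw [← h.2, ofReal_integral_eq_lintegral_ofReal h.1 (Eventually.of_forall h0)]

theorem tendsto_div_atTop {m : ℝ} (hm : 0 < m) : Tendsto (fun y : ℝ => y / m) atTop atTop :=
  tendsto_id.atTop_div_const hm

theorem tendsto_arctan_div {m : ℝ} (hm : 0 < m) :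
    Tendsto (fun y : ℝ => Real.arctan (y / m)) atTop (𝓝 (Real.pi / 2)) :=
  (Real.tendsto_arctan_atTop.mono_right nhdsWithin_le_nhds).comp (tendsto_div_atTop hm)

theorem hasDerivAt_arctan_div {m : ℝ} (hm : 0 < m) (y : ℝ) :
    HasDerivAt (fun y : ℝ => Real.arctan (y / m)) (m / (y ^ 2 + m ^ 2)) y := by
  have h := (hasDerivAt_id y).div_const m |>.arctan
  convert! h using 1
  simp only [id]
  field_simp
  ring

theorem lintegral_inv_sq_sq {m : ℝ} (hm : 0 < m) (a : R3) :
    ∫⁻ q : R3, ENNReal.ofReal (1 / (‖q + a‖ ^ 2 + m ^ 2) ^ 2) =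
      ENNReal.ofReal (Real.pi ^ 2 / m) := by
  rw [lintegral_add_right_eq_self
    (fun q : R3 => ENNReal.ofReal (1 / (‖q‖ ^ 2 + m ^ 2) ^ 2)) a]
  refine lintegral_of_integral ?_ fun q => by positivity
  set G : ℝ → ℝ := fun y => 1 / 2 * (Real.arctan (y / m) / m - y / (y ^ 2 + m ^ 2)) with hG
  have hd : ∀ y : ℝ, HasDerivAt G (y ^ 2 * (1 / (y ^ 2 + m ^ 2) ^ 2)) y := by
    intro y
    have hne : y ^ 2 + m ^ 2 ≠ 0 := by positivity
    have h1 := (hasDerivAt_arctan_div hm y).div_const m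
    have h2 := (hasDerivAt_id y).fun_div ((hasDerivAt_pow 2 y).add_const (m ^ 2)) hne
    convert! (h1.fun_sub h2).const_mul (1 / 2) using 1
    simp only [id]
    field_simp
    push_cast
    ring
  have hl : Tendsto G atTop (𝓝 (1 / 2 * (Real.pi / 2 / m - 0))) := by
    refine (((tendsto_arctan_div hm).div_const m).sub ?_).const_mul _
    refine squeeze_zero' (eventually_ge_atTop 0 |>.mono fun y hy => by positivity)
      (eventually_gt_atTop 0 |>.mono fun y hy => ?_) tendsto_inv_atTop_zero
    rw [div_le_iff₀ (by positivity), inv_mul_eq_div, le_div_iff₀ hy]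
    nlinarith [sq_nonneg m]
  have h := radial_integral (f := fun y => 1 / (y ^ 2 + m ^ 2) ^ 2)
    (hd 0).continuousAt.continuousWithinAt (fun y _ => hd y) (fun y _ => by positivity) hl
  refine ⟨h.1, h.2.trans ?_⟩
  simp only [hG, zero_div, Real.arctan_zero]
  field_simp
  ring

theorem hasDerivAt_div_sqrt {m : ℝ} (hm : 0 < m) (y : ℝ) :
    HasDerivAt (fun y : ℝ => y / √(y ^ 2 + m)) (m / √(y ^ 2 + m) ^ 3) y := by
  have hpos : 0 < y ^ 2 + m := by positivity
  have hs : 0 < √(y ^ 2 + m) := Real.sqrt_pos.2 hpos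
  have h2 := (hasDerivAt_id y).fun_div (((hasDerivAt_pow 2 y).add_const m).sqrt hpos.ne') hs.ne'
  convert! h2 using 1
  have hsq : √(y ^ 2 + m) ^ 2 = y ^ 2 + m := Real.sq_sqrt hpos.le
  simp only [id]
  field_simp
  push_cast
  linear_combination -2 * hsq

theorem lintegral_inv_sqrt_pow {m : ℝ} (hm : 0 < m) (a : R3) :
    ∫⁻ q : R3, ENNReal.ofReal (1 / √(‖q + a‖ ^ 2 + m) ^ 5) =
      ENNReal.ofReal (4 * Real.pi / (3 * m)) := by
  rw [lintegral_add_right_eq_self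
    (fun q : R3 => ENNReal.ofReal (1 / √(‖q‖ ^ 2 + m) ^ 5)) a]
  refine lintegral_of_integral ?_ fun q => by positivity
  set G : ℝ → ℝ := fun y => (y / √(y ^ 2 + m)) ^ 3 / (3 * m) with hG
  have hd : ∀ y : ℝ, HasDerivAt G (y ^ 2 * (1 / √(y ^ 2 + m) ^ 5)) y := by
    intro y
    have hs : 0 < √(y ^ 2 + m) := Real.sqrt_pos.2 (by positivity)
    have h1 := ((hasDerivAt_div_sqrt hm y).fun_pow 3).div_const (3 * m)
    convert! h1 using 1
    norm_num
    field_simp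
  have hl : Tendsto G atTop (𝓝 (1 ^ 3 / (3 * m))) := by
    refine Tendsto.div_const (Tendsto.pow ?_ 3) _
    have h1 : Tendsto (fun y : ℝ => √(1 - m / (y ^ 2 + m))) atTop (𝓝 √(1 - 0)) := by
      refine (tendsto_const_nhds.sub ?_).sqrt
      refine Tendsto.div_atTop tendsto_const_nhds ?_
      exact tendsto_atTop_add_const_right _ _ (tendsto_pow_atTop two_ne_zero)
    rw [sub_zero, Real.sqrt_one] at h1
    refine h1.congr' ?_
    filter_upwards [eventually_ge_atTop 0] with y hy
    have hpos : 0 < y ^ 2 + m := by positivity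
    rw [← Real.sqrt_sq hy, ← Real.sqrt_div (sq_nonneg y), Real.sq_sqrt (sq_nonneg y)]
    congr 1
    field_simp
    ring
  have h := radial_integral (f := fun y => 1 / √(y ^ 2 + m) ^ 5)
    (hd 0).continuousAt.continuousWithinAt (fun y _ => hd y) (fun y _ => by positivity) hl
  refine ⟨h.1, h.2.trans ?_⟩
  simp only [hG, zero_div]
  field_simp
  ring

/-- The primitive comes from partial fractions, hence the assumption a ≠ b. This integral is the
overlap in k of two layers on the same plane with different spectral parameters. -/
theorem integral_inv_mul_inv {a b : ℝ} (ha : 0 < a) (hb : 0 < b) (hab : a ≠ b) :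
    Integrable (fun k : R3 => 1 / ((‖k‖ ^ 2 + a ^ 2) * (‖k‖ ^ 2 + b ^ 2))) ∧
    ∫ k : R3, 1 / ((‖k‖ ^ 2 + a ^ 2) * (‖k‖ ^ 2 + b ^ 2)) = 2 * Real.pi ^ 2 / (a + b) := by
  have hne : a ^ 2 - b ^ 2 ≠ 0 := by
    rw [sq_sub_sq]
    exact mul_ne_zero (by positivity) (sub_ne_zero.2 hab)
  set G : ℝ → ℝ := fun y =>
    (a * Real.arctan (y / a) - b * Real.arctan (y / b)) / (a ^ 2 - b ^ 2) with hG
  have hd : ∀ y : ℝ, HasDerivAt G (y ^ 2 * (1 / ((y ^ 2 + a ^ 2) * (y ^ 2 + b ^ 2)))) y := by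
    intro y
    have h1 := ((hasDerivAt_arctan_div ha y).const_mul a).sub
      ((hasDerivAt_arctan_div hb y).const_mul b)
    convert! h1.div_const (a ^ 2 - b ^ 2) using 1
    field_simp
    ring
  have hl : Tendsto G atTop (𝓝 ((a * (Real.pi / 2) - b * (Real.pi / 2)) / (a ^ 2 - b ^ 2))) :=
    (((tendsto_arctan_div ha).const_mul a).sub ((tendsto_arctan_div hb).const_mul b)).div_const _
  have h := radial_integral (f := fun y => 1 / ((y ^ 2 + a ^ 2) * (y ^ 2 + b ^ 2)))
    (hd 0).continuousAt.continuousWithinAt (fun y _ => hd y) (fun y _ => by positivity) hl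
  refine ⟨h.1, h.2.trans ?_⟩
  simp only [hG, zero_div, Real.arctan_zero]
  have : a - b ≠ 0 := sub_ne_zero.2 hab
  rw [sq_sub_sq]
  field_simp
  ring

theorem lintegral_Ioo_of_deriv {G g : ℝ → ℝ} (hc : ContinuousOn G (Icc 0 1))
    (hd : ∀ y ∈ Ioo (0 : ℝ) 1, HasDerivAt G (g y) y) (hg : ∀ y ∈ Ioo (0 : ℝ) 1, 0 ≤ g y) :
    ∫⁻ y in Ioo (0 : ℝ) 1, ENNReal.ofReal (g y) = ENNReal.ofReal (G 1 - G 0) := by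
  have hi : IntegrableOn g (Ioc 0 1) := intervalIntegral.integrableOn_deriv_of_nonneg hc hd hg
  have h1 := intervalIntegral.integral_eq_sub_of_hasDerivAt_of_le zero_le_one hc hd
    ((intervalIntegrable_iff_integrableOn_Ioc_of_le zero_le_one).2 hi)
  rw [intervalIntegral.integral_of_le zero_le_one, integral_Ioc_eq_integral_Ioo] at h1
  rw [← h1, ofReal_integral_eq_lintegral_ofReal (hi.mono_set Ioo_subset_Ioc_self)]
  exact (ae_restrict_iff' measurableSet_Ioo).2 (Eventually.of_forall hg)

/-- Feynman's parametrization of 1/(ab) with parameter α = y². The square makes the last integration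
in `lintegral_pairForm_mul_inv_sq` an arcsine. -/
theorem lintegral_feynman {a b : ℝ} (ha : 0 < a) (hb : 0 < b) :
    ∫⁻ y in Ioo (0 : ℝ) 1, ENNReal.ofReal (2 * y / (y ^ 2 * a + (1 - y ^ 2) * b) ^ 2) =
      ENNReal.ofReal (1 / (a * b)) := by
  have hpos : ∀ y ∈ Icc (0 : ℝ) 1, 0 < y ^ 2 * a + (1 - y ^ 2) * b := by
    intro y hy
    have h1 : y ^ 2 ≤ 1 := pow_le_one₀ hy.1 hy.2
    rcases eq_or_lt_of_le h1 with h | h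
    · rw [h]; linarith
    · have : 0 < (1 - y ^ 2) * b := mul_pos (by linarith) hb
      positivity
  have hd : ∀ y ∈ Icc (0 : ℝ) 1, HasDerivAt
      (fun y : ℝ => y ^ 2 / (b * (y ^ 2 * a + (1 - y ^ 2) * b)))
      (2 * y / (y ^ 2 * a + (1 - y ^ 2) * b) ^ 2) y := by
    intro y hy
    have h0 := (hpos y hy).ne'
    have h2 := hasDerivAt_pow 2 y
    have h3 := (((h2.mul_const a).fun_add ((h2.const_sub 1).mul_const b)).const_mul b)
    convert! h2.fun_div h3 (mul_ne_zero hb.ne' h0) using 1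
    field_simp
    push_cast
    ring
  rw [lintegral_Ioo_of_deriv (G := fun y : ℝ => y ^ 2 / (b * (y ^ 2 * a + (1 - y ^ 2) * b)))
    (fun y hy => (hd y hy).continuousAt.continuousWithinAt)
    (fun y hy => hd y (Ioo_subset_Icc_self hy))
    (fun y hy => by have := hy.1; positivity)]
  congr 1
  field_simp
  ring

/-- Feynman's parametrization for the exponents 2 and 1/2, with α = y². The constant is 2 Γ(5/2) /
(Γ(2) Γ(1/2)) = 3/2, and the square removes the singular factor α^{-1/2}. -/
theorem lintegral_feynman_sqrt {a b : ℝ} (ha : 0 < a) (hb : 0 < b) :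
    ∫⁻ y in Ioo (0 : ℝ) 1,
      ENNReal.ofReal (3 / 2 * (1 - y ^ 2) / √(a * (1 - y ^ 2) + b * y ^ 2) ^ 5) =
      ENNReal.ofReal (1 / (a ^ 2 * √b)) := by
  have hpos : ∀ y ∈ Icc (0 : ℝ) 1, 0 < a * (1 - y ^ 2) + b * y ^ 2 := by
    intro y hy
    have h1 : y ^ 2 ≤ 1 := pow_le_one₀ hy.1 hy.2
    rcases eq_or_lt_of_le h1 with h | h
    · rw [h]; linarith
    · have : 0 < a * (1 - y ^ 2) := mul_pos ha (by linarith)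
      positivity
  set G : ℝ → ℝ := fun y => 3 / 4 * ((2 / a * y + (4 * b - 6 * a) / (3 * a ^ 2) * y ^ 3) /
    √(a * (1 - y ^ 2) + b * y ^ 2) ^ 3) with hG
  have hd : ∀ y ∈ Icc (0 : ℝ) 1, HasDerivAt G
      (3 / 2 * (1 - y ^ 2) / √(a * (1 - y ^ 2) + b * y ^ 2) ^ 5) y := by
    intro y hy
    have h0 := hpos y hy
    have hs : 0 < √(a * (1 - y ^ 2) + b * y ^ 2) := Real.sqrt_pos.2 h0
    have hsq : √(a * (1 - y ^ 2) + b * y ^ 2) ^ 2 = a * (1 - y ^ 2) + b * y ^ 2 :=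
      Real.sq_sqrt h0.le
    have h2 := hasDerivAt_pow 2 y
    have h3 := hasDerivAt_pow 3 y
    have h4 := ((((h2.const_sub 1).const_mul a).fun_add (h2.const_mul b)).sqrt h0.ne').fun_pow 3
    have h5 := ((hasDerivAt_id y).const_mul (2 / a)).fun_add
      (h3.const_mul ((4 * b - 6 * a) / (3 * a ^ 2)))
    convert! (h5.fun_div h4 (pow_ne_zero 3 hs.ne')).const_mul (3 / 4) using 1
    simp only [id]
    set s := √(a * (1 - y ^ 2) + b * y ^ 2) with hsdef
    push_cast
    norm_num
    field_simp
    rw [hsq]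
    ring
  rw [lintegral_Ioo_of_deriv (G := G) (fun y hy => (hd y hy).continuousAt.continuousWithinAt)
    (fun y hy => hd y (Ioo_subset_Icc_self hy))
    (fun y hy => by
      have h1 : y ^ 2 ≤ 1 := pow_le_one₀ hy.1.le hy.2.le
      have h2 : 0 ≤ 1 - y ^ 2 := by linarith
      positivity)]
  congr 1
  simp only [hG]
  have hs : 0 < √b := Real.sqrt_pos.2 hb
  have hsq : √b ^ 2 = b := Real.sq_sqrt hb.le
  norm_num
  field_simp
  rw [hsq]
  ring

end Integrals

/-! ### Schur weights for the kernels 1/Q and 1/Q² -/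

section Kernels

open Set Filter Topology

/-- The quadratic form `p² + q² + p·q`. -/
def pairForm (p q : R3) : ℝ := ‖p‖ ^ 2 + ‖q‖ ^ 2 + inner ℝ p q

theorem continuous_pairForm : Continuous fun z : R3 × R3 => pairForm z.1 z.2 := by
  unfold pairForm
  fun_prop

theorem pairForm_comm (p q : R3) : pairForm p q = pairForm q p := by
  unfold pairForm
  rw [real_inner_comm]
  ring

theorem pairForm_ge (p q : R3) : (‖p‖ ^ 2 + ‖q‖ ^ 2) / 2 ≤ pairForm p q := by
  have h := norm_add_sq_real p q
  unfold pairForm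
  nlinarith [sq_nonneg ‖p + q‖]

theorem pairForm_nonneg (p q : R3) : 0 ≤ pairForm p q :=
  le_trans (by positivity) (pairForm_ge p q)

theorem pairForm_pos {p : R3} (hp : p ≠ 0) (q : R3) : 0 < pairForm p q :=
  lt_of_lt_of_le (by have := norm_pos_iff.2 hp; positivity) (pairForm_ge p q)

theorem norm_add_smul_sq (p q : R3) (c : ℝ) :
    ‖q + c • p‖ ^ 2 = ‖q‖ ^ 2 + 2 * c * inner ℝ p q + c ^ 2 * ‖p‖ ^ 2 := by
  rw [norm_add_sq_real, inner_smul_right, norm_smul, mul_pow, Real.norm_eq_abs, sq_abs,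
    real_inner_comm]
  ring

/-- The weight |q|⁻² reproduces itself up to the factor (2π³/3)|p|. Feynman's formula followed by
completing the square in q leaves (2π²/|p|) ∫₀¹ dy/√(1 - y²/4), and arcsin(1/2) = π/6 fixes the
constant. -/
theorem lintegral_pairForm_mul_inv_sq {p : R3} (hp : p ≠ 0) :
    ∫⁻ q : R3, ENNReal.ofReal (1 / pairForm p q) * ENNReal.ofReal (1 / ‖q‖ ^ 2) =
      ENNReal.ofReal (2 * Real.pi ^ 3 / 3 / ‖p‖) := by
  have hn : 0 < ‖p‖ := norm_pos_iff.2 hp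
  have hid : ∀ (y : ℝ) (q : R3), y ^ 2 * pairForm p q + (1 - y ^ 2) * ‖q‖ ^ 2 =
      ‖q + (y ^ 2 / 2) • p‖ ^ 2 + ‖p‖ ^ 2 * (y ^ 2 - y ^ 4 / 4) := by
    intro y q
    rw [norm_add_smul_sq]
    unfold pairForm
    ring
  have hm : Measurable fun z : R3 × ℝ => ENNReal.ofReal
      (2 * z.2 / (z.2 ^ 2 * pairForm p z.1 + (1 - z.2 ^ 2) * ‖z.1‖ ^ 2) ^ 2) := by
    have : Measurable fun q : R3 => pairForm p q :=
      (continuous_pairForm.comp (Continuous.prodMk_right p)).measurable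
    fun_prop
  have hne : ∀ᵐ q : R3, q ≠ 0 := by
    simp [ae_iff, measure_singleton]
  calc ∫⁻ q : R3, ENNReal.ofReal (1 / pairForm p q) * ENNReal.ofReal (1 / ‖q‖ ^ 2)
      = ∫⁻ q : R3, ∫⁻ y in Ioo (0 : ℝ) 1, ENNReal.ofReal
          (2 * y / (y ^ 2 * pairForm p q + (1 - y ^ 2) * ‖q‖ ^ 2) ^ 2) := by
        refine lintegral_congr_ae ?_
        filter_upwards [hne] with q hq
        have hq' : 0 < ‖q‖ := norm_pos_iff.2 hq
        rw [lintegral_feynman (pairForm_pos hp q) (by positivity), ← ENNReal.ofReal_mul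
          (by have := pairForm_pos hp q; positivity)]
        congr 1
        field_simp
    _ = ∫⁻ y in Ioo (0 : ℝ) 1, ∫⁻ q : R3, ENNReal.ofReal
          (2 * y / (y ^ 2 * pairForm p q + (1 - y ^ 2) * ‖q‖ ^ 2) ^ 2) :=
        lintegral_lintegral_swap hm.aemeasurable
    _ = ∫⁻ y in Ioo (0 : ℝ) 1,
          ENNReal.ofReal (2 * Real.pi ^ 2 / ‖p‖ * (1 / √(1 - (y / 2) ^ 2))) := by
        refine setLIntegral_congr_fun measurableSet_Ioo fun y hy => ?_
        have h1 : 0 < 1 - (y / 2) ^ 2 := by nlinarith [hy.1, hy.2]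
        have hs : 0 < √(1 - (y / 2) ^ 2) := Real.sqrt_pos.2 h1
        have hsq : √(1 - (y / 2) ^ 2) ^ 2 = 1 - (y / 2) ^ 2 := Real.sq_sqrt h1.le
        have hmm : 0 < ‖p‖ * y * √(1 - (y / 2) ^ 2) := by have := hy.1; positivity
        have hint := lintegral_inv_sq_sq hmm ((y ^ 2 / 2) • p)
        have e : ∀ q : R3, ENNReal.ofReal
            (2 * y / (y ^ 2 * pairForm p q + (1 - y ^ 2) * ‖q‖ ^ 2) ^ 2) =
            ENNReal.ofReal (2 * y) * ENNReal.ofReal (1 / (‖q + (y ^ 2 / 2) • p‖ ^ 2 +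
              (‖p‖ * y * √(1 - (y / 2) ^ 2)) ^ 2) ^ 2) := by
          intro q
          rw [← ENNReal.ofReal_mul (by linarith [hy.1]), hid, mul_pow, mul_pow, hsq, mul_one_div]
          congr 4
          ring
        simp_rw [e]
        rw [lintegral_const_mul' _ _ ENNReal.ofReal_ne_top, hint,
          ← ENNReal.ofReal_mul (by linarith [hy.1])]
        congr 1
        have := hy.1
        field_simp
    _ = ENNReal.ofReal (2 * Real.pi ^ 2 / ‖p‖ * (2 * Real.arcsin (1 / 2)) -
          2 * Real.pi ^ 2 / ‖p‖ * (2 * Real.arcsin (0 / 2))) := by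
        refine lintegral_Ioo_of_deriv
          (G := fun y => 2 * Real.pi ^ 2 / ‖p‖ * (2 * Real.arcsin (y / 2))) ?_ ?_ ?_
        · have := Real.continuous_arcsin
          fun_prop
        · intro y hy
          have h1 := (Real.hasDerivAt_arcsin (x := y / 2) (by linarith [hy.1])
            (by linarith [hy.2]))
          have h2 := ((h1.comp y ((hasDerivAt_id y).div_const 2)).const_mul 2).const_mul
            (2 * Real.pi ^ 2 / ‖p‖)
          convert! h2 using 1
          ring
        · intro y hy
          positivity
    _ = _ := by
        have h6 : Real.arcsin (1 / 2) = Real.pi / 6 :=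
          Real.arcsin_eq_of_sin_eq Real.sin_pi_div_six
            ⟨by linarith [Real.pi_pos], by linarith [Real.pi_pos]⟩
        rw [h6, zero_div, Real.arcsin_zero]
        congr 1
        field_simp
        ring

/-- The analogue in position space: after the y-integration there remains (8π/|x|²) ∫₀¹ ds/(s² + 3),
and arctan(1/√3) = π/6. -/
theorem lintegral_pairForm_sq_mul_inv {x : R3} (hx : x ≠ 0) :
    ∫⁻ y : R3, ENNReal.ofReal (1 / pairForm x y ^ 2) * ENNReal.ofReal (1 / ‖y‖) =
      ENNReal.ofReal (4 * Real.pi ^ 2 / (3 * √3) / ‖x‖ ^ 2) := by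
  have hn : 0 < ‖x‖ := norm_pos_iff.2 hx
  have hid : ∀ (s : ℝ) (y : R3), pairForm x y * (1 - s ^ 2) + ‖y‖ ^ 2 * s ^ 2 =
      ‖y + ((1 - s ^ 2) / 2) • x‖ ^ 2 + ‖x‖ ^ 2 * (1 - s ^ 2) * (3 + s ^ 2) / 4 := by
    intro s y
    rw [norm_add_smul_sq]
    unfold pairForm
    ring
  have hm : Measurable fun z : R3 × ℝ => ENNReal.ofReal
      (3 / 2 * (1 - z.2 ^ 2) / √(pairForm x z.1 * (1 - z.2 ^ 2) + ‖z.1‖ ^ 2 * z.2 ^ 2) ^ 5) := by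
    have : Measurable fun q : R3 => pairForm x q :=
      (continuous_pairForm.comp (Continuous.prodMk_right x)).measurable
    fun_prop
  have hne : ∀ᵐ q : R3, q ≠ 0 := by
    simp [ae_iff, measure_singleton]
  have h3 : (0 : ℝ) < √3 := by positivity
  have h3sq : √3 ^ 2 = (3 : ℝ) := Real.sq_sqrt (by norm_num)
  calc ∫⁻ y : R3, ENNReal.ofReal (1 / pairForm x y ^ 2) * ENNReal.ofReal (1 / ‖y‖)
      = ∫⁻ y : R3, ∫⁻ s in Ioo (0 : ℝ) 1, ENNReal.ofReal
          (3 / 2 * (1 - s ^ 2) / √(pairForm x y * (1 - s ^ 2) + ‖y‖ ^ 2 * s ^ 2) ^ 5) := by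
        refine lintegral_congr_ae ?_
        filter_upwards [hne] with y hy
        have hy' : 0 < ‖y‖ := norm_pos_iff.2 hy
        rw [lintegral_feynman_sqrt (pairForm_pos hx y) (by positivity), ← ENNReal.ofReal_mul
          (by have := pairForm_pos hx y; positivity), Real.sqrt_sq hy'.le]
        congr 1
        field_simp
    _ = ∫⁻ s in Ioo (0 : ℝ) 1, ∫⁻ y : R3, ENNReal.ofReal
          (3 / 2 * (1 - s ^ 2) / √(pairForm x y * (1 - s ^ 2) + ‖y‖ ^ 2 * s ^ 2) ^ 5) :=
        lintegral_lintegral_swap hm.aemeasurable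
    _ = ∫⁻ s in Ioo (0 : ℝ) 1, ENNReal.ofReal (8 * Real.pi / ‖x‖ ^ 2 * (1 / (s ^ 2 + √3 ^ 2))) := by
        refine setLIntegral_congr_fun measurableSet_Ioo fun s hs => ?_
        have h1 : 0 < 1 - s ^ 2 := by nlinarith [hs.1, hs.2]
        have hmm : 0 < ‖x‖ ^ 2 * (1 - s ^ 2) * (3 + s ^ 2) / 4 := by positivity
        have hint := lintegral_inv_sqrt_pow hmm (((1 - s ^ 2) / 2) • x)
        have e : ∀ y : R3, ENNReal.ofReal
            (3 / 2 * (1 - s ^ 2) / √(pairForm x y * (1 - s ^ 2) + ‖y‖ ^ 2 * s ^ 2) ^ 5) =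
            ENNReal.ofReal (3 / 2 * (1 - s ^ 2)) * ENNReal.ofReal
              (1 / √(‖y + ((1 - s ^ 2) / 2) • x‖ ^ 2 +
                ‖x‖ ^ 2 * (1 - s ^ 2) * (3 + s ^ 2) / 4) ^ 5) := by
          intro y
          rw [← ENNReal.ofReal_mul (by positivity), hid, mul_one_div]
        simp_rw [e]
        rw [lintegral_const_mul' _ _ ENNReal.ofReal_ne_top, hint,
          ← ENNReal.ofReal_mul (by positivity), h3sq]
        congr 1
        field_simp
        ring
    _ = ENNReal.ofReal (8 * Real.pi / ‖x‖ ^ 2 * (Real.arctan (1 / √3) / √3) -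
          8 * Real.pi / ‖x‖ ^ 2 * (Real.arctan (0 / √3) / √3)) := by
        have hd : ∀ s : ℝ, HasDerivAt
            (fun s => 8 * Real.pi / ‖x‖ ^ 2 * (Real.arctan (s / √3) / √3))
            (8 * Real.pi / ‖x‖ ^ 2 * (1 / (s ^ 2 + √3 ^ 2))) s := by
          intro s
          convert! ((hasDerivAt_arctan_div h3 s).div_const √3).const_mul
            (8 * Real.pi / ‖x‖ ^ 2) using 1
          field_simp
        exact lintegral_Ioo_of_deriv
          (G := fun s => 8 * Real.pi / ‖x‖ ^ 2 * (Real.arctan (s / √3) / √3))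
          (fun s _ => (hd s).continuousAt.continuousWithinAt) (fun s _ => hd s)
          fun s _ => by positivity
    _ = _ := by
        have h6 : Real.arctan (1 / √3) = Real.pi / 6 := by
          rw [← Real.tan_pi_div_six]
          exact Real.arctan_tan (by linarith [Real.pi_pos]) (by linarith [Real.pi_pos])
        rw [h6, zero_div, Real.arctan_zero]
        congr 1
        field_simp
        ring

theorem measurable_ofReal_kernel {g : ℝ → ℝ} (hg : Measurable g) :
    Measurable (Function.uncurry fun p q : R3 => ENNReal.ofReal (g (pairForm p q))) :=
  (hg.comp continuous_pairForm.measurable).ennreal_ofReal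

theorem ae_ofReal_norm_pow_ne (n : ℕ) :
    (∀ᵐ q : R3, ENNReal.ofReal (1 / ‖q‖ ^ n) ≠ 0) ∧
      ∀ᵐ q : R3, ENNReal.ofReal (1 / ‖q‖ ^ n) ≠ ∞ := by
  refine ⟨?_, Eventually.of_forall fun q => ENNReal.ofReal_ne_top⟩
  have hne : ∀ᵐ q : R3, q ≠ 0 := by
    simp [ae_iff, measure_singleton]
  filter_upwards [hne] with q hq
  have := norm_pos_iff.2 hq
  simp only [ne_eq, ENNReal.ofReal_eq_zero, not_le]
  positivity

/-- Schur's test in momentum space for the kernel `1 / (p² + q² + p·q + λ)`. -/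
theorem schur_momentum {lam : ℝ} (hlam : 0 ≤ lam) {f g : R3 → ℝ≥0∞}
    (hf : AEMeasurable f volume) (hg : AEMeasurable g volume) :
    2 * ∫⁻ p, ∫⁻ q, ENNReal.ofReal (1 / (pairForm p q + lam)) * (f p * g q) ≤
      (∫⁻ p, ENNReal.ofReal (2 * Real.pi ^ 3 / 3 * ‖p‖) * f p ^ 2) +
        ∫⁻ p, ENNReal.ofReal (2 * Real.pi ^ 3 / 3 * ‖p‖) * g p ^ 2 := by
  have hne : ∀ᵐ q : R3, q ≠ 0 := by
    simp [ae_iff, measure_singleton]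
  -- With the weight |q|⁻² the Schur bound is homogeneous of degree one in p, like the kinetic
  -- energy. Dropping λ only enlarges the kernel.
  refine schur_test (k := fun p q => ENNReal.ofReal (1 / (pairForm p q + lam)))
    (h := fun q => ENNReal.ofReal (1 / ‖q‖ ^ 2))
    (measurable_ofReal_kernel (g := fun x => 1 / (x + lam)) (by fun_prop))
    (fun x y => by rw [pairForm_comm]) (by fun_prop) (ae_ofReal_norm_pow_ne 2).1
    (ae_ofReal_norm_pow_ne 2).2 ?_ hf hg
  filter_upwards [hne] with p hp
  have hn : 0 < ‖p‖ := norm_pos_iff.2 hp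
  calc ∫⁻ q, ENNReal.ofReal (1 / (pairForm p q + lam)) * ENNReal.ofReal (1 / ‖q‖ ^ 2)
      ≤ ∫⁻ q, ENNReal.ofReal (1 / pairForm p q) * ENNReal.ofReal (1 / ‖q‖ ^ 2) := by
        refine lintegral_mono fun q => ?_
        gcongr
        · exact pairForm_pos hp q
        · linarith
    _ ≤ _ := by
        rw [lintegral_pairForm_mul_inv_sq hp, ← ENNReal.ofReal_mul (by positivity)]
        refine le_of_eq ?_
        congr 1
        field_simp

/-- Schur's test in position space for the kernel `1 / (x² + y² + x·y)²`. -/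
theorem schur_position {f g : R3 → ℝ≥0∞}
    (hf : AEMeasurable f volume) (hg : AEMeasurable g volume) :
    2 * ∫⁻ x, ∫⁻ y, ENNReal.ofReal (1 / pairForm x y ^ 2) * (f x * g y) ≤
      (∫⁻ x, ENNReal.ofReal (4 * Real.pi ^ 2 / (3 * √3) / ‖x‖) * f x ^ 2) +
        ∫⁻ x, ENNReal.ofReal (4 * Real.pi ^ 2 / (3 * √3) / ‖x‖) * g x ^ 2 := by
  have hne : ∀ᵐ q : R3, q ≠ 0 := by
    simp [ae_iff, measure_singleton]
  -- With the weight 1/|y| the Schur bound is homogeneous of degree -1, like the Coulomb repulsion.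
  refine schur_test (k := fun p q => ENNReal.ofReal (1 / pairForm p q ^ 2))
    (h := fun q => ENNReal.ofReal (1 / ‖q‖ ^ 1))
    (measurable_ofReal_kernel (g := fun x => 1 / x ^ 2) (by fun_prop))
    (fun x y => by rw [pairForm_comm]) (by fun_prop) (ae_ofReal_norm_pow_ne 1).1
    (ae_ofReal_norm_pow_ne 1).2 ?_ hf hg
  filter_upwards [hne] with x hx
  have hn : 0 < ‖x‖ := norm_pos_iff.2 hx
  simp only [pow_one]
  rw [lintegral_pairForm_sq_mul_inv hx, ← ENNReal.ofReal_mul (by positivity)]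
  refine le_of_eq ?_
  congr 1
  field_simp

end Kernels

/-! ### The Gaussian kernel exp(-tQ) in position space -/

section GaussianKernels

open Set Filter Topology

theorem integrable_exp_neg_mul_sq {b : ℝ} (hb : 0 < b) :
    Integrable fun p : R3 => Real.exp (-b * ‖p‖ ^ 2) := by
  have h := (GaussianFourier.integrable_cexp_neg_mul_sq_norm_add (V := R3) (b := (b : ℂ))
    (by simpa using hb) 0 0).norm
  refine h.congr (Filter.Eventually.of_forall fun p => ?_)
  simp [Complex.norm_exp, ← Complex.ofReal_pow]

theorem memLp_exp_neg_mul_sq {b : ℝ} (hb : 0 < b) :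
    MemLp (fun p : R3 => Real.exp (-b * ‖p‖ ^ 2)) 2 volume := by
  have hc : Continuous fun p : R3 => Real.exp (-b * ‖p‖ ^ 2) := by fun_prop
  rw [memLp_two_iff_integrable_sq_norm hc.aestronglyMeasurable]
  refine (integrable_exp_neg_mul_sq (b := 2 * b) (by positivity)).congr
    (Filter.Eventually.of_forall fun p => ?_)
  simp only
  rw [Real.norm_of_nonneg (Real.exp_pos _).le, ← Real.exp_nat_mul]
  congr 1
  push_cast
  ring

theorem lintegral_exp_neg_mul_sq {b : ℝ} (hb : 0 < b) (a : R3) :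
    ∫⁻ q : R3, ENNReal.ofReal (Real.exp (-b * ‖q + a‖ ^ 2)) =
      ENNReal.ofReal ((Real.pi / b) ^ (3 / 2 : ℝ)) := by
  rw [lintegral_add_right_eq_self (fun q : R3 => ENNReal.ofReal (Real.exp (-b * ‖q‖ ^ 2))) a]
  refine lintegral_of_integral ⟨integrable_exp_neg_mul_sq hb, ?_⟩ fun q => (Real.exp_pos _).le
  rw [GaussianFourier.integral_rexp_neg_mul_sq_norm hb]
  simp

/-- The Gaussian average of `f` against plane waves, for `f = ξ̂`. -/
def wavePacket (ξ : L2 R3) (t : ℝ) (z : R3) : ℂ :=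
  ∫ p, ft ξ p * Complex.exp (-(t / 2 : ℝ) * ‖p‖ ^ 2 - Complex.I * (inner ℝ p z : ℝ))

/-- Phases may be discarded only on the position side, where the Gaussian kernels are positive; this
is why ξ̂ is first transformed back to ξ. -/
theorem enorm_wavePacket_le (ξ : L2 R3) {t : ℝ} (ht : 0 < t) (z : R3) :
    ‖wavePacket ξ t z‖ₑ ≤ ENNReal.ofReal (t ^ (-(3 / 2) : ℝ)) *
      ∫⁻ y, ENNReal.ofReal (Real.exp (-‖y + z‖ ^ 2 / (2 * t))) * ‖ξ y‖ₑ := by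
  rw [wavePacket, integral_ft_mul_gaussian ξ ht z, enorm_mul, ← ofReal_norm (_ : ℂ),
    Complex.norm_real, Real.norm_of_nonneg (by positivity)]
  gcongr
  refine (enorm_integral_le_lintegral_enorm _).trans (le_of_eq ?_)
  refine lintegral_congr fun y => ?_
  rw [enorm_mul, mul_comm, ← ofReal_norm (_ : ℂ), Complex.norm_real,
    Real.norm_of_nonneg (Real.exp_pos _).le]

/-- Superposition of Gaussian wave packets. -/
theorem integral_mul_exp_pairForm (ξ : L2 R3) {t : ℝ} (ht : 0 < t) :
    ((2 * Real.pi * t) ^ (3 / 2 : ℝ) : ℝ) *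
      ∫ w : R3 × R3, conj (ft ξ w.1) * ft ξ w.2 * (Real.exp (-t * pairForm w.1 w.2) : ℂ) =
    ∫ z : R3, (Real.exp (-‖z‖ ^ 2 / (2 * t)) : ℂ) *
      (conj (wavePacket ξ t (-z)) * wavePacket ξ t z) := by
  set f := ft ξ with hf
  set e : R3 → R3 → ℂ := fun p z =>
    Complex.exp (-(t / 2 : ℝ) * ‖p‖ ^ 2 - Complex.I * (inner ℝ p z : ℝ)) with he
  have hen : ∀ p z, ‖e p z‖ = Real.exp (-(t / 2) * ‖p‖ ^ 2) := by
    intro p z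
    rw [he, Complex.norm_exp]
    congr 1
    simp [← Complex.ofReal_pow]
  have hfm : AEStronglyMeasurable f volume := (Lp.memLp f).1
  have ha : Integrable fun p => ‖f p‖ * Real.exp (-(t / 2) * ‖p‖ ^ 2) :=
    MemLp.integrable_mul (Lp.memLp f).norm (memLp_exp_neg_mul_sq (by positivity))
  have hg : Integrable fun z : R3 => Real.exp (-‖z‖ ^ 2 / (2 * t)) := by
    refine (integrable_exp_neg_mul_sq (b := 1 / (2 * t)) (by positivity)).congr
      (Eventually.of_forall fun z => ?_)
    simp only
    congr 1
    ring
  set Φ : R3 × R3 → R3 → ℂ := fun w z =>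
    (conj (f w.1) * e w.1 z) * (f w.2 * e w.2 z) * (Real.exp (-‖z‖ ^ 2 / (2 * t)) : ℂ) with hΦ
  have hΦi : Integrable (Function.uncurry Φ) ((volume : Measure (R3 × R3)).prod volume) := by
    have hdom := (ha.mul_prod ha).mul_prod hg
    refine hdom.mono' ?_ (Eventually.of_forall fun w => ?_)
    · have m1 : AEStronglyMeasurable (fun w : (R3 × R3) × R3 => f w.1.1)
          ((volume : Measure (R3 × R3)).prod volume) :=
        (hfm.comp_fst (ν := (volume : Measure R3))).comp_fst
      have m2 : AEStronglyMeasurable (fun w : (R3 × R3) × R3 => f w.1.2)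
          ((volume : Measure (R3 × R3)).prod volume) :=
        (hfm.comp_snd (μ := (volume : Measure R3))).comp_fst
      have c1 : Continuous fun w : (R3 × R3) × R3 => e w.1.1 w.2 := by rw [he]; fun_prop
      have c2 : Continuous fun w : (R3 × R3) × R3 => e w.1.2 w.2 := by rw [he]; fun_prop
      have c3 : Continuous fun w : (R3 × R3) × R3 =>
          (Real.exp (-‖w.2‖ ^ 2 / (2 * t)) : ℂ) := by fun_prop
      exact (((Complex.continuous_conj.comp_aestronglyMeasurable m1).mul
        c1.aestronglyMeasurable).mul (m2.mul c2.aestronglyMeasurable)).mul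
        c3.aestronglyMeasurable
    · simp only [Function.uncurry, hΦ, norm_mul, hen, RCLike.norm_conj, Complex.norm_real]
      rw [Real.norm_of_nonneg (Real.exp_pos _).le]
  -- The coupling factor exp(-t|v|²/2), v = p + q, is the transform of a Gaussian in an auxiliary
  -- variable z; superposing over z decouples p from q.
  have hgauss : ∀ v : R3, ∫ z : R3,
      Complex.exp (-((1 / (2 * t) : ℝ) : ℂ) * ‖z‖ ^ 2 + (-Complex.I) * (inner ℝ v z : ℝ)) =
      (((2 * Real.pi * t) ^ (3 / 2 : ℝ) : ℝ) : ℂ) * (Real.exp (-(t / 2) * ‖v‖ ^ 2) : ℂ) := by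
    intro v
    have hre : 0 < ((((1 / (2 * t) : ℝ) : ℂ))).re := by
      rw [Complex.ofReal_re]; positivity
    rw [GaussianFourier.integral_cexp_neg_mul_sq_norm_add hre]
    congr 1
    · rw [Complex.ofReal_cpow (by positivity)]
      congr 1
      · push_cast
        field_simp
      · simp
    · rw [Complex.ofReal_exp]
      congr 1
      rw [neg_sq, Complex.I_sq]
      push_cast
      field_simp
      ring
  have hin : ∀ w : R3 × R3, ∫ z, Φ w z = (((2 * Real.pi * t) ^ (3 / 2 : ℝ) : ℝ) : ℂ) *
      (conj (f w.1) * f w.2 * (Real.exp (-t * pairForm w.1 w.2) : ℂ)) := by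
    intro w
    have e1 : ∀ z, Φ w z = (conj (f w.1) * f w.2 *
        (Real.exp (-(t / 2) * (‖w.1‖ ^ 2 + ‖w.2‖ ^ 2)) : ℂ)) *
        Complex.exp (-((1 / (2 * t) : ℝ) : ℂ) * ‖z‖ ^ 2 +
          (-Complex.I) * (inner ℝ (w.1 + w.2) z : ℝ)) := by
      intro z
      have : e w.1 z * e w.2 z * (Real.exp (-‖z‖ ^ 2 / (2 * t)) : ℂ) =
          (Real.exp (-(t / 2) * (‖w.1‖ ^ 2 + ‖w.2‖ ^ 2)) : ℂ) *
          Complex.exp (-((1 / (2 * t) : ℝ) : ℂ) * ‖z‖ ^ 2 +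
            (-Complex.I) * (inner ℝ (w.1 + w.2) z : ℝ)) := by
        rw [he, Complex.ofReal_exp, Complex.ofReal_exp, ← Complex.exp_add, ← Complex.exp_add,
          ← Complex.exp_add, inner_add_left]
        congr 1
        push_cast
        ring
      rw [hΦ]
      linear_combination (conj (f w.1) * f w.2) * this
    simp_rw [e1]
    rw [integral_const_mul, hgauss]
    -- This rests on Q(p, q) = (p² + q²)/2 + |p + q|²/2.
    have e2 : Real.exp (-t * pairForm w.1 w.2) =
        Real.exp (-(t / 2) * (‖w.1‖ ^ 2 + ‖w.2‖ ^ 2)) *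
          Real.exp (-(t / 2) * ‖w.1 + w.2‖ ^ 2) := by
      rw [← Real.exp_add, norm_add_sq_real]
      congr 1
      unfold pairForm
      ring
    rw [e2]
    push_cast
    ring
  have hout : ∀ z, ∫ w, Φ w z = (Real.exp (-‖z‖ ^ 2 / (2 * t)) : ℂ) *
      (conj (wavePacket ξ t (-z)) * wavePacket ξ t z) := by
    intro z
    rw [hΦ, integral_mul_const, mul_comm]
    congr 1
    rw [Measure.volume_eq_prod, integral_prod_mul (fun p => conj (f p) * e p z)
      (fun p => f p * e p z)]
    congr 1
    rw [wavePacket, ← integral_conj]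
    congr 1
    ext p
    rw [map_mul, ← Complex.exp_conj]
    congr 2
    simp [← Complex.ofReal_pow, map_ofNat, he, sub_eq_add_neg]
  rw [← integral_const_mul]
  simp_rw [← hin, ← hout]
  exact integral_integral_swap hΦi

/-- Completing the square in z about (x - y)/3 leaves exactly Q(x, y)/(3t) in the exponent: the same
quadratic form reappears in position space. -/
theorem lintegral_three_gaussians {t : ℝ} (ht : 0 < t) (x y : R3) :
    ∫⁻ z : R3, ENNReal.ofReal (Real.exp (-‖z‖ ^ 2 / (2 * t))) *
      (ENNReal.ofReal (Real.exp (-‖x + -z‖ ^ 2 / (2 * t))) *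
        ENNReal.ofReal (Real.exp (-‖y + z‖ ^ 2 / (2 * t)))) =
      ENNReal.ofReal ((2 * Real.pi * t / 3) ^ (3 / 2 : ℝ) *
        Real.exp (-pairForm x y / (3 * t))) := by
  have e : ∀ z : R3, ENNReal.ofReal (Real.exp (-‖z‖ ^ 2 / (2 * t))) *
      (ENNReal.ofReal (Real.exp (-‖x + -z‖ ^ 2 / (2 * t))) *
        ENNReal.ofReal (Real.exp (-‖y + z‖ ^ 2 / (2 * t)))) =
      ENNReal.ofReal (Real.exp (-pairForm x y / (3 * t))) *
        ENNReal.ofReal (Real.exp (-(3 / (2 * t)) * ‖z + (1 / 3 : ℝ) • (y - x)‖ ^ 2)) := by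
    intro z
    rw [← ENNReal.ofReal_mul (Real.exp_pos _).le, ← ENNReal.ofReal_mul (Real.exp_pos _).le,
      ← ENNReal.ofReal_mul (Real.exp_pos _).le, ← Real.exp_add, ← Real.exp_add, ← Real.exp_add]
    congr 2
    rw [norm_add_smul_sq, norm_add_sq_real, norm_add_sq_real, norm_neg, inner_neg_right,
      norm_sub_sq_real, inner_sub_left, pairForm, real_inner_comm y x]
    field_simp
    ring
  simp_rw [e]
  rw [lintegral_const_mul' _ _ ENNReal.ofReal_ne_top, lintegral_exp_neg_mul_sq (by positivity),
    ← ENNReal.ofReal_mul (Real.exp_pos _).le, mul_comm]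
  congr 3
  field_simp

theorem lintegral_mul_lintegral_swap {X : Type} [MeasurableSpace X] {μ : Measure X} [SFinite μ]
    {a : X → ℝ≥0∞} {k l : X → X → ℝ≥0∞} {f : X → ℝ≥0∞} (ha : Measurable a)
    (hk : Measurable (Function.uncurry k)) (hl : Measurable (Function.uncurry l))
    (hf : AEMeasurable f μ) :
    ∫⁻ z, a z * ((∫⁻ x, k x z * f x ∂μ) * ∫⁻ y, l y z * f y ∂μ) ∂μ =
      ∫⁻ x, ∫⁻ y, (∫⁻ z, a z * (k x z * l y z) ∂μ) * (f x * f y) ∂μ ∂μ := by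
  have hkz : ∀ z, AEMeasurable (fun x => k x z * f x) μ := fun z =>
    (hk.comp measurable_prodMk_right).aemeasurable.mul hf
  have hlz : ∀ z, AEMeasurable (fun x => l x z * f x) μ := fun z =>
    (hl.comp measurable_prodMk_right).aemeasurable.mul hf
  have m : AEMeasurable (Function.uncurry fun (z : X) (w : X × X) =>
      a z * ((k w.1 z * f w.1) * (l w.2 z * f w.2))) (μ.prod (μ.prod μ)) := by
    have m1 : Measurable fun w : X × (X × X) => k w.2.1 w.1 :=
      hk.comp (measurable_snd.fst.prodMk measurable_fst)
    have m2 : Measurable fun w : X × (X × X) => l w.2.2 w.1 :=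
      hl.comp (measurable_snd.snd.prodMk measurable_fst)
    have f1 : AEMeasurable (fun w : X × (X × X) => f w.2.1) (μ.prod (μ.prod μ)) :=
      (hf.comp_fst (ν := μ)).comp_snd
    have f2 : AEMeasurable (fun w : X × (X × X) => f w.2.2) (μ.prod (μ.prod μ)) :=
      (hf.comp_snd (μ := μ)).comp_snd
    exact (ha.comp measurable_fst).aemeasurable.mul
      ((m1.aemeasurable.mul f1).mul (m2.aemeasurable.mul f2))
  calc ∫⁻ z, a z * ((∫⁻ x, k x z * f x ∂μ) * ∫⁻ y, l y z * f y ∂μ) ∂μ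
      = ∫⁻ z, ∫⁻ w : X × X, a z * ((k w.1 z * f w.1) * (l w.2 z * f w.2)) ∂(μ.prod μ) ∂μ := by
        refine lintegral_congr fun z => ?_
        rw [← lintegral_prod_mul (hkz z) (hlz z), lintegral_const_mul'']
        exact ((hkz z).comp_fst).mul ((hlz z).comp_snd)
    _ = ∫⁻ w : X × X, ∫⁻ z, a z * ((k w.1 z * f w.1) * (l w.2 z * f w.2)) ∂μ ∂(μ.prod μ) :=
        lintegral_lintegral_swap m
    _ = ∫⁻ w : X × X, (∫⁻ z, a z * (k w.1 z * l w.2 z) ∂μ) * (f w.1 * f w.2) ∂(μ.prod μ) := by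
        refine lintegral_congr fun w => ?_
        have hm : Measurable fun z => a z * (k w.1 z * l w.2 z) :=
          ha.mul ((hk.comp measurable_prodMk_left).mul (hl.comp measurable_prodMk_left))
        rw [← lintegral_mul_const _ hm]
        refine lintegral_congr fun z => ?_
        ring
    _ = _ := by
        rw [lintegral_prod]
        have hm : Measurable fun w : (X × X) × X => a w.2 * (k w.1.1 w.2 * l w.1.2 w.2) :=
          (ha.comp measurable_snd).mul ((hk.comp (measurable_fst.fst.prodMk measurable_snd)).mul
            (hl.comp (measurable_fst.snd.prodMk measurable_snd)))
        exact hm.lintegral_prod_right'.aemeasurable.mul (hf.comp_fst.mul hf.comp_snd)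

/-- The two wave packets contribute t^{-3/2} each, and (2πt/3)^{3/2} / (2πt)^{3/2} = 1/(3√3). -/
theorem enorm_integral_mul_exp_pairForm_le (ξ : L2 R3) {t : ℝ} (ht : 0 < t) :
    ‖∫ w : R3 × R3, conj (ft ξ w.1) * ft ξ w.2 * (Real.exp (-t * pairForm w.1 w.2) : ℂ)‖ₑ ≤
      ∫⁻ x, ∫⁻ y, ENNReal.ofReal (1 / (3 * √3) * (1 / t ^ 3 * Real.exp (-pairForm x y / (3 * t))))
        * (‖ξ x‖ₑ * ‖ξ y‖ₑ) := by
  set C : ℝ := (2 * Real.pi * t) ^ (3 / 2 : ℝ) with hC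
  have hC0 : 0 < C := by positivity
  set D : ℝ := t ^ (-(3 / 2) : ℝ) with hD
  have hD0 : 0 < D := by positivity
  set B := ∫ w : R3 × R3, conj (ft ξ w.1) * ft ξ w.2 * (Real.exp (-t * pairForm w.1 w.2) : ℂ)
  have hfm : AEMeasurable (fun x => ‖ξ x‖ₑ) volume := (Lp.memLp ξ).1.enorm
  have h1 : ENNReal.ofReal C * ‖B‖ₑ ≤ ENNReal.ofReal (D * D) *
      ∫⁻ x, ∫⁻ y, ENNReal.ofReal ((2 * Real.pi * t / 3) ^ (3 / 2 : ℝ) *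
        Real.exp (-pairForm x y / (3 * t))) * (‖ξ x‖ₑ * ‖ξ y‖ₑ) := by
    have h2 := integral_mul_exp_pairForm ξ ht
    calc ENNReal.ofReal C * ‖B‖ₑ = ‖(C : ℂ) * B‖ₑ := by
          rw [enorm_mul, ← ofReal_norm (C : ℂ), Complex.norm_real, Real.norm_of_nonneg hC0.le]
      _ ≤ ∫⁻ z : R3, ENNReal.ofReal (Real.exp (-‖z‖ ^ 2 / (2 * t))) *
          (‖wavePacket ξ t (-z)‖ₑ * ‖wavePacket ξ t z‖ₑ) := by
          rw [h2]
          refine (enorm_integral_le_lintegral_enorm _).trans (le_of_eq ?_)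
          refine lintegral_congr fun z => ?_
          rw [enorm_mul, enorm_mul, RCLike.enorm_conj, ← ofReal_norm (_ : ℂ), Complex.norm_real,
            Real.norm_of_nonneg (Real.exp_pos _).le]
      _ ≤ ∫⁻ z : R3, ENNReal.ofReal (D * D) * (ENNReal.ofReal (Real.exp (-‖z‖ ^ 2 / (2 * t))) *
          ((∫⁻ x, ENNReal.ofReal (Real.exp (-‖x + -z‖ ^ 2 / (2 * t))) * ‖ξ x‖ₑ) *
            ∫⁻ y, ENNReal.ofReal (Real.exp (-‖y + z‖ ^ 2 / (2 * t))) * ‖ξ y‖ₑ)) := by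
          refine lintegral_mono fun z => ?_
          have a1 := enorm_wavePacket_le ξ ht (-z)
          have a2 := enorm_wavePacket_le ξ ht z
          refine (mul_le_mul_right (mul_le_mul' a1 a2) _).trans (le_of_eq ?_)
          rw [ENNReal.ofReal_mul hD0.le]
          ring
      _ = _ := by
          rw [lintegral_const_mul' _ _ ENNReal.ofReal_ne_top]
          congr 1
          rw [lintegral_mul_lintegral_swap
            (a := fun z => ENNReal.ofReal (Real.exp (-‖z‖ ^ 2 / (2 * t))))
            (k := fun x z => ENNReal.ofReal (Real.exp (-‖x + -z‖ ^ 2 / (2 * t))))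
            (l := fun y z => ENNReal.ofReal (Real.exp (-‖y + z‖ ^ 2 / (2 * t))))
            (by fun_prop) (by unfold Function.uncurry; fun_prop)
            (by unfold Function.uncurry; fun_prop) hfm]
          simp_rw [lintegral_three_gaussians ht]
  have h3 : ENNReal.ofReal C * ‖B‖ₑ ≤ ENNReal.ofReal C *
      ∫⁻ x, ∫⁻ y, ENNReal.ofReal (1 / (3 * √3) * (1 / t ^ 3 * Real.exp (-pairForm x y / (3 * t))))
        * (‖ξ x‖ₑ * ‖ξ y‖ₑ) := by
    refine h1.trans (le_of_eq ?_)
    rw [← lintegral_const_mul' _ _ ENNReal.ofReal_ne_top,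
      ← lintegral_const_mul' _ _ ENNReal.ofReal_ne_top]
    refine lintegral_congr fun x => ?_
    rw [← lintegral_const_mul' _ _ ENNReal.ofReal_ne_top,
      ← lintegral_const_mul' _ _ ENNReal.ofReal_ne_top]
    refine lintegral_congr fun y => ?_
    rw [← mul_assoc, ← ENNReal.ofReal_mul (by positivity), ← mul_assoc (ENNReal.ofReal C),
      ← ENNReal.ofReal_mul (by positivity)]
    congr 2
    have hDD : D * D = 1 / t ^ 3 := by
      rw [hD, ← Real.rpow_add ht, show (-(3 / 2) + -(3 / 2) : ℝ) = -((3 : ℕ) : ℝ) by norm_num,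
        Real.rpow_neg ht.le, Real.rpow_natCast, one_div]
    have h33 : (3 : ℝ) ^ (3 / 2 : ℝ) = 3 * √3 := by
      rw [show (3 / 2 : ℝ) = 1 + 1 / 2 by norm_num, Real.rpow_add (by norm_num), Real.rpow_one,
        Real.sqrt_eq_rpow]
    rw [hDD, Real.div_rpow (by positivity) (by norm_num), h33, ← hC]
    field_simp
  refine (ENNReal.mul_le_mul_iff_right ?_ ENNReal.ofReal_ne_top).1 h3
  simpa using hC0

theorem lintegral_exp_neg_div {a : ℝ} (ha : 0 < a) :
    ∫⁻ t in Ioi (0 : ℝ), ENNReal.ofReal (1 / t ^ 3 * Real.exp (-a / t)) =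
      ENNReal.ofReal (1 / a ^ 2) := by
  set G : ℝ → ℝ := fun t => Real.exp (-a / t) * (1 / (a * t) + 1 / a ^ 2) with hG
  -- At t = 0 the convention for division by zero gives `G` the value 1/a², whereas its limit from
  -- the right is 0; the primitive has to be redefined there.
  set G' : ℝ → ℝ := fun t => if t = 0 then 0 else G t with hG'
  have hd : ∀ t ∈ Ioi (0 : ℝ), HasDerivAt G' (1 / t ^ 3 * Real.exp (-a / t)) t := by
    intro t ht
    have ht0 : t ≠ 0 := (mem_Ioi.1 ht).ne'
    have h1 : HasDerivAt (fun t : ℝ => -a / t) (a / t ^ 2) t := by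
      convert! (hasDerivAt_const t (-a)).fun_div (hasDerivAt_id t) ht0 using 1
      simp only [id]
      ring
    have h2 : HasDerivAt (fun t : ℝ => 1 / (a * t)) (-(a / (a * t) ^ 2)) t := by
      convert! (hasDerivAt_const t (1 : ℝ)).fun_div ((hasDerivAt_id t).const_mul a)
        (mul_ne_zero ha.ne' ht0) using 1
      simp only [id]
      ring
    have h3 : HasDerivAt G (1 / t ^ 3 * Real.exp (-a / t)) t := by
      convert! h1.exp.fun_mul (h2.add_const (1 / a ^ 2)) using 1
      field_simp
      ring
    refine h3.congr_of_eventuallyEq ?_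
    filter_upwards [isOpen_ne.mem_nhds ht0] with s hs
    simp only [hG']
    rw [if_neg hs]
  have hc : ContinuousWithinAt G' (Ici 0) 0 := by
    have h0 : G' 0 = 0 := by simp [hG']
    rw [← continuousWithinAt_Ioi_iff_Ici, ContinuousWithinAt, h0]
    have hlim : Tendsto (fun s : ℝ => Real.exp (-s) * (s / a ^ 2 + 1 / a ^ 2)) atTop (𝓝 0) := by
      have h1 := Real.tendsto_pow_mul_exp_neg_atTop_nhds_zero 1
      have h2 := Real.tendsto_pow_mul_exp_neg_atTop_nhds_zero 0
      have h3 := (h1.mul_const (1 / a ^ 2)).add (h2.mul_const (1 / a ^ 2))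
      simp only [zero_mul, add_zero] at h3
      refine h3.congr fun s => ?_
      ring
    have hin : Tendsto (fun t : ℝ => a / t) (𝓝[>] 0) atTop := by
      simp_rw [div_eq_mul_inv]
      exact tendsto_inv_nhdsGT_zero.const_mul_atTop ha
    refine (hlim.comp hin).congr' ?_
    filter_upwards [self_mem_nhdsWithin] with t ht
    have ht0 : t ≠ 0 := (mem_Ioi.1 ht).ne'
    simp only [hG', hG, Function.comp_apply]
    rw [if_neg ht0, neg_div]
    congr 1
    field_simp
  have hl : Tendsto G' atTop (𝓝 (1 * (0 + 1 / a ^ 2))) := by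
    have h1 : Tendsto (fun t : ℝ => -a / t) atTop (𝓝 0) :=
      tendsto_const_nhds.div_atTop tendsto_id
    have h2 : Tendsto (fun t : ℝ => 1 / (a * t)) atTop (𝓝 0) :=
      tendsto_const_nhds.div_atTop (tendsto_id.const_mul_atTop ha)
    have h3 := (Real.continuous_exp.tendsto 0).comp h1
    rw [Real.exp_zero] at h3
    refine (h3.mul (h2.add_const _)).congr' ?_
    filter_upwards [eventually_ne_atTop 0] with t ht
    simp only [hG', hG, Function.comp_apply]
    rw [if_neg ht]
  have h0 : ∀ t ∈ Ioi (0 : ℝ), 0 ≤ 1 / t ^ 3 * Real.exp (-a / t) := by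
    intro t ht
    have : 0 < t := ht
    positivity
  have h1 := integral_Ioi_of_hasDerivAt_of_nonneg hc hd h0 hl
  rw [← ofReal_integral_eq_lintegral_ofReal (integrableOn_Ioi_deriv_of_nonneg hc hd h0 hl)
    ((ae_restrict_iff' measurableSet_Ioi).2 (Eventually.of_forall h0)), h1]
  congr 1
  simp [hG']

end GaussianKernels

/-! ### The exchange form against the Coulomb energy, and Kato's inequality -/

section KatoAndCharge

open Set Filter Topology

theorem lintegral_enorm_sq {E : Type} [NormedAddCommGroup E] [InnerProductSpace ℝ E]
    [FiniteDimensional ℝ E] [MeasurableSpace E] [BorelSpace E] (u : L2 E) :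
    ∫⁻ x, ‖u x‖ₑ ^ 2 = ENNReal.ofReal (‖u‖ ^ 2) := by
  rw [norm_sq_eq_integral, ofReal_integral_eq_lintegral_ofReal
    ((memLp_two_iff_integrable_sq_norm (Lp.memLp u).1).1 (Lp.memLp u))
    (Eventually.of_forall fun x => by positivity)]
  refine lintegral_congr fun x => ?_
  rw [← ofReal_norm, ENNReal.ofReal_pow (norm_nonneg _)]

theorem ae_ne_zero_R3 : ∀ᵐ q : R3, q ≠ 0 := by
  simp [ae_iff, measure_singleton]

theorem lintegral_kernel_swap {X : Type} [MeasurableSpace X] {ν : Measure X} [SFinite ν]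
    {k : ℝ → X → ℝ≥0∞} (hk : Measurable (Function.uncurry k)) {F : X → ℝ≥0∞}
    (hF : AEMeasurable F ν) :
    ∫⁻ s in Ioi (0 : ℝ), ∫⁻ p, k s p * F p ∂ν = ∫⁻ p, (∫⁻ s in Ioi (0 : ℝ), k s p) * F p ∂ν := by
  rw [lintegral_lintegral_swap (hk.aemeasurable.mul hF.comp_snd)]
  refine lintegral_congr fun p => ?_
  have hp : Measurable fun s => k s p := hk.comp measurable_prodMk_right
  rw [lintegral_mul_const _ hp]

/-- The exchange form of a charge is controlled by a position space kernel. -/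
theorem enorm_integral_div_pairForm_le (ξ : L2 R3) {lam : ℝ} (hlam : 0 < lam)
    (hint : Integrable fun w : R3 × R3 =>
      ‖ft ξ w.1‖ * ‖ft ξ w.2‖ * (1 / (pairForm w.1 w.2 + lam))) :
    ‖∫ w : R3 × R3, conj (ft ξ w.1) * ft ξ w.2 * ((1 / (pairForm w.1 w.2 + lam) : ℝ) : ℂ)‖ₑ ≤
      ∫⁻ x, ∫⁻ y, ENNReal.ofReal (√3 * (1 / pairForm x y ^ 2)) * (‖ξ x‖ₑ * ‖ξ y‖ₑ) := by
  have hfm : AEStronglyMeasurable (ft ξ) volume := (Lp.memLp (ft ξ)).1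
  have hpos : ∀ w : R3 × R3, -(pairForm w.1 w.2 + lam) < 0 := fun w => by
    have := pairForm_nonneg w.1 w.2
    linarith
  -- The resolvent kernel is the Laplace transform of exp(-t(Q + λ)), to which the Gaussian estimate
  -- applies for each t.
  have hlap : ∀ w : R3 × R3, ∫ t in Ioi (0 : ℝ), Real.exp (-(pairForm w.1 w.2 + lam) * t) =
      1 / (pairForm w.1 w.2 + lam) := fun w => by
    rw [integral_exp_mul_Ioi (hpos w), mul_zero, Real.exp_zero, neg_div_neg_eq]
  set Φ : R3 × R3 → ℝ → ℂ := fun w t =>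
    conj (ft ξ w.1) * ft ξ w.2 * (Real.exp (-(pairForm w.1 w.2 + lam) * t) : ℂ) with hΦ
  have hΦm : AEStronglyMeasurable (Function.uncurry Φ)
      ((volume : Measure (R3 × R3)).prod (volume.restrict (Ioi 0))) := by
    have m1 : AEStronglyMeasurable (fun w : (R3 × R3) × ℝ => ft ξ w.1.1)
        ((volume : Measure (R3 × R3)).prod (volume.restrict (Ioi 0))) :=
      (hfm.comp_fst (ν := (volume : Measure R3))).comp_fst
    have m2 : AEStronglyMeasurable (fun w : (R3 × R3) × ℝ => ft ξ w.1.2)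
        ((volume : Measure (R3 × R3)).prod (volume.restrict (Ioi 0))) :=
      (hfm.comp_snd (μ := (volume : Measure R3))).comp_fst
    have c3 : Continuous fun w : (R3 × R3) × ℝ =>
        (Real.exp (-(pairForm w.1.1 w.1.2 + lam) * w.2) : ℂ) := by
      unfold pairForm
      fun_prop
    exact ((Complex.continuous_conj.comp_aestronglyMeasurable m1).mul m2).mul
      c3.aestronglyMeasurable
  have hΦn : ∀ w t, ‖Φ w t‖ =
      ‖ft ξ w.1‖ * ‖ft ξ w.2‖ * Real.exp (-(pairForm w.1 w.2 + lam) * t) := fun w t => by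
    rw [hΦ, norm_mul, norm_mul, RCLike.norm_conj, Complex.norm_real,
      Real.norm_of_nonneg (Real.exp_pos _).le]
  have hΦi : Integrable (Function.uncurry Φ)
      ((volume : Measure (R3 × R3)).prod (volume.restrict (Ioi 0))) := by
    rw [integrable_prod_iff hΦm]
    constructor
    · refine Eventually.of_forall fun w => ?_
      exact ((integrableOn_exp_mul_Ioi (hpos w) 0).ofReal (𝕜 := ℂ)).const_mul
        (conj (ft ξ w.1) * ft ξ w.2)
    · refine hint.congr (Eventually.of_forall fun w => ?_)
      simp only [Function.uncurry, hΦn]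
      rw [integral_const_mul, hlap]
  have h1 : ∫ w : R3 × R3, conj (ft ξ w.1) * ft ξ w.2 *
      ((1 / (pairForm w.1 w.2 + lam) : ℝ) : ℂ) = ∫ t in Ioi (0 : ℝ), ∫ w, Φ w t := by
    rw [← integral_integral_swap hΦi]
    refine integral_congr_ae (Eventually.of_forall fun w => ?_)
    simp only [hΦ]
    rw [integral_const_mul, ← hlap w, integral_complex_ofReal]
  have hxm : AEMeasurable (fun x => ‖ξ x‖ₑ) volume := (Lp.memLp ξ).1.enorm
  set k : ℝ → R3 × R3 → ℝ≥0∞ := fun t w =>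
    ENNReal.ofReal (1 / (3 * √3) * (1 / t ^ 3 * Real.exp (-pairForm w.1 w.2 / (3 * t)))) with hk
  have hkm : Measurable (Function.uncurry k) := by
    have : Measurable fun w : ℝ × (R3 × R3) => pairForm w.2.1 w.2.2 :=
      continuous_pairForm.measurable.comp measurable_snd
    simp only [hk]
    fun_prop
  have hff : AEMeasurable (fun w : R3 × R3 => ‖ξ w.1‖ₑ * ‖ξ w.2‖ₑ) volume :=
    (hxm.comp_fst (ν := (volume : Measure R3))).mul (hxm.comp_snd (μ := (volume : Measure R3)))
  -- The time integral of t⁻³ exp(-Q/(3t)) is 9/Q², and 9/(3√3) = √3.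
  have htime : ∀ x y : R3, x ≠ 0 → ∫⁻ t in Ioi (0 : ℝ), k t (x, y) =
      ENNReal.ofReal (√3 * (1 / pairForm x y ^ 2)) := by
    intro x y hx
    have hQ := pairForm_pos hx y
    have e : ∀ t : ℝ, k t (x, y) = ENNReal.ofReal (1 / (3 * √3)) *
        ENNReal.ofReal (1 / t ^ 3 * Real.exp (-(pairForm x y / 3) / t)) := by
      intro t
      rw [← ENNReal.ofReal_mul (by positivity)]
      simp only [hk]
      congr 4
      ring
    simp_rw [e]
    rw [lintegral_const_mul' _ _ ENNReal.ofReal_ne_top, lintegral_exp_neg_div (by positivity),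
      ← ENNReal.ofReal_mul (by positivity)]
    congr 1
    have : √3 * √3 = 3 := Real.mul_self_sqrt (by norm_num)
    field_simp
    nlinarith
  rw [h1]
  calc ‖∫ t in Ioi (0 : ℝ), ∫ w, Φ w t‖ₑ
      ≤ ∫⁻ t in Ioi (0 : ℝ), ‖∫ w, Φ w t‖ₑ := enorm_integral_le_lintegral_enorm _
    _ ≤ ∫⁻ t in Ioi (0 : ℝ), ∫⁻ w : R3 × R3, k t w * (‖ξ w.1‖ₑ * ‖ξ w.2‖ₑ) := by
        refine setLIntegral_mono' measurableSet_Ioi fun t ht => ?_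
        have e : ∫ w, Φ w t = (Real.exp (-lam * t) : ℂ) *
            ∫ w : R3 × R3, conj (ft ξ w.1) * ft ξ w.2 *
              (Real.exp (-t * pairForm w.1 w.2) : ℂ) := by
          rw [← integral_const_mul]
          congr 1
          ext w
          simp only [hΦ]
          have : Real.exp (-(pairForm w.1 w.2 + lam) * t) =
              Real.exp (-lam * t) * Real.exp (-t * pairForm w.1 w.2) := by
            rw [← Real.exp_add]
            congr 1
            ring
          rw [this, Complex.ofReal_mul]
          ring
        -- The factor exp(-λt) is simply bounded by one, so the estimate does not depend on λ.
        have h2 : ‖(Real.exp (-lam * t) : ℂ)‖ₑ ≤ 1 := by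
          rw [← ofReal_norm, Complex.norm_real, Real.norm_of_nonneg (Real.exp_pos _).le,
            ENNReal.ofReal_le_one, Real.exp_le_one_iff]
          have : 0 < t := ht
          nlinarith
        rw [e, enorm_mul]
        refine (mul_le_mul' h2 (enorm_integral_mul_exp_pairForm_le ξ ht)).trans (le_of_eq ?_)
        rw [one_mul, Measure.volume_eq_prod, lintegral_prod]
        exact (hkm.comp measurable_prodMk_left).aemeasurable.mul hff
    _ = ∫⁻ w : R3 × R3, (∫⁻ t in Ioi (0 : ℝ), k t w) * (‖ξ w.1‖ₑ * ‖ξ w.2‖ₑ) := by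
        exact lintegral_kernel_swap hkm hff
    _ = ∫⁻ x, ∫⁻ y, (∫⁻ t in Ioi (0 : ℝ), k t (x, y)) * (‖ξ x‖ₑ * ‖ξ y‖ₑ) := by
        rw [Measure.volume_eq_prod, lintegral_prod]
        exact (hkm.lintegral_prod_left' (μ := volume.restrict (Ioi 0))).aemeasurable.mul hff
    _ = _ := by
        refine lintegral_congr_ae ?_
        filter_upwards [ae_ne_zero_R3] with x hx
        simp_rw [htime x _ hx]

/-- The exchange form of a charge is controlled by its Coulomb energy. -/
theorem enorm_integral_div_pairForm_le_coulomb (ξ : L2 R3) {lam : ℝ} (hlam : 0 < lam)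
    (hint : Integrable fun w : R3 × R3 =>
      ‖ft ξ w.1‖ * ‖ft ξ w.2‖ * (1 / (pairForm w.1 w.2 + lam))) :
    ‖∫ w : R3 × R3, conj (ft ξ w.1) * ft ξ w.2 * ((1 / (pairForm w.1 w.2 + lam) : ℝ) : ℂ)‖ₑ ≤
      ENNReal.ofReal (4 * Real.pi ^ 2 / 3) * ∫⁻ x, ENNReal.ofReal (1 / ‖x‖) * ‖ξ x‖ₑ ^ 2 := by
  refine (enorm_integral_div_pairForm_le ξ hlam hint).trans ?_
  have hxm : AEMeasurable (fun x => ‖ξ x‖ₑ) volume := (Lp.memLp ξ).1.enorm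
  -- With equal arguments the factor 2 cancels; the constant becomes √3 · 4π²/(3√3) = 4π²/3.
  have h := schur_position hxm hxm
  rw [← two_mul, ENNReal.mul_le_mul_iff_right (by norm_num) (by norm_num)] at h
  have e1 : ∫⁻ x, ∫⁻ y, ENNReal.ofReal (√3 * (1 / pairForm x y ^ 2)) * (‖ξ x‖ₑ * ‖ξ y‖ₑ) =
      ENNReal.ofReal √3 *
        ∫⁻ x, ∫⁻ y, ENNReal.ofReal (1 / pairForm x y ^ 2) * (‖ξ x‖ₑ * ‖ξ y‖ₑ) := by
    simp_rw [ENNReal.ofReal_mul (Real.sqrt_nonneg 3), mul_assoc]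
    rw [← lintegral_const_mul' _ _ ENNReal.ofReal_ne_top]
    refine lintegral_congr fun x => ?_
    rw [lintegral_const_mul' _ _ ENNReal.ofReal_ne_top]
  rw [e1]
  refine (mul_le_mul_right h _).trans (le_of_eq ?_)
  rw [← lintegral_const_mul' _ _ ENNReal.ofReal_ne_top,
    ← lintegral_const_mul' _ _ ENNReal.ofReal_ne_top]
  refine lintegral_congr fun x => ?_
  rw [← mul_assoc, ← mul_assoc, ← ENNReal.ofReal_mul (by positivity),
    ← ENNReal.ofReal_mul (by positivity)]
  congr 2
  field_simp

/-! ### Coulomb energy and momentum -/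

/-- On the ball the integrand is at most 2s²/(q²(q² + s²)), whose integral over all of space has an
arctangent primitive. The constant is not sharp, and need not be: Kato's inequality is used only for
finiteness and boundedness. -/
theorem setLIntegral_ball_inv_sq_le {s : ℝ} (hs : 0 < s) :
    ∫⁻ q in Metric.ball (0 : R3) s, ENNReal.ofReal (1 / ‖q‖ ^ 2) ≤
      ENNReal.ofReal (4 * Real.pi ^ 2 * s) := by
  have hd : ∀ y ∈ Ioi (0 : ℝ), HasDerivAt (fun y => 2 * s * Real.arctan (y / s))
      (y ^ 2 * (2 * s ^ 2 / (y ^ 2 * (y ^ 2 + s ^ 2)))) y := by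
    intro y hy
    have hy0 : 0 < y := hy
    convert! (hasDerivAt_arctan_div hs y).const_mul (2 * s) using 1
    field_simp
  have h := radial_integral (l := 2 * s * (Real.pi / 2))
    (by fun_prop : ContinuousWithinAt (fun y => 2 * s * Real.arctan (y / s)) (Ici 0) 0) hd
    (fun y _ => by positivity) ((tendsto_arctan_div hs).const_mul _)
  have h2 := lintegral_of_integral h fun q => by positivity
  calc ∫⁻ q in Metric.ball (0 : R3) s, ENNReal.ofReal (1 / ‖q‖ ^ 2)
      ≤ ∫⁻ q in Metric.ball (0 : R3) s,
          ENNReal.ofReal (2 * s ^ 2 / (‖q‖ ^ 2 * (‖q‖ ^ 2 + s ^ 2))) := by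
        refine setLIntegral_mono' measurableSet_ball fun q hq => ENNReal.ofReal_le_ofReal ?_
        have hq' : ‖q‖ < s := by simpa using hq
        rcases eq_or_ne q 0 with rfl | h0
        · simp
        · have hn := norm_pos_iff.2 h0
          rw [div_le_div_iff₀ (by positivity) (by positivity)]
          have : ‖q‖ ^ 2 ≤ s ^ 2 := by gcongr
          have h3 : 0 < ‖q‖ ^ 2 := by positivity
          nlinarith
    _ ≤ ∫⁻ q : R3, ENNReal.ofReal (2 * s ^ 2 / (‖q‖ ^ 2 * (‖q‖ ^ 2 + s ^ 2))) :=
        setLIntegral_le_lintegral _ _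
    _ ≤ _ := by
        rw [h2]
        refine le_of_eq ?_
        congr 1
        simp
        ring

/-- Cauchy–Schwarz with weight |p|⁻², obtained as Schur's test for the constant kernel on the ball.
-/
theorem sq_setLIntegral_ball_le {F : R3 → ℝ≥0∞} (hF : AEMeasurable F volume) {s : ℝ}
    (hs : 0 < s) :
    (∫⁻ p in Metric.ball (0 : R3) s, F p) ^ 2 ≤
      ∫⁻ p in Metric.ball (0 : R3) s, ENNReal.ofReal (4 * Real.pi ^ 2 * s * ‖p‖ ^ 2) * F p ^ 2 := by
  have h := schur_test (μ := volume.restrict (Metric.ball (0 : R3) s)) (k := fun _ _ => 1)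
    (h := fun q => ENNReal.ofReal (1 / ‖q‖ ^ 2))
    (W := fun p => ENNReal.ofReal (4 * Real.pi ^ 2 * s * ‖p‖ ^ 2)) (by fun_prop)
    (fun _ _ => rfl) (by fun_prop) (ae_restrict_of_ae (ae_ofReal_norm_pow_ne 2).1)
    (ae_restrict_of_ae (ae_ofReal_norm_pow_ne 2).2) ?_ hF.restrict hF.restrict
  · rw [← two_mul, ENNReal.mul_le_mul_iff_right (by norm_num) (by norm_num)] at h
    refine le_trans (le_of_eq ?_) h
    simp_rw [one_mul]
    rw [sq, ← lintegral_mul_const'' _ hF.restrict]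
    refine lintegral_congr fun x => ?_
    rw [lintegral_const_mul'' _ hF.restrict]
  · filter_upwards [ae_restrict_of_ae ae_ne_zero_R3] with p hp
    have hn := norm_pos_iff.2 hp
    simp_rw [one_mul]
    refine (setLIntegral_ball_inv_sq_le hs).trans (le_of_eq ?_)
    rw [← ENNReal.ofReal_mul (by positivity)]
    congr 1
    field_simp

/-- Splitting of a function on a ball into its low and high momenta. -/
theorem setLIntegral_ball_le (ξ : L2 R3) {s : ℝ} (hs : 0 < s) :
    ∫⁻ x in Metric.ball (0 : R3) (1 / s), ‖ξ x‖ₑ ^ 2 ≤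
      2 * (ENNReal.ofReal (4 * Real.pi ^ 2) * volume (Metric.ball (0 : R3) 1)) *
        (∫⁻ p, (if ‖p‖ < s then ENNReal.ofReal (1 / s ^ 2 * ‖p‖ ^ 2) else 0) * ‖ft ξ p‖ₑ ^ 2) +
      2 * ∫⁻ p, (if ‖p‖ < s then 0 else 1) * ‖ft ξ p‖ₑ ^ 2 := by
  set f := ft ξ with hf
  set B := Metric.ball (0 : R3) s with hB
  have hBm : MeasurableSet B := measurableSet_ball
  have hfm : AEMeasurable (fun p => ‖f p‖ₑ) volume := (Lp.memLp f).1.enorm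
  have hl2 : MemLp (B.indicator f) 2 volume := (Lp.memLp f).indicator hBm
  have hh2 : MemLp (Bᶜ.indicator f) 2 volume := (Lp.memLp f).indicator hBm.compl
  have hl1 : Integrable (B.indicator f) := by
    rw [integrable_indicator_iff hBm]
    have : IsFiniteMeasure (volume.restrict B) := ⟨by
      rw [Measure.restrict_apply_univ]; exact measure_ball_lt_top⟩
    exact ((Lp.memLp f).restrict B).integrable (by norm_num)
  -- The splitting is at momentum s on the ball of radius 1/s, the scale at which both parts
  -- contribute comparably.
  have hsum : ξ = ft.symm hl2.toLp + ft.symm hh2.toLp := by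
    rw [← map_add, ← MemLp.toLp_add, LinearIsometryEquiv.eq_symm_apply]
    refine Lp.ext ?_
    filter_upwards [MemLp.coeFn_toLp (hl2.add hh2)] with p hp
    rw [hp, indicator_self_add_compl]
  -- The low-momentum part is bounded pointwise by the L¹ norm of its transform; the prefactor
  -- (2π)^{-3/2} is at most one.
  have hlow : ∀ᵐ x, ‖(ft.symm hl2.toLp : L2 R3) x‖ₑ ≤ ∫⁻ p in B, ‖f p‖ₑ := by
    filter_upwards [ft_symm_toLp_ae hl1 hl2] with x hx
    rw [hx, enorm_mul]
    have h1 : ‖(((2 * Real.pi) ^ (-((Module.finrank ℝ R3 : ℝ) / 2)) : ℝ) : ℂ)‖ₑ ≤ 1 := by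
      rw [← ofReal_norm, Complex.norm_real, Real.norm_of_nonneg (by positivity),
        ENNReal.ofReal_le_one]
      exact Real.rpow_le_one_of_one_le_of_nonpos (by linarith [Real.pi_gt_three])
        (by rw [neg_nonpos]; positivity)
    refine (mul_le_mul' h1 (enorm_integral_le_lintegral_enorm _)).trans (le_of_eq ?_)
    rw [one_mul, ← lintegral_indicator hBm]
    refine lintegral_congr fun p => ?_
    have h2 : ‖Complex.exp (Complex.I * (inner ℝ p x : ℝ))‖ₑ = 1 := by
      rw [← ofReal_norm, mul_comm, Complex.norm_exp_ofReal_mul_I, ENNReal.ofReal_one]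
    rw [enorm_mul, h2, one_mul, enorm_indicator_eq_indicator_enorm]
  have hhigh : ∫⁻ x, ‖(ft.symm hh2.toLp : L2 R3) x‖ₑ ^ 2 =
      ∫⁻ p, (if ‖p‖ < s then 0 else 1) * ‖f p‖ₑ ^ 2 := by
    rw [lintegral_enorm_sq, LinearIsometryEquiv.norm_map, ← lintegral_enorm_sq]
    refine lintegral_congr_ae ?_
    filter_upwards [MemLp.coeFn_toLp hh2] with p hp
    rw [hp]
    by_cases h : ‖p‖ < s
    · simp [h, hB]
    · simp [h, hB]
  have hsplit : ∀ᵐ x, ‖ξ x‖ₑ ^ 2 ≤ 2 * (∫⁻ p in B, ‖f p‖ₑ) ^ 2 +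
      2 * ‖(ft.symm hh2.toLp : L2 R3) x‖ₑ ^ 2 := by
    have h0 := Lp.coeFn_add (ft.symm hl2.toLp : L2 R3) (ft.symm hh2.toLp)
    rw [← hsum] at h0
    filter_upwards [h0, hlow] with x hx hx2
    rw [hx, Pi.add_apply]
    have h3 : ‖(ft.symm hl2.toLp : L2 R3) x + (ft.symm hh2.toLp : L2 R3) x‖ₑ ≤
      (∫⁻ p in B, ‖f p‖ₑ) + ‖(ft.symm hh2.toLp : L2 R3) x‖ₑ :=
      (enorm_add_le _ _).trans (add_le_add hx2 le_rfl)
    refine (pow_le_pow_left' h3 2).trans ?_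
    have h4 := two_mul_mul_le_weighted (∫⁻ p in B, ‖f p‖ₑ)
      ‖(ft.symm hh2.toLp : L2 R3) x‖ₑ 1 one_ne_zero ENNReal.one_ne_top
    rw [inv_one, mul_one, mul_one] at h4
    rw [add_sq, mul_assoc, two_mul (_ ^ 2), two_mul (_ ^ 2)]
    refine (add_le_add (add_le_add le_rfl h4) le_rfl).trans (le_of_eq ?_)
    ring
  have hvol : volume (Metric.ball (0 : R3) (1 / s)) =
      ENNReal.ofReal (1 / s ^ 3) * volume (Metric.ball (0 : R3) 1) := by
    rw [Measure.addHaar_ball_of_pos _ _ (by positivity)]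
    congr 2
    simp
  calc ∫⁻ x in Metric.ball (0 : R3) (1 / s), ‖ξ x‖ₑ ^ 2
      ≤ ∫⁻ x in Metric.ball (0 : R3) (1 / s), (2 * (∫⁻ p in B, ‖f p‖ₑ) ^ 2 +
          2 * ‖(ft.symm hh2.toLp : L2 R3) x‖ₑ ^ 2) :=
        lintegral_mono_ae (ae_restrict_of_ae hsplit)
    _ = 2 * (∫⁻ p in B, ‖f p‖ₑ) ^ 2 * volume (Metric.ball (0 : R3) (1 / s)) +
        2 * ∫⁻ x in Metric.ball (0 : R3) (1 / s), ‖(ft.symm hh2.toLp : L2 R3) x‖ₑ ^ 2 := by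
        rw [lintegral_add_left measurable_const, setLIntegral_const,
          lintegral_const_mul' _ _ (by norm_num)]
    _ ≤ 2 * (∫⁻ p in B, ENNReal.ofReal (4 * Real.pi ^ 2 * s * ‖p‖ ^ 2) * ‖f p‖ₑ ^ 2) *
        (ENNReal.ofReal (1 / s ^ 3) * volume (Metric.ball (0 : R3) 1)) +
        2 * ∫⁻ p, (if ‖p‖ < s then 0 else 1) * ‖f p‖ₑ ^ 2 := by
        rw [← hhigh, hvol]
        gcongr
        · exact sq_setLIntegral_ball_le hfm hs
        · exact Measure.restrict_le_self
    _ = _ := by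
        congr 1
        have e : ∫⁻ p in B, ENNReal.ofReal (4 * Real.pi ^ 2 * s * ‖p‖ ^ 2) * ‖f p‖ₑ ^ 2 =
            ENNReal.ofReal (4 * Real.pi ^ 2 * s ^ 3) *
            ∫⁻ p, (if ‖p‖ < s then ENNReal.ofReal (1 / s ^ 2 * ‖p‖ ^ 2) else 0) *
              ‖f p‖ₑ ^ 2 := by
          rw [← lintegral_const_mul' _ _ ENNReal.ofReal_ne_top, ← lintegral_indicator hBm]
          refine lintegral_congr fun p => ?_
          by_cases h : ‖p‖ < s
          · have hpB : p ∈ B := by simpa [hB] using h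
            rw [indicator_of_mem hpB, if_pos h, ← mul_assoc,
              ← ENNReal.ofReal_mul (by positivity)]
            congr 2
            field_simp
          · have hpB : p ∉ B := by simpa [hB] using h
            rw [indicator_of_notMem hpB, if_neg h, zero_mul, mul_zero]
        rw [e]
        have e2 : ENNReal.ofReal (4 * Real.pi ^ 2) =
            ENNReal.ofReal (4 * Real.pi ^ 2 * s ^ 3) * ENNReal.ofReal (1 / s ^ 3) := by
          rw [← ENNReal.ofReal_mul (by positivity)]
          congr 1
          field_simp
        rw [e2]
        ring

theorem lintegral_Ioi_inv_sq {a : ℝ} (ha : 0 < a) :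
    ∫⁻ s in Ioi a, ENNReal.ofReal (1 / s ^ 2) = ENNReal.ofReal (1 / a) := by
  have e : ∫⁻ s in Ioi a, ENNReal.ofReal (1 / s ^ 2) =
      ∫⁻ s in Ioi a, ENNReal.ofReal (s ^ (-2 : ℝ)) := by
    refine setLIntegral_congr_fun measurableSet_Ioi fun s hs => ?_
    have hs0 : 0 < s := ha.trans hs
    rw [Real.rpow_neg hs0.le, one_div]
    norm_num
  rw [e, ← ofReal_integral_eq_lintegral_ofReal (integrableOn_Ioi_rpow_of_lt (by norm_num) ha)
    ((ae_restrict_iff' measurableSet_Ioi).2 (Eventually.of_forall fun s hs => by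
      have hs0 : 0 < s := ha.trans hs
      positivity)), integral_Ioi_rpow_of_lt (by norm_num) ha]
  congr 1
  norm_num
  rw [Real.rpow_neg_one]

/-- Kato's inequality: the Coulomb energy is bounded by the expectation of `|p|`, up to a
constant. -/
theorem lintegral_coulomb_le (ξ : L2 R3) :
    ∫⁻ x, ENNReal.ofReal (1 / ‖x‖) * ‖ξ x‖ₑ ^ 2 ≤
      (2 * (ENNReal.ofReal (4 * Real.pi ^ 2) * volume (Metric.ball (0 : R3) 1)) + 2) *
        ∫⁻ p, ENNReal.ofReal ‖p‖ * ‖ft ξ p‖ₑ ^ 2 := by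
  set f := ft ξ with hf
  set K := 2 * (ENNReal.ofReal (4 * Real.pi ^ 2) * volume (Metric.ball (0 : R3) 1)) with hK
  have hKt : K ≠ ∞ := by
    have : volume (Metric.ball (0 : R3) 1) ≠ ∞ := measure_ball_lt_top.ne
    rw [hK]
    finiteness
  have hfm : AEMeasurable (fun p => ‖f p‖ₑ ^ 2) volume := ((Lp.memLp f).1.enorm).pow_const 2
  have hxm : AEMeasurable (fun p => ‖ξ p‖ₑ ^ 2) volume := ((Lp.memLp ξ).1.enorm).pow_const 2
  have hlt : MeasurableSet {z : ℝ × R3 | ‖z.2‖ < z.1} :=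
    measurableSet_lt measurable_snd.norm measurable_fst
  have hk1 : Measurable (Function.uncurry fun (s : ℝ) (x : R3) =>
      if ‖x‖ < 1 / s then (1 : ℝ≥0∞) else 0) :=
    Measurable.ite (measurableSet_lt measurable_snd.norm (measurable_const.div measurable_fst))
      measurable_const measurable_const
  have hk2 : Measurable (Function.uncurry fun (s : ℝ) (p : R3) =>
      if ‖p‖ < s then ENNReal.ofReal (1 / s ^ 2 * ‖p‖ ^ 2) else 0) :=
    Measurable.ite hlt (by fun_prop) measurable_const
  have hk3 : Measurable (Function.uncurry fun (s : ℝ) (p : R3) =>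
      if ‖p‖ < s then (0 : ℝ≥0∞) else 1) :=
    Measurable.ite hlt measurable_const measurable_const
  -- Layer cake over the scale s: the indicators of |x| < 1/s integrate to 1/|x|, while the low- and
  -- high-momentum weights |p|²/s² on |p| < s and 1 on |p| ≥ s each integrate to |p|.
  have hI1 : ∀ x : R3, x ≠ 0 → ∫⁻ s in Ioi (0 : ℝ), (if ‖x‖ < 1 / s then (1 : ℝ≥0∞) else 0) =
      ENNReal.ofReal (1 / ‖x‖) := by
    intro x hx
    have hn := norm_pos_iff.2 hx
    have : ∫⁻ s in Ioi (0 : ℝ), (if ‖x‖ < 1 / s then (1 : ℝ≥0∞) else 0) =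
        ∫⁻ s in Ioi (0 : ℝ), (Iio (1 / ‖x‖)).indicator 1 s := by
      refine setLIntegral_congr_fun measurableSet_Ioi fun s hs => ?_
      have hs0 : 0 < s := hs
      simp only [indicator, mem_Iio, Pi.one_apply]
      simp only [lt_div_comm₀ hn hs0]
    rw [this, lintegral_indicator_one measurableSet_Iio, Measure.restrict_apply measurableSet_Iio,
      inter_comm, Ioi_inter_Iio, Real.volume_Ioo, sub_zero]
  have hI2 : ∀ p : R3, p ≠ 0 → ∫⁻ s in Ioi (0 : ℝ),
      (if ‖p‖ < s then ENNReal.ofReal (1 / s ^ 2 * ‖p‖ ^ 2) else 0) = ENNReal.ofReal ‖p‖ := by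
    intro p hp
    have hn := norm_pos_iff.2 hp
    have : ∀ s : ℝ, (if ‖p‖ < s then ENNReal.ofReal (1 / s ^ 2 * ‖p‖ ^ 2) else 0) =
        (Ioi ‖p‖).indicator (fun s => ENNReal.ofReal (1 / s ^ 2) * ENNReal.ofReal (‖p‖ ^ 2)) s := by
      intro s
      simp only [indicator, mem_Ioi]
      rw [ENNReal.ofReal_mul (by positivity)]
    simp_rw [this]
    rw [lintegral_indicator measurableSet_Ioi, Measure.restrict_restrict measurableSet_Ioi,
      Ioi_inter_Ioi, max_eq_left hn.le, lintegral_mul_const' _ _ ENNReal.ofReal_ne_top,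
      lintegral_Ioi_inv_sq hn, ← ENNReal.ofReal_mul (by positivity)]
    congr 1
    field_simp
  have hI3 : ∀ p : R3, ∫⁻ s in Ioi (0 : ℝ), (if ‖p‖ < s then (0 : ℝ≥0∞) else 1) =
      ENNReal.ofReal ‖p‖ := by
    intro p
    have : ∀ s : ℝ, (if ‖p‖ < s then (0 : ℝ≥0∞) else 1) = (Iic ‖p‖).indicator 1 s := by
      intro s
      by_cases h : ‖p‖ < s
      · simp [h]
      · simp [h, not_lt.1 h]
    simp_rw [this]
    rw [lintegral_indicator_one measurableSet_Iic, Measure.restrict_apply measurableSet_Iic,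
      inter_comm, Ioi_inter_Iic, Real.volume_Ioc, sub_zero]
  calc ∫⁻ x, ENNReal.ofReal (1 / ‖x‖) * ‖ξ x‖ₑ ^ 2
      = ∫⁻ s in Ioi (0 : ℝ), ∫⁻ x, (if ‖x‖ < 1 / s then (1 : ℝ≥0∞) else 0) * ‖ξ x‖ₑ ^ 2 := by
        rw [lintegral_kernel_swap hk1 hxm]
        refine lintegral_congr_ae ?_
        filter_upwards [ae_ne_zero_R3] with x hx
        rw [hI1 x hx]
    _ ≤ ∫⁻ s in Ioi (0 : ℝ), (K * (∫⁻ p, (if ‖p‖ < s then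
          ENNReal.ofReal (1 / s ^ 2 * ‖p‖ ^ 2) else 0) * ‖f p‖ₑ ^ 2) +
          2 * ∫⁻ p, (if ‖p‖ < s then 0 else 1) * ‖f p‖ₑ ^ 2) := by
        refine setLIntegral_mono' measurableSet_Ioi fun s hs => ?_
        refine le_trans (le_of_eq ?_) (setLIntegral_ball_le ξ hs)
        rw [← lintegral_indicator measurableSet_ball]
        refine lintegral_congr fun x => ?_
        by_cases h : ‖x‖ < 1 / s
        · rw [if_pos h, indicator_of_mem (by simpa using h), one_mul]
        · rw [if_neg h, indicator_of_notMem (by simpa using h), zero_mul]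
    _ = K * (∫⁻ p, ENNReal.ofReal ‖p‖ * ‖f p‖ₑ ^ 2) +
          2 * ∫⁻ p, ENNReal.ofReal ‖p‖ * ‖f p‖ₑ ^ 2 := by
        have m2 : AEMeasurable (fun s : ℝ => 2 * ∫⁻ p : R3, (if ‖p‖ < s then 0 else 1) *
            ‖f p‖ₑ ^ 2) (volume.restrict (Ioi 0)) :=
          ((hk3.aemeasurable.mul hfm.comp_snd).lintegral_prod_right').const_mul _
        rw [lintegral_add_right' _ m2, lintegral_const_mul' _ _ hKt,
          lintegral_const_mul' _ _ (by norm_num), lintegral_kernel_swap hk2 hfm,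
          lintegral_kernel_swap hk3 hfm]
        congr 2
        · refine lintegral_congr_ae ?_
          filter_upwards [ae_ne_zero_R3] with p hp
          rw [hI2 p hp]
        · simp_rw [hI3]
    _ = _ := by rw [add_mul]

end KatoAndCharge
-- The three parts of Φ^λ and their boundedness on H^{1/2}
section ChargeForms

open Set Filter Topology

/-- The hypotheses on θ hold only almost everywhere on the half line. A measurable null set there
pulls back to a null set under the norm, since its indicator has zero integral in polar coordinates.
-/
theorem ae_comp_norm {P : ℝ → Prop} (h : ∀ᵐ r ∂(volume.restrict (Ioi (0 : ℝ))), P r) :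
    ∀ᵐ y : R3, P ‖y‖ := by
  obtain ⟨N, hN, hNm, hN0⟩ := exists_measurable_superset_of_null (ae_iff.1 h)
  have h0 : ∀ᵐ r ∂(volume.restrict (Ioi (0 : ℝ))), r ∉ N := measure_eq_zero_iff_ae_notMem.1 hN0
  set f : ℝ → ℝ := N.indicator 1 with hf
  have hz : (fun r : ℝ => r ^ (Module.finrank ℝ R3 - 1) • f r)
      =ᵐ[volume.restrict (Ioi (0 : ℝ))] fun _ => 0 := by
    filter_upwards [h0] with r hr
    simp [hf, hr]
  have hi : Integrable fun y : R3 => f ‖y‖ := by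
    rw [integrable_fun_norm_addHaar]
    exact (integrable_zero _ _ _).congr hz.symm
  have h1 : ∫ y : R3, f ‖y‖ = 0 := by
    rw [integral_fun_norm_addHaar, integral_congr_ae hz]
    simp
  have h2 : (fun y : R3 => f ‖y‖) =ᵐ[volume] 0 :=
    (integral_eq_zero_iff_of_nonneg
      (fun y => indicator_nonneg (fun _ _ => zero_le_one) _) hi).1 h1
  filter_upwards [h2] with y hy
  by_contra hP
  have : ‖y‖ ∈ N := hN hP
  simp [hf, this] at hy

theorem aestronglyMeasurable_comp_norm {θ : ℝ → ℝ}
    (h : AEStronglyMeasurable θ (volume.restrict (Ioi (0 : ℝ)))) :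
    AEStronglyMeasurable (fun y : R3 => θ ‖y‖) volume :=
  ⟨fun y => h.mk θ ‖y‖, h.stronglyMeasurable_mk.comp_measurable measurable_norm,
    ae_comp_norm h.ae_eq_mk⟩

/-- The square of the norm of `ξ` in `H^{1/2}`, with value `∞` outside of this space. -/
def halfEnergy (ξ : L2 R3) : ℝ≥0∞ := ∫⁻ p, ENNReal.ofReal (bessel 1 p) * ‖ft ξ p‖ₑ ^ 2

theorem bessel_add {E : Type} [NormedAddCommGroup E] (s t : ℝ) (k : E) :
    bessel s k * bessel t k = bessel (s + t) k := by
  unfold bessel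
  rw [← Real.rpow_add (by positivity), ← add_div]

theorem one_le_bessel_one (p : R3) : 1 ≤ bessel 1 p := by
  unfold bessel
  exact Real.one_le_rpow (by nlinarith [sq_nonneg ‖p‖]) (by norm_num)

theorem norm_le_bessel_one (p : R3) : ‖p‖ ≤ bessel 1 p := by
  unfold bessel
  rw [← Real.sqrt_eq_rpow]
  exact Real.le_sqrt_of_sq_le (by linarith)

theorem bessel_one_sq (p : R3) : bessel 1 p ^ 2 = 1 + ‖p‖ ^ 2 := by
  unfold bessel
  rw [← Real.sqrt_eq_rpow, Real.sq_sqrt (by positivity)]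

theorem enorm_ofReal_mul_sq {r : ℝ} (hr : 0 ≤ r) (z : ℂ) :
    ‖(r : ℂ) * z‖ₑ ^ 2 = ENNReal.ofReal (r ^ 2) * ‖z‖ₑ ^ 2 := by
  rw [enorm_mul, mul_pow, ← ofReal_norm, Complex.norm_real, Real.norm_of_nonneg hr,
    ENNReal.ofReal_pow hr]

theorem memLp_two_iff_lintegral {X : Type} [MeasurableSpace X] {μ : Measure X} {f : X → ℂ}
    (hf : AEStronglyMeasurable f μ) : MemLp f 2 μ ↔ ∫⁻ x, ‖f x‖ₑ ^ 2 ∂μ < ∞ := by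
  have h := eLpNorm_lt_top_iff_lintegral_rpow_enorm_lt_top (μ := μ) (f := f) (p := 2) (by norm_num)
    (by norm_num)
  simp only [ENNReal.toReal_ofNat, ENNReal.rpow_ofNat] at h
  rw [← h]
  exact ⟨fun h => h.2, fun h => ⟨hf, h⟩⟩

theorem inSobolev_half_iff (ξ : L2 R3) : InSobolev (1 / 2) ξ ↔ halfEnergy ξ < ∞ := by
  rw [inSobolev_iff (by norm_num), memLp_two_iff_lintegral, halfEnergy]
  · simp_rw [enorm_ofReal_mul_sq (bessel_pos _ _).le, sq (bessel _ _), bessel_add]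
    norm_num
  · exact ((Complex.continuous_ofReal.comp (continuous_bessel _)).aestronglyMeasurable).mul
      (Lp.memLp (ft ξ)).1

theorem ofReal_norm_sq_le_halfEnergy (ξ : L2 R3) : ENNReal.ofReal (‖ξ‖ ^ 2) ≤ halfEnergy ξ := by
  rw [← (ft : L2 R3 ≃ₗᵢ[ℂ] L2 R3).norm_map ξ, ← lintegral_enorm_sq, halfEnergy]
  refine lintegral_mono fun p => ?_
  nth_rw 1 [← one_mul (‖ft ξ p‖ₑ ^ 2)]
  gcongr
  rw [← ENNReal.ofReal_one]
  exact ENNReal.ofReal_le_ofReal (one_le_bessel_one p)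

theorem lintegral_norm_mul_le_halfEnergy (ξ : L2 R3) :
    ∫⁻ p, ENNReal.ofReal ‖p‖ * ‖ft ξ p‖ₑ ^ 2 ≤ halfEnergy ξ :=
  lintegral_mono fun p => mul_le_mul_left (ENNReal.ofReal_le_ofReal (norm_le_bessel_one p)) _

theorem lintegral_enorm_conj_mul_le {X : Type} [MeasurableSpace X] {μ : Measure X}
    {m a b : X → ℂ} {W : X → ℝ≥0∞} (hm : ∀ᵐ x ∂μ, ‖m x‖ₑ ≤ W x) (hW : AEMeasurable W μ)
    (ha : AEStronglyMeasurable a μ) :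
    ∫⁻ x, ‖conj (a x) * (m x * b x)‖ₑ ∂μ ≤
      (∫⁻ x, W x * ‖a x‖ₑ ^ 2 ∂μ) + ∫⁻ x, W x * ‖b x‖ₑ ^ 2 ∂μ := by
  have hWa : AEMeasurable (fun x => W x * ‖a x‖ₑ ^ 2) μ := hW.mul (ha.enorm.pow_const 2)
  rw [← lintegral_add_left' hWa]
  refine lintegral_mono_ae ?_
  filter_upwards [hm] with x hx
  rw [enorm_mul, enorm_mul, RCLike.enorm_conj, ← mul_add]
  have h4 := two_mul_mul_le_weighted ‖a x‖ₑ ‖b x‖ₑ 1 one_ne_zero ENNReal.one_ne_top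
  rw [inv_one, mul_one, mul_one] at h4
  calc ‖a x‖ₑ * (‖m x‖ₑ * ‖b x‖ₑ) = ‖m x‖ₑ * (‖a x‖ₑ * ‖b x‖ₑ) := by ring
    _ ≤ W x * (‖a x‖ₑ ^ 2 + ‖b x‖ₑ ^ 2) := by
      refine mul_le_mul' hx (le_trans ?_ h4)
      rw [two_mul]
      exact le_self_add

variable {β γ : ℝ} {θ : ℝ → ℝ} {lam : ℝ}

/-- The diagonal part of the form of the charges in momentum space. -/
def kineticForm (lam : ℝ) (η ξ : L2 R3) : ℂ :=
  ∫ p : R3, conj (ft η p) * ((Real.sqrt (3 / 4 * ‖p‖ ^ 2 + lam) : ℂ) * ft ξ p)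

/-- The off-diagonal part of the form of the charges in momentum space. -/
def exchangeForm (lam : ℝ) (η ξ : L2 R3) : ℂ :=
  ∫ w : R3 × R3, conj (ft η w.1) * (((1 / (pairForm w.1 w.2 + lam) : ℝ) : ℂ) * ft ξ w.2)

/-- The three-body term of the form of the charges. -/
def coulombForm (β γ : ℝ) (θ : ℝ → ℝ) (η ξ : L2 R3) : ℂ :=
  ∫ y : R3, conj (η y) * (((β + γ / ‖y‖ * θ ‖y‖ : ℝ) : ℂ) * ξ y)

theorem sqrt_le_bessel_one (hlam : 0 < lam) (p : R3) :
    Real.sqrt (3 / 4 * ‖p‖ ^ 2 + lam) ≤ (1 + lam) * bessel 1 p := by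
  rw [Real.sqrt_le_left (by have := bessel_pos 1 p; positivity), mul_pow, bessel_one_sq]
  nlinarith [sq_nonneg ‖p‖, mul_nonneg hlam.le (sq_nonneg ‖p‖),
    mul_nonneg (sq_nonneg lam) (sq_nonneg ‖p‖)]

theorem lintegral_kineticForm_le (hlam : 0 < lam) (η ξ : L2 R3) :
    ∫⁻ p : R3, ‖conj (ft η p) * ((Real.sqrt (3 / 4 * ‖p‖ ^ 2 + lam) : ℂ) * ft ξ p)‖ₑ ≤
      ENNReal.ofReal (1 + lam) * (halfEnergy η + halfEnergy ξ) := by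
  have hb : Measurable fun p : R3 => bessel 1 p := (continuous_bessel 1).measurable
  refine (lintegral_enorm_conj_mul_le
    (W := fun p => ENNReal.ofReal (1 + lam) * ENNReal.ofReal (bessel 1 p))
    (Eventually.of_forall fun p => ?_) (by fun_prop) (Lp.memLp (ft η)).1).trans (le_of_eq ?_)
  · rw [← ofReal_norm, Complex.norm_real, Real.norm_of_nonneg (Real.sqrt_nonneg _),
      ← ENNReal.ofReal_mul (by positivity)]
    exact ENNReal.ofReal_le_ofReal (sqrt_le_bessel_one hlam p)
  · simp_rw [mul_assoc]
    rw [lintegral_const_mul' _ _ ENNReal.ofReal_ne_top,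
      lintegral_const_mul' _ _ ENNReal.ofReal_ne_top, ← mul_add, halfEnergy, halfEnergy]

theorem lintegral_exchangeForm_eq (hlam : 0 < lam) (η ξ : L2 R3) :
    ∫⁻ w : R3 × R3,
      ‖conj (ft η w.1) * (((1 / (pairForm w.1 w.2 + lam) : ℝ) : ℂ) * ft ξ w.2)‖ₑ =
      ∫⁻ p, ∫⁻ q, ENNReal.ofReal (1 / (pairForm p q + lam)) * (‖ft η p‖ₑ * ‖ft ξ q‖ₑ) := by
  have e : ∀ w : R3 × R3,
      ‖conj (ft η w.1) * (((1 / (pairForm w.1 w.2 + lam) : ℝ) : ℂ) * ft ξ w.2)‖ₑ =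
      ENNReal.ofReal (1 / (pairForm w.1 w.2 + lam)) * (‖ft η w.1‖ₑ * ‖ft ξ w.2‖ₑ) := by
    intro w
    have := pairForm_nonneg w.1 w.2
    rw [enorm_mul, enorm_mul, RCLike.enorm_conj, ← ofReal_norm ((_ : ℝ) : ℂ), Complex.norm_real,
      Real.norm_of_nonneg (by positivity), mul_left_comm]
  simp_rw [e]
  rw [Measure.volume_eq_prod, lintegral_prod]
  have h1 := (Lp.memLp (ft η)).1.enorm
  have h2 := (Lp.memLp (ft ξ)).1.enorm
  have hk := measurable_ofReal_kernel (g := fun x => 1 / (x + lam)) (by fun_prop)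
  exact hk.aemeasurable.mul ((h1.comp_fst (ν := volume)).mul (h2.comp_snd (μ := volume)))

/-- The bound is kept in terms of |p| rather than the H^{1/2} weight: its constant is compared with
√3/2 in the coercivity estimate. -/
theorem lintegral_exchangeForm_le (hlam : 0 < lam) (η ξ : L2 R3) :
    2 * ∫⁻ w : R3 × R3,
      ‖conj (ft η w.1) * (((1 / (pairForm w.1 w.2 + lam) : ℝ) : ℂ) * ft ξ w.2)‖ₑ ≤
      ENNReal.ofReal (2 * Real.pi ^ 3 / 3) * ((∫⁻ p, ENNReal.ofReal ‖p‖ * ‖ft η p‖ₑ ^ 2) +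
        ∫⁻ p, ENNReal.ofReal ‖p‖ * ‖ft ξ p‖ₑ ^ 2) := by
  rw [lintegral_exchangeForm_eq hlam]
  refine (schur_momentum hlam.le (Lp.memLp (ft η)).1.enorm (Lp.memLp (ft ξ)).1.enorm).trans
    (le_of_eq ?_)
  rw [mul_add, ← lintegral_const_mul' _ _ ENNReal.ofReal_ne_top,
    ← lintegral_const_mul' _ _ ENNReal.ofReal_ne_top]
  simp_rw [← mul_assoc, ← ENNReal.ofReal_mul (by positivity : 0 ≤ 2 * Real.pi ^ 3 / 3)]

theorem aestronglyMeasurable_coulombWeight (hθ : CutoffHypothesis θ) :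
    AEStronglyMeasurable (fun y : R3 => (((β + γ / ‖y‖ * θ ‖y‖ : ℝ) : ℂ))) volume := by
  have h1 := aestronglyMeasurable_comp_norm hθ.1.1
  have h2 : Measurable fun y : R3 => γ / ‖y‖ := by fun_prop
  exact Complex.continuous_ofReal.comp_aestronglyMeasurable
    ((h2.aestronglyMeasurable.mul h1).const_add _)

theorem exists_enorm_coulombWeight_le (β γ : ℝ) (hθ : CutoffHypothesis θ) :
    ∃ M : ℝ, 0 ≤ M ∧ ∀ᵐ y : R3, ‖(((β + γ / ‖y‖ * θ ‖y‖ : ℝ) : ℂ))‖ₑ ≤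
      ENNReal.ofReal |β| + ENNReal.ofReal M * ENNReal.ofReal (1 / ‖y‖) := by
  obtain ⟨C, hC⟩ : ∃ C : ℝ, ∀ᵐ r ∂(volume.restrict (Ioi (0 : ℝ))), |θ r| ≤ C := by
    have h1 := hθ.1.2
    rw [eLpNorm_exponent_top] at h1
    refine ⟨(eLpNormEssSup θ (volume.restrict (Ioi 0))).toReal, ?_⟩
    filter_upwards [ae_le_eLpNormEssSup (f := θ) (μ := volume.restrict (Ioi 0))] with r hr
    have h2 := ENNReal.toReal_mono h1.ne hr
    rwa [toReal_enorm] at h2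
  refine ⟨|γ| * |C|, by positivity, ?_⟩
  filter_upwards [ae_comp_norm hC] with y hy
  rw [← ENNReal.ofReal_mul (by positivity), ← ENNReal.ofReal_add (by positivity) (by positivity),
    ← ofReal_norm, Complex.norm_real, Real.norm_eq_abs]
  refine ENNReal.ofReal_le_ofReal ((abs_add_le _ _).trans ?_)
  rw [abs_mul, abs_div, abs_norm]
  have : |θ ‖y‖| ≤ |C| := hy.trans (le_abs_self C)
  calc |β| + |γ| / ‖y‖ * |θ ‖y‖| ≤ |β| + |γ| / ‖y‖ * |C| := by gcongr
    _ = _ := by ring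

/-- Boundedness of the three-body term on `H^{1/2}`. -/
theorem exists_lintegral_coulombForm_le (β γ : ℝ) (hθ : CutoffHypothesis θ) :
    ∃ K : ℝ, ∀ η ξ : L2 R3,
      ∫⁻ y : R3, ‖conj (η y) * (((β + γ / ‖y‖ * θ ‖y‖ : ℝ) : ℂ) * ξ y)‖ₑ ≤
        ENNReal.ofReal K * (halfEnergy η + halfEnergy ξ) := by
  obtain ⟨M, hM0, hM⟩ := exists_enorm_coulombWeight_le β γ hθ
  set L := 2 * (ENNReal.ofReal (4 * Real.pi ^ 2) * volume (Metric.ball (0 : R3) 1)) + 2 with hL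
  have hLt : L ≠ ∞ := by
    have : volume (Metric.ball (0 : R3) 1) ≠ ∞ := measure_ball_lt_top.ne
    rw [hL]
    finiteness
  refine ⟨|β| + M * L.toReal, fun η ξ => ?_⟩
  have hone : ∀ u : L2 R3, ∫⁻ y, (ENNReal.ofReal |β| + ENNReal.ofReal M *
      ENNReal.ofReal (1 / ‖y‖)) * ‖u y‖ₑ ^ 2 ≤
        ENNReal.ofReal (|β| + M * L.toReal) * halfEnergy u := by
    intro u
    have hm : AEMeasurable (fun y => ‖u y‖ₑ ^ 2) volume := (Lp.memLp u).1.enorm.pow_const 2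
    simp_rw [add_mul, mul_assoc]
    rw [lintegral_add_left' (hm.const_mul _), lintegral_const_mul' _ _ ENNReal.ofReal_ne_top,
      lintegral_const_mul' _ _ ENNReal.ofReal_ne_top, lintegral_enorm_sq,
      ENNReal.ofReal_add (by positivity) (by positivity), ENNReal.ofReal_mul hM0,
      ENNReal.ofReal_toReal hLt, add_mul, mul_assoc]
    gcongr
    · exact ofReal_norm_sq_le_halfEnergy u
    · exact (lintegral_coulomb_le u).trans
        (mul_le_mul_right (lintegral_norm_mul_le_halfEnergy u) _)
  refine (lintegral_enorm_conj_mul_le hM (by fun_prop) (Lp.memLp η).1).trans ?_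
  rw [mul_add]
  exact add_le_add (hone η) (hone ξ)

theorem integrable_kineticForm (hlam : 0 < lam) {η ξ : L2 R3} (hη : InSobolev (1 / 2) η)
    (hξ : InSobolev (1 / 2) ξ) :
    Integrable fun p : R3 =>
      conj (ft η p) * ((Real.sqrt (3 / 4 * ‖p‖ ^ 2 + lam) : ℂ) * ft ξ p) := by
  rw [inSobolev_half_iff] at hη hξ
  have hc : Continuous fun p : R3 => (Real.sqrt (3 / 4 * ‖p‖ ^ 2 + lam) : ℂ) := by fun_prop
  refine ⟨(Complex.continuous_conj.comp_aestronglyMeasurable (Lp.memLp (ft η)).1).mul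
    (hc.aestronglyMeasurable.mul (Lp.memLp (ft ξ)).1),
    (lintegral_kineticForm_le hlam η ξ).trans_lt (by finiteness)⟩

theorem integrable_exchangeForm (hlam : 0 < lam) {η ξ : L2 R3} (hη : InSobolev (1 / 2) η)
    (hξ : InSobolev (1 / 2) ξ) :
    Integrable (fun w : R3 × R3 =>
      conj (ft η w.1) * (((1 / (pairForm w.1 w.2 + lam) : ℝ) : ℂ) * ft ξ w.2)) volume := by
  rw [inSobolev_half_iff] at hη hξ
  have h1 : AEStronglyMeasurable (fun w : R3 × R3 => ft η w.1) volume :=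
    (Lp.memLp (ft η)).1.comp_fst (ν := (volume : Measure R3))
  have h2 : AEStronglyMeasurable (fun w : R3 × R3 => ft ξ w.2) volume :=
    (Lp.memLp (ft ξ)).1.comp_snd (μ := (volume : Measure R3))
  have hc : Measurable fun w : R3 × R3 => (((1 / (pairForm w.1 w.2 + lam) : ℝ) : ℂ)) := by
    have := continuous_pairForm.measurable
    fun_prop
  refine ⟨(Complex.continuous_conj.comp_aestronglyMeasurable h1).mul
    (hc.aestronglyMeasurable.mul h2), ?_⟩
  have h3 := lintegral_exchangeForm_le hlam η ξ
  have h4 : ∫⁻ w : R3 × R3,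
      ‖conj (ft η w.1) * (((1 / (pairForm w.1 w.2 + lam) : ℝ) : ℂ) * ft ξ w.2)‖ₑ ≤
      ENNReal.ofReal (2 * Real.pi ^ 3 / 3) * (halfEnergy η + halfEnergy ξ) := by
    refine le_trans ?_ (h3.trans (mul_le_mul_right (add_le_add
      (lintegral_norm_mul_le_halfEnergy η) (lintegral_norm_mul_le_halfEnergy ξ)) _))
    rw [two_mul]
    exact le_self_add
  exact h4.trans_lt (by finiteness)

theorem integrable_coulombForm (hθ : CutoffHypothesis θ) {η ξ : L2 R3}
    (hη : InSobolev (1 / 2) η) (hξ : InSobolev (1 / 2) ξ) :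
    Integrable fun y : R3 => conj (η y) * (((β + γ / ‖y‖ * θ ‖y‖ : ℝ) : ℂ) * ξ y) := by
  rw [inSobolev_half_iff] at hη hξ
  obtain ⟨K, hK⟩ := exists_lintegral_coulombForm_le β γ hθ
  exact ⟨(Complex.continuous_conj.comp_aestronglyMeasurable (Lp.memLp η).1).mul
    ((aestronglyMeasurable_coulombWeight hθ).mul (Lp.memLp ξ).1),
    (hK η ξ).trans_lt (by finiteness)⟩

/-- The iterated integral in the definition becomes a double integral by Fubini, absolute
convergence being Schur's test; algebra and estimates are then done on each part separately. -/
theorem PhiForm_eq (hlam : 0 < lam) {η ξ : L2 R3} (hη : InSobolev (1 / 2) η)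
    (hξ : InSobolev (1 / 2) ξ) :
    PhiForm β γ θ lam η ξ = kineticForm lam η ξ - 1 / (Real.pi : ℂ) ^ 2 * exchangeForm lam η ξ +
      coulombForm β γ θ η ξ := by
  have h1 := integrable_kineticForm hlam hη hξ
  have h2 := integrable_exchangeForm hlam hη hξ
  have h3 := h2.integral_prod_left
  have e : ∀ p : R3, conj (ft η p) * ((Real.sqrt (3 / 4 * ‖p‖ ^ 2 + lam) : ℂ) * ft ξ p
      - 1 / (Real.pi : ℂ) ^ 2 *
        ∫ q : R3, ft ξ q / ((‖p‖ ^ 2 + ‖q‖ ^ 2 + inner ℝ p q + lam : ℝ) : ℂ)) =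
      conj (ft η p) * ((Real.sqrt (3 / 4 * ‖p‖ ^ 2 + lam) : ℂ) * ft ξ p) -
      1 / (Real.pi : ℂ) ^ 2 *
        ∫ q : R3, conj (ft η p) * (((1 / (pairForm p q + lam) : ℝ) : ℂ) * ft ξ q) := by
    intro p
    have : ∀ q : R3, conj (ft η p) * (((1 / (pairForm p q + lam) : ℝ) : ℂ) * ft ξ q) =
        conj (ft η p) * (ft ξ q / ((‖p‖ ^ 2 + ‖q‖ ^ 2 + inner ℝ p q + lam : ℝ) : ℂ)) := by
      intro q
      rw [pairForm]
      push_cast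
      ring
    simp_rw [this]
    rw [integral_const_mul]
    ring
  rw [PhiForm, kineticForm, exchangeForm, coulombForm]
  congr 1
  simp_rw [e]
  rw [integral_sub h1 (h3.const_mul _), integral_const_mul, Measure.volume_eq_prod,
    integral_prod _ h2]

end ChargeForms
-- Sesquilinearity, Hermitian symmetry and coercivity of Φ^λ
section ChargeOperator

open Set Filter Topology

variable {β γ : ℝ} {θ : ℝ → ℝ} {lam : ℝ}

section Sobolev

variable {E : Type} [NormedAddCommGroup E] [InnerProductSpace ℝ E] [FiniteDimensional ℝ E]
  [MeasurableSpace E] [BorelSpace E] {s : ℝ}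

theorem InSobolev.add (hs : 0 ≤ s) {u v : L2 E} (hu : InSobolev s u) (hv : InSobolev s v) :
    InSobolev s (u + v) := by
  rw [inSobolev_iff hs] at *
  refine (memLp_congr_ae ?_).1 (hu.add hv)
  filter_upwards [ft_add_ae u v] with k hk
  rw [hk, Pi.add_apply, mul_add]

theorem InSobolev.smul (hs : 0 ≤ s) {u : L2 E} (a : ℂ) (hu : InSobolev s u) :
    InSobolev s (a • u) := by
  rw [inSobolev_iff hs] at *
  refine (memLp_congr_ae ?_).1 (hu.const_mul a)
  filter_upwards [ft_smul_ae a u] with k hk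
  rw [hk, mul_left_comm]

theorem InSobolev.sub (hs : 0 ≤ s) {u v : L2 E} (hu : InSobolev s u) (hv : InSobolev s v) :
    InSobolev s (u - v) := by
  have h := hu.add hs (hv.smul hs (-1))
  rwa [neg_one_smul, ← sub_eq_add_neg] at h

end Sobolev

theorem ae_snd {P : R3 → Prop} (h : ∀ᵐ p, P p) : ∀ᵐ w : R3 × R3, P w.2 :=
  Measure.quasiMeasurePreserving_snd.ae h

theorem PhiForm_add_right (hθ : CutoffHypothesis θ) (hlam : 0 < lam) {η ξ ζ : L2 R3}
    (hη : InSobolev (1 / 2) η) (hξ : InSobolev (1 / 2) ξ) (hζ : InSobolev (1 / 2) ζ) :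
    PhiForm β γ θ lam η (ξ + ζ) = PhiForm β γ θ lam η ξ + PhiForm β γ θ lam η ζ := by
  rw [PhiForm_eq hlam hη hξ, PhiForm_eq hlam hη hζ,
    PhiForm_eq hlam hη (hξ.add (by norm_num) hζ)]
  have h1 : kineticForm lam η (ξ + ζ) = kineticForm lam η ξ + kineticForm lam η ζ := by
    rw [kineticForm, kineticForm, kineticForm,
      ← integral_add (integrable_kineticForm hlam hη hξ) (integrable_kineticForm hlam hη hζ)]
    refine integral_congr_ae ?_
    filter_upwards [ft_add_ae ξ ζ] with p hp
    rw [hp]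
    ring
  have h2 : exchangeForm lam η (ξ + ζ) = exchangeForm lam η ξ + exchangeForm lam η ζ := by
    rw [exchangeForm, exchangeForm, exchangeForm,
      ← integral_add (integrable_exchangeForm hlam hη hξ) (integrable_exchangeForm hlam hη hζ)]
    refine integral_congr_ae ?_
    filter_upwards [ae_snd (ft_add_ae ξ ζ)] with w hw
    rw [hw]
    ring
  have h3 : coulombForm β γ θ η (ξ + ζ) = coulombForm β γ θ η ξ + coulombForm β γ θ η ζ := by
    rw [coulombForm, coulombForm, coulombForm,
      ← integral_add (integrable_coulombForm hθ hη hξ) (integrable_coulombForm hθ hη hζ)]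
    refine integral_congr_ae ?_
    filter_upwards [Lp.coeFn_add ξ ζ] with p hp
    rw [hp, Pi.add_apply]
    ring
  rw [h1, h2, h3]
  ring

theorem PhiForm_smul_right (hlam : 0 < lam) {η ξ : L2 R3} (a : ℂ)
    (hη : InSobolev (1 / 2) η) (hξ : InSobolev (1 / 2) ξ) :
    PhiForm β γ θ lam η (a • ξ) = a * PhiForm β γ θ lam η ξ := by
  rw [PhiForm_eq hlam hη hξ, PhiForm_eq hlam hη (hξ.smul (by norm_num) a)]
  have h1 : kineticForm lam η (a • ξ) = a * kineticForm lam η ξ := by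
    rw [kineticForm, kineticForm, ← integral_const_mul]
    refine integral_congr_ae ?_
    filter_upwards [ft_smul_ae a ξ] with p hp
    rw [hp]
    ring
  have h2 : exchangeForm lam η (a • ξ) = a * exchangeForm lam η ξ := by
    rw [exchangeForm, exchangeForm, ← integral_const_mul]
    refine integral_congr_ae ?_
    filter_upwards [ae_snd (ft_smul_ae a ξ)] with w hw
    rw [hw]
    ring
  have h3 : coulombForm β γ θ η (a • ξ) = a * coulombForm β γ θ η ξ := by
    rw [coulombForm, coulombForm, ← integral_const_mul]
    refine integral_congr_ae ?_
    filter_upwards [Lp.coeFn_smul a ξ] with p hp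
    rw [hp, Pi.smul_apply, smul_eq_mul]
    ring
  rw [h1, h2, h3]
  ring

theorem PhiForm_conj (hlam : 0 < lam) {η ξ : L2 R3}
    (hη : InSobolev (1 / 2) η) (hξ : InSobolev (1 / 2) ξ) :
    PhiForm β γ θ lam η ξ = conj (PhiForm β γ θ lam ξ η) := by
  rw [PhiForm_eq hlam hη hξ, PhiForm_eq hlam hξ hη, map_add, map_sub, map_mul]
  have h1 : kineticForm lam η ξ = conj (kineticForm lam ξ η) := by
    rw [kineticForm, kineticForm, ← integral_conj]
    congr 1
    ext p
    simp only [map_mul, Complex.conj_conj, Complex.conj_ofReal]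
    ring
  have h2 : exchangeForm lam η ξ = conj (exchangeForm lam ξ η) := by
    rw [exchangeForm, exchangeForm, ← integral_conj, Measure.volume_eq_prod,
      ← integral_prod_swap]
    congr 1
    ext w
    simp only [map_mul, Complex.conj_conj, Complex.conj_ofReal, Prod.fst_swap, Prod.snd_swap]
    rw [pairForm_comm]
    ring
  have h3 : coulombForm β γ θ η ξ = conj (coulombForm β γ θ ξ η) := by
    rw [coulombForm, coulombForm, ← integral_conj]
    congr 1
    ext p
    simp only [map_mul, Complex.conj_conj, Complex.conj_ofReal]
    ring
  rw [h1, h2, h3]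
  simp

/-! ### Coercivity -/

theorem integral_weight {X : Type} [MeasurableSpace X] {μ : Measure X} {W : X → ℝ}
    (hW : AEStronglyMeasurable W μ) (h0 : ∀ x, 0 ≤ W x) {f : X → ℂ}
    (hf : AEStronglyMeasurable f μ) (hfin : ∫⁻ x, ENNReal.ofReal (W x) * ‖f x‖ₑ ^ 2 ∂μ < ∞) :
    Integrable (fun x => W x * ‖f x‖ ^ 2) μ ∧
      ∫⁻ x, ENNReal.ofReal (W x) * ‖f x‖ₑ ^ 2 ∂μ = ENNReal.ofReal (∫ x, W x * ‖f x‖ ^ 2 ∂μ) := by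
  have e : ∀ x, ENNReal.ofReal (W x) * ‖f x‖ₑ ^ 2 = ENNReal.ofReal (W x * ‖f x‖ ^ 2) := by
    intro x
    rw [ENNReal.ofReal_mul (h0 x), ENNReal.ofReal_pow (norm_nonneg _), ofReal_norm]
  have hp : ∀ x, 0 ≤ W x * ‖f x‖ ^ 2 := fun x => mul_nonneg (h0 x) (by positivity)
  simp_rw [e] at hfin ⊢
  have hi : Integrable (fun x => W x * ‖f x‖ ^ 2) μ := by
    refine ⟨hW.mul (hf.norm.pow 2), ?_⟩
    rw [hasFiniteIntegral_iff_ofReal (Eventually.of_forall hp)]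
    exact hfin
  exact ⟨hi, (ofReal_integral_eq_lintegral_ofReal hi (Eventually.of_forall hp)).symm⟩

theorem conj_mul_ofReal_mul (r : ℝ) (z : ℂ) :
    conj z * ((r : ℂ) * z) = ((r * ‖z‖ ^ 2 : ℝ) : ℂ) := by
  rw [mul_left_comm, Complex.conj_mul']
  push_cast
  ring

/-- The shape in which the threshold arises: 4/3 is the Coulomb constant of the exchange term, and
√3/π is (4/3) times the fraction of it that the kinetic energy can pay for. -/
theorem gammaC_eq : gammaC = 4 / 3 - √3 / Real.pi := by
  have h3 : √3 ≠ 0 := by positivity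
  unfold gammaC
  field_simp

theorem gammaC_pos : 0 < gammaC := by
  rw [gammaC_eq, sub_pos, div_lt_iff₀ Real.pi_pos]
  have h : √3 < 2 := by
    rw [Real.sqrt_lt' (by norm_num)]
    norm_num
  linarith [Real.pi_gt_three]

/-- The mass term dominates lower order terms. -/
theorem exists_sqrt_ge {κ M : ℝ} (hκ0 : 0 ≤ κ) (hκ : κ < √3 / 2) (hM : 0 ≤ M) :
    ∃ δ > 0, ∃ lam0 > 0, ∀ lam : ℝ, lam0 < lam → ∀ p : R3,
      κ * ‖p‖ + δ * bessel 1 p + M ≤ √(3 / 4 * ‖p‖ ^ 2 + lam) := by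
  -- Half of the gap, so that κ + δ is the midpoint of κ and √3/2 and some H^{1/2} energy is left
  -- over.
  set δ := (√3 / 2 - κ) / 2 with hδ
  have hδ0 : 0 < δ := by rw [hδ]; linarith
  set a := κ + δ with ha
  set N := M + δ with hN
  have ha0 : 0 < a := by positivity
  have haa : a < √3 / 2 := by rw [ha, hδ]; linarith
  have h3 : √3 ^ 2 = 3 := Real.sq_sqrt (by norm_num)
  have hd : 0 < 3 / 4 - a ^ 2 := by nlinarith
  refine ⟨δ, hδ0, N ^ 2 + (a * N) ^ 2 / (3 / 4 - a ^ 2) + 1, by positivity, fun lam hlam p => ?_⟩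
  have hb : bessel 1 p ≤ 1 + ‖p‖ := by
    refine (pow_le_pow_iff_left₀ (bessel_pos 1 p).le (by positivity) two_ne_zero).1 ?_
    rw [bessel_one_sq]
    nlinarith [norm_nonneg p]
  refine le_trans (b := a * ‖p‖ + N) (by rw [ha, hN]; nlinarith) ?_
  refine Real.le_sqrt_of_sq_le ?_
  have h4 : 2 * (a * N * ‖p‖) ≤
      (3 / 4 - a ^ 2) * ‖p‖ ^ 2 + (a * N) ^ 2 / (3 / 4 - a ^ 2) := by
    have h5 : (a * N) ^ 2 / (3 / 4 - a ^ 2) * (3 / 4 - a ^ 2) = (a * N) ^ 2 :=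
      div_mul_cancel₀ _ hd.ne'
    have h6 := sq_nonneg ((3 / 4 - a ^ 2) * ‖p‖ - a * N)
    have h7 : (3 / 4 - a ^ 2) * (2 * (a * N * ‖p‖)) ≤ (3 / 4 - a ^ 2) *
        ((3 / 4 - a ^ 2) * ‖p‖ ^ 2 + (a * N) ^ 2 / (3 / 4 - a ^ 2)) := by
      nlinarith
    exact le_of_mul_le_mul_left h7 hd
  nlinarith

/-- Lower bound of the three-body term. -/
theorem exists_coulombForm_ge (hθ : CutoffHypothesis θ) (hγ : 0 < γ) :
    ∃ M : ℝ, 0 ≤ M ∧ ∀ ξ : L2 R3, InSobolev (1 / 2) ξ →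
      Integrable (fun y => 1 / ‖y‖ * ‖ξ y‖ ^ 2) →
      γ * (∫ y, 1 / ‖y‖ * ‖ξ y‖ ^ 2) - M * ‖ξ‖ ^ 2 ≤ (coulombForm β γ θ ξ ξ).re := by
  obtain ⟨c, hc0, hc⟩ := hθ.2
  -- From θ(r) ≥ 1 - cr, the weight γθ(r)/r loses at most the constant γc.
  refine ⟨|β| + γ * c, by positivity, fun ξ hξ hi => ?_⟩
  have h1 := integrable_coulombForm (β := β) (γ := γ) hθ hξ hξ
  have h2 : Integrable fun y => ‖ξ y‖ ^ 2 :=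
    (memLp_two_iff_integrable_sq_norm (Lp.memLp ξ).1).1 (Lp.memLp ξ)
  rw [coulombForm]
  simp_rw [conj_mul_ofReal_mul] at h1 ⊢
  rw [integral_complex_ofReal, Complex.ofReal_re, norm_sq_eq_integral, ← integral_const_mul,
    ← integral_const_mul, ← integral_sub (hi.const_mul _) (h2.const_mul _)]
  refine integral_mono_ae ((hi.const_mul _).sub (h2.const_mul _)) ?_ ?_
  · simpa only [RCLike.re_to_complex, Complex.ofReal_re] using h1.re
  · filter_upwards [ae_comp_norm hc, ae_ne_zero_R3] with y hy hy0
    have hn := norm_pos_iff.2 hy0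
    have h3 : 1 / ‖y‖ - c ≤ 1 / ‖y‖ * θ ‖y‖ := by
      have h4 : 1 - c * ‖y‖ ≤ θ ‖y‖ := by linarith [(abs_le.1 hy).1]
      calc 1 / ‖y‖ - c = 1 / ‖y‖ * (1 - c * ‖y‖) := by field_simp
        _ ≤ _ := by gcongr
    have h5 : γ * (1 / ‖y‖) - (|β| + γ * c) ≤ β + γ / ‖y‖ * θ ‖y‖ := by
      have h6 := neg_abs_le β
      have h7 : γ / ‖y‖ * θ ‖y‖ = γ * (1 / ‖y‖ * θ ‖y‖) := by ring
      rw [h7]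
      nlinarith
    calc γ * (1 / ‖y‖ * ‖ξ y‖ ^ 2) - (|β| + γ * c) * ‖ξ y‖ ^ 2
        = (γ * (1 / ‖y‖) - (|β| + γ * c)) * ‖ξ y‖ ^ 2 := by ring
      _ ≤ _ := mul_le_mul_of_nonneg_right h5 (by positivity)

/-- A convex combination of the momentum and the position bounds on the exchange term is absorbed by
the kinetic energy and by the repulsion; γ > γ_c is exactly what leaves a positive fraction of |p|
over. -/
theorem PhiForm_coercive (β : ℝ) (hθ : CutoffHypothesis θ) (hγ : gammaC < γ) :
    ∃ δ > 0, ∃ lam0 > 0, ∀ lam : ℝ, lam0 < lam → ∀ ξ : L2 R3, InSobolev (1 / 2) ξ →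
      δ * (halfEnergy ξ).toReal ≤ (PhiForm β γ θ lam ξ ξ).re := by
  have hγ0 : 0 < γ := gammaC_pos.trans hγ
  obtain ⟨M, hM0, hM⟩ := exists_coulombForm_ge (β := β) hθ hγ0
  -- The share t of the exchange term is paid for by γ/|y|, which requires 4t/3 ≤ γ; a share above
  -- one is not needed.
  set t := min (3 * γ / 4) 1 with ht
  have ht0 : 0 ≤ t := le_min (by positivity) zero_le_one
  have ht1 : t ≤ 1 := min_le_right _ _
  have htγ : t * (4 / 3) ≤ γ := by
    have := min_le_left (3 * γ / 4) 1
    rw [← ht] at this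
    linarith
  set κ := (1 - t) * (2 * Real.pi / 3) with hκ
  have hκ0 : 0 ≤ κ := mul_nonneg (by linarith) (by positivity)
  -- The only use of the threshold: for 3γ/4 ≤ 1 this inequality is equivalent to γ > 4/3 - √3/π.
  -- For larger γ the repulsion pays for everything and κ = 0.
  have hκ1 : κ < √3 / 2 := by
    rcases le_total (3 * γ / 4) 1 with h | h
    · rw [hκ, ht, min_eq_left h]
      rw [gammaC_eq] at hγ
      have h1 : (1 - 3 * γ / 4) < 3 / 4 * (√3 / Real.pi) := by linarith
      calc (1 - 3 * γ / 4) * (2 * Real.pi / 3) <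
          3 / 4 * (√3 / Real.pi) * (2 * Real.pi / 3) := by
            have := Real.pi_pos
            gcongr
        _ = √3 / 2 := by
            field_simp
            norm_num
    · rw [hκ, ht, min_eq_right h]
      simp
  obtain ⟨δ, hδ, lam0, hlam0, hsq⟩ := exists_sqrt_ge hκ0 hκ1 hM0
  refine ⟨δ, hδ, lam0, hlam0, fun lam hl ξ hξ => ?_⟩
  have hlam : 0 < lam := hlam0.trans hl
  have hE := (inSobolev_half_iff ξ).1 hξ
  have hfm := (Lp.memLp (ft ξ)).1
  obtain ⟨iE, eE⟩ := integral_weight (continuous_bessel 1).aestronglyMeasurable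
    (fun p => (bessel_pos 1 p).le) hfm hE
  have hP := (lintegral_norm_mul_le_halfEnergy ξ).trans_lt hE
  obtain ⟨iP, eP⟩ := integral_weight (W := fun p => ‖p‖) continuous_norm.aestronglyMeasurable
    (fun p => norm_nonneg p) hfm hP
  have hinv : Measurable fun y : R3 => 1 / ‖y‖ := by fun_prop
  have hK : ∫⁻ x, ENNReal.ofReal (1 / ‖x‖) * ‖ξ x‖ₑ ^ 2 < ∞ := by
    refine (lintegral_coulomb_le ξ).trans_lt ?_
    have : volume (Metric.ball (0 : R3) 1) ≠ ∞ := measure_ball_lt_top.ne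
    finiteness
  obtain ⟨iK, eK⟩ := integral_weight hinv.aestronglyMeasurable
    (fun y => by positivity) (Lp.memLp ξ).1 hK
  have iN : Integrable fun p => ‖ft ξ p‖ ^ 2 := (memLp_two_iff_integrable_sq_norm hfm).1 (Lp.memLp _)
  have hEr : (halfEnergy ξ).toReal = ∫ p, bessel 1 p * ‖ft ξ p‖ ^ 2 := by
    rw [halfEnergy, eE, ENNReal.toReal_ofReal]
    exact integral_nonneg fun p => mul_nonneg (bessel_pos 1 p).le (by positivity)
  set P := ∫ p, ‖p‖ * ‖ft ξ p‖ ^ 2 with hPdef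
  set K := ∫ y, 1 / ‖y‖ * ‖ξ y‖ ^ 2 with hKdef
  have hP0 : 0 ≤ P := integral_nonneg fun p => by positivity
  have hK0 : 0 ≤ K := integral_nonneg fun p => by positivity
  have hX1 : ‖exchangeForm lam ξ ξ‖ ≤ 2 * Real.pi ^ 3 / 3 * P := by
    have h1 := lintegral_exchangeForm_le hlam ξ ξ
    rw [← two_mul, mul_left_comm, ENNReal.mul_le_mul_iff_right (by norm_num) (by norm_num), eP,
      ← ENNReal.ofReal_mul (by positivity)] at h1
    have h2 : ‖exchangeForm lam ξ ξ‖ₑ ≤ _ := (enorm_integral_le_lintegral_enorm _).trans h1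
    rwa [← ofReal_norm, ENNReal.ofReal_le_ofReal_iff (by positivity)] at h2
  have hX2 : ‖exchangeForm lam ξ ξ‖ ≤ 4 * Real.pi ^ 2 / 3 * K := by
    have hi := (integrable_exchangeForm hlam hξ hξ).norm
    have h1 := enorm_integral_div_pairForm_le_coulomb ξ hlam (hi.congr
      (Eventually.of_forall fun w => by
        have := pairForm_nonneg w.1 w.2
        simp only [norm_mul, RCLike.norm_conj, Complex.norm_real]
        rw [Real.norm_of_nonneg (by positivity : 0 ≤ 1 / (pairForm w.1 w.2 + lam))]
        ring))
    rw [eK, ← ENNReal.ofReal_mul (by positivity)] at h1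
    have h2 : exchangeForm lam ξ ξ = ∫ w : R3 × R3, conj (ft ξ w.1) * ft ξ w.2 *
        ((1 / (pairForm w.1 w.2 + lam) : ℝ) : ℂ) := by
      rw [exchangeForm]
      congr 1
      ext w
      ring
    rwa [← h2, ← ofReal_norm, ENNReal.ofReal_le_ofReal_iff (by positivity)] at h1
  -- The two bounds 2π/3 · P and 4/3 · K are averaged with weights 1 - t and t.
  have hX : 1 / Real.pi ^ 2 * ‖exchangeForm lam ξ ξ‖ ≤ γ * K + κ * P := by
    have hpi := Real.pi_pos
    have a1 : 1 / Real.pi ^ 2 * ‖exchangeForm lam ξ ξ‖ ≤ 2 * Real.pi / 3 * P := by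
      calc _ ≤ 1 / Real.pi ^ 2 * (2 * Real.pi ^ 3 / 3 * P) := by gcongr
        _ = _ := by field_simp
    have a2 : 1 / Real.pi ^ 2 * ‖exchangeForm lam ξ ξ‖ ≤ 4 / 3 * K := by
      calc _ ≤ 1 / Real.pi ^ 2 * (4 * Real.pi ^ 2 / 3 * K) := by gcongr
        _ = _ := by field_simp
    have a3 := mul_le_mul_of_nonneg_left a2 ht0
    have a4 := mul_le_mul_of_nonneg_left a1 (by linarith : 0 ≤ 1 - t)
    have a5 := mul_le_mul_of_nonneg_right htγ hK0
    rw [hκ]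
    nlinarith
  have iPE : Integrable fun p => κ * (‖p‖ * ‖ft ξ p‖ ^ 2) + δ * (bessel 1 p * ‖ft ξ p‖ ^ 2) :=
    (iP.const_mul _).add (iE.const_mul _)
  have hkin : κ * P + δ * (halfEnergy ξ).toReal + M * ‖ξ‖ ^ 2 ≤ (kineticForm lam ξ ξ).re := by
    have h1 := integrable_kineticForm hlam hξ hξ
    rw [kineticForm]
    simp_rw [conj_mul_ofReal_mul] at h1 ⊢
    rw [integral_complex_ofReal, Complex.ofReal_re, ← (ft : L2 R3 ≃ₗᵢ[ℂ] L2 R3).norm_map ξ,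
      norm_sq_eq_integral, hEr, hPdef, ← integral_const_mul, ← integral_const_mul,
      ← integral_const_mul, ← integral_add (iP.const_mul _) (iE.const_mul _),
      ← integral_add iPE (iN.const_mul _)]
    refine integral_mono (iPE.add (iN.const_mul _))
      (by simpa only [RCLike.re_to_complex, Complex.ofReal_re] using h1.re) fun p => ?_
    have h2 := mul_le_mul_of_nonneg_right (hsq lam hl p) (sq_nonneg ‖ft ξ p‖)
    simp only
    linarith
  have hcou := hM ξ hξ iK
  rw [PhiForm_eq hlam hξ hξ, Complex.add_re, Complex.sub_re]
  have hre : (1 / (Real.pi : ℂ) ^ 2 * exchangeForm lam ξ ξ).re ≤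
      1 / Real.pi ^ 2 * ‖exchangeForm lam ξ ξ‖ := by
    refine (Complex.re_le_norm _).trans (le_of_eq ?_)
    rw [norm_mul, norm_div, norm_pow, Complex.norm_real, Real.norm_of_nonneg Real.pi_pos.le,
      norm_one]
  linarith

end ChargeOperator
-- Inversion of Γ^λ by transport from H^{1/2} to L²
section ChargeResolvent

open Set Filter Topology

variable {β γ : ℝ} {θ : ℝ → ℝ} {lam : ℝ}

theorem memLp_bessel_neg_mul (u : L2 R3) :
    MemLp (fun p => (bessel (-(1 / 2)) p : ℂ) * u p) 2 volume := by
  refine (Lp.memLp u).of_le_mul (c := 1) ?_ (Eventually.of_forall fun p => ?_)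
  · exact ((Complex.continuous_ofReal.comp (continuous_bessel _)).aestronglyMeasurable).mul
      (Lp.memLp u).1
  · rw [norm_mul, Complex.norm_real, Real.norm_of_nonneg (bessel_pos _ _).le]
    gcongr
    exact bessel_neg_le_one (by norm_num) p

/-- The unitary map from `L²` onto `H^{1/2}`. -/
def halfSmoothing : L2 R3 →L[ℂ] L2 R3 :=
  LinearMap.mkContinuous
    { toFun := fun u => ft.symm (memLp_bessel_neg_mul (ft u)).toLp
      map_add' := fun u v => by
        rw [← map_add, ← MemLp.toLp_add]
        congr 1
        refine MemLp.toLp_congr _ _ ?_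
        filter_upwards [ft_add_ae u v] with p hp
        rw [hp, Pi.add_apply]
        ring
      map_smul' := fun a u => by
        rw [RingHom.id_apply, ← map_smul, ← MemLp.toLp_const_smul]
        congr 1
        refine MemLp.toLp_congr _ _ ?_
        filter_upwards [ft_smul_ae a u] with p hp
        rw [hp, Pi.smul_apply, smul_eq_mul]
        ring }
    1 fun u => by
      change ‖ft.symm (memLp_bessel_neg_mul (ft u)).toLp‖ ≤ 1 * ‖u‖
      rw [LinearIsometryEquiv.norm_map, one_mul, ← (ft : L2 R3 ≃ₗᵢ[ℂ] L2 R3).norm_map u]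
      refine Lp.norm_le_norm_of_ae_le ?_
      filter_upwards [MemLp.coeFn_toLp (memLp_bessel_neg_mul (ft u))] with p hp
      rw [hp, norm_mul, Complex.norm_real, Real.norm_of_nonneg (bessel_pos _ _).le]
      exact mul_le_of_le_one_left (norm_nonneg _) (bessel_neg_le_one (by norm_num) p)

theorem ft_halfSmoothing_ae (u : L2 R3) :
    ft (halfSmoothing u) =ᵐ[volume] fun p => (bessel (-(1 / 2)) p : ℂ) * ft u p := by
  have h : ft (halfSmoothing u) = (memLp_bessel_neg_mul (ft u)).toLp :=
    LinearIsometryEquiv.apply_symm_apply _ _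
  rw [h]
  exact MemLp.coeFn_toLp _

theorem halfEnergy_halfSmoothing (u : L2 R3) :
    halfEnergy (halfSmoothing u) = ENNReal.ofReal (‖u‖ ^ 2) := by
  rw [← (ft : L2 R3 ≃ₗᵢ[ℂ] L2 R3).norm_map u, ← lintegral_enorm_sq, halfEnergy]
  refine lintegral_congr_ae ?_
  filter_upwards [ft_halfSmoothing_ae u] with p hp
  rw [hp, enorm_ofReal_mul_sq (bessel_pos _ _).le, sq (bessel _ _), bessel_add, ← mul_assoc,
    ← ENNReal.ofReal_mul (bessel_pos _ _).le]
  have : bessel 1 p * bessel (-(1 / 2) + -(1 / 2)) p = 1 := by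
    rw [bessel_add]
    norm_num [bessel]
  rw [this, ENNReal.ofReal_one, one_mul]

theorem inSobolev_halfSmoothing (u : L2 R3) : InSobolev (1 / 2) (halfSmoothing u) := by
  rw [inSobolev_half_iff, halfEnergy_halfSmoothing]
  exact ENNReal.ofReal_lt_top

theorem exists_halfSmoothing_eq {ξ : L2 R3} (hξ : InSobolev (1 / 2) ξ) :
    ∃ u, halfSmoothing u = ξ := by
  rw [inSobolev_iff (by norm_num)] at hξ
  refine ⟨ft.symm hξ.toLp, ft.injective (Lp.ext ?_)⟩
  have h := ft_halfSmoothing_ae (ft.symm hξ.toLp)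
  rw [LinearIsometryEquiv.apply_symm_apply] at h
  filter_upwards [h, MemLp.coeFn_toLp hξ] with p h1 h2
  rw [h1, h2, ← mul_assoc, ← Complex.ofReal_mul, mul_comm (bessel _ p),
    bessel_mul_bessel_neg, Complex.ofReal_one, one_mul]

theorem inner_halfSmoothing (u v : L2 R3) :
    inner ℂ (halfSmoothing u) v = inner ℂ u (halfSmoothing v) := by
  rw [← inner_ft, ← inner_ft u, inner_eq_integral, inner_eq_integral]
  refine integral_congr_ae ?_
  filter_upwards [ft_halfSmoothing_ae u, ft_halfSmoothing_ae v] with p h1 h2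
  rw [h1, h2, map_mul, Complex.conj_ofReal]
  ring

theorem halfSmoothing_injective : Function.Injective halfSmoothing := by
  intro u v h
  have h1 : halfSmoothing (u - v) = 0 := by rw [map_sub, h, sub_self]
  have h2 := halfEnergy_halfSmoothing (u - v)
  have h3 : halfEnergy (0 : L2 R3) = 0 := by
    rw [halfEnergy, lintegral_congr_ae (g := fun _ => 0), lintegral_zero]
    refine Eventually.of_forall fun p => ?_
    simp
  rw [h1, h3, eq_comm, ENNReal.ofReal_eq_zero] at h2
  have h4 : ‖u - v‖ = 0 := by nlinarith [norm_nonneg (u - v)]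
  exact sub_eq_zero.1 (norm_eq_zero.1 h4)

theorem norm_le_of_enorm_le {z : ℂ} {c a b : ℝ} (ha : 0 ≤ a) (hb : 0 ≤ b)
    (h : ‖z‖ₑ ≤ ENNReal.ofReal c * (ENNReal.ofReal a + ENNReal.ofReal b)) :
    ‖z‖ ≤ |c| * (a + b) := by
  have h1 : ‖z‖ₑ ≤ ENNReal.ofReal (|c| * (a + b)) := by
    refine h.trans ?_
    rw [← ENNReal.ofReal_add ha hb, ENNReal.ofReal_mul (abs_nonneg c)]
    gcongr
    exact le_abs_self c
  rwa [← ofReal_norm, ENNReal.ofReal_le_ofReal_iff (by positivity)] at h1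

/-- The elementary bound by a sum of squares suffices, since scaling (`norm_le_of_le_sum_sq`)
upgrades it to a product of norms. -/
theorem exists_norm_PhiForm_le (β γ : ℝ) (hθ : CutoffHypothesis θ) (hlam : 0 < lam) :
    ∃ C : ℝ, 0 ≤ C ∧ ∀ u v : L2 R3,
      ‖PhiForm β γ θ lam (halfSmoothing u) (halfSmoothing v)‖ ≤ C * (‖u‖ ^ 2 + ‖v‖ ^ 2) := by
  obtain ⟨K, hK⟩ := exists_lintegral_coulombForm_le β γ hθ
  refine ⟨|1 + lam| + 1 / Real.pi ^ 2 * |2 * Real.pi ^ 3 / 3| + |K|, by positivity,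
    fun u v => ?_⟩
  rw [PhiForm_eq hlam (inSobolev_halfSmoothing u) (inSobolev_halfSmoothing v)]
  set η := halfSmoothing u with hη
  set ξ := halfSmoothing v with hξ
  have hu : halfEnergy η = ENNReal.ofReal (‖u‖ ^ 2) := halfEnergy_halfSmoothing u
  have hv : halfEnergy ξ = ENNReal.ofReal (‖v‖ ^ 2) := halfEnergy_halfSmoothing v
  have h1 : ‖kineticForm lam η ξ‖ ≤ |1 + lam| * (‖u‖ ^ 2 + ‖v‖ ^ 2) := by
    refine norm_le_of_enorm_le (by positivity) (by positivity) ?_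
    rw [← hu, ← hv]
    exact (enorm_integral_le_lintegral_enorm _).trans (lintegral_kineticForm_le hlam η ξ)
  have h2 : ‖exchangeForm lam η ξ‖ ≤ |2 * Real.pi ^ 3 / 3| * (‖u‖ ^ 2 + ‖v‖ ^ 2) := by
    refine norm_le_of_enorm_le (by positivity) (by positivity) ?_
    rw [← hu, ← hv]
    refine (enorm_integral_le_lintegral_enorm _).trans (le_trans ?_
      ((lintegral_exchangeForm_le hlam η ξ).trans (mul_le_mul_right (add_le_add
        (lintegral_norm_mul_le_halfEnergy η) (lintegral_norm_mul_le_halfEnergy ξ)) _)))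
    rw [two_mul]
    exact le_self_add
  have h3 : ‖coulombForm β γ θ η ξ‖ ≤ |K| * (‖u‖ ^ 2 + ‖v‖ ^ 2) := by
    refine norm_le_of_enorm_le (by positivity) (by positivity) ?_
    rw [← hu, ← hv]
    exact (enorm_integral_le_lintegral_enorm _).trans (hK η ξ)
  have h4 : ‖1 / (Real.pi : ℂ) ^ 2 * exchangeForm lam η ξ‖ ≤
      1 / Real.pi ^ 2 * (|2 * Real.pi ^ 3 / 3| * (‖u‖ ^ 2 + ‖v‖ ^ 2)) := by
    rw [norm_mul, norm_div, norm_pow, Complex.norm_real, Real.norm_of_nonneg Real.pi_pos.le,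
      norm_one]
    gcongr
  calc _ ≤ ‖kineticForm lam η ξ‖ + ‖1 / (Real.pi : ℂ) ^ 2 * exchangeForm lam η ξ‖ +
        ‖coulombForm β γ θ η ξ‖ :=
        (norm_add_le _ _).trans (add_le_add (norm_sub_le _ _) le_rfl)
    _ ≤ _ := by linarith

/-- A sesquilinear map bounded by the sum of the squares of the norms is bounded. -/
theorem norm_le_of_le_sum_sq {K : Type} [NormedAddCommGroup K] [NormedSpace ℂ K]
    (B : K →ₗ⋆[ℂ] K →ₗ[ℂ] ℂ) {C : ℝ} (h : ∀ u v, ‖B u v‖ ≤ C * (‖u‖ ^ 2 + ‖v‖ ^ 2)) (u v : K) :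
    ‖B u v‖ ≤ 2 * C * ‖u‖ * ‖v‖ := by
  rcases eq_or_ne u 0 with rfl | hu
  · simp
  rcases eq_or_ne v 0 with rfl | hv
  · simp
  have hu0 := norm_pos_iff.2 hu
  have hv0 := norm_pos_iff.2 hv
  have e : ∀ a b : ℂ, B (a • u) (b • v) = conj a * (b * B u v) := by
    intro a b
    rw [LinearMap.map_smulₛₗ B, LinearMap.smul_apply, map_smul, smul_eq_mul, smul_eq_mul]
  -- Both vectors are rescaled to unit length.
  have h1 := h (((‖u‖⁻¹ : ℝ) : ℂ) • u) (((‖v‖⁻¹ : ℝ) : ℂ) • v)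
  rw [e, norm_mul, norm_mul, norm_smul, norm_smul, RCLike.norm_conj, Complex.norm_real, Complex.norm_real,
    Real.norm_of_nonneg (by positivity), Real.norm_of_nonneg (by positivity),
    inv_mul_cancel₀ hu0.ne', inv_mul_cancel₀ hv0.ne'] at h1
  have h2 : ‖B u v‖ = ‖u‖ * ‖v‖ * (‖u‖⁻¹ * (‖v‖⁻¹ * ‖B u v‖)) := by field_simp
  rw [h2]
  calc _ ≤ ‖u‖ * ‖v‖ * (C * (1 ^ 2 + 1 ^ 2)) := by gcongr
    _ = _ := by ring

/-- The form of the charges transported to `L²`. -/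
def smoothedForm (β γ : ℝ) (hθ : CutoffHypothesis θ) (hlam : 0 < lam) :
    L2 R3 →ₗ⋆[ℂ] L2 R3 →ₗ[ℂ] ℂ :=
  LinearMap.mk₂'ₛₗ (starRingEnd ℂ) (RingHom.id ℂ)
    (fun u v => PhiForm β γ θ lam (halfSmoothing u) (halfSmoothing v))
    -- Antilinearity in the first argument is reduced to linearity in the second by Hermitian
    -- symmetry.
    (fun u u' v => by
      have i := inSobolev_halfSmoothing
      rw [PhiForm_conj hlam (i _) (i _), map_add, PhiForm_add_right hθ hlam (i _) (i _) (i _),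
        map_add, ← PhiForm_conj hlam (i _) (i _), ← PhiForm_conj hlam (i _) (i _)])
    (fun a u v => by
      have i := inSobolev_halfSmoothing
      rw [PhiForm_conj hlam (i _) (i _), map_smul, PhiForm_smul_right hlam a (i _) (i _),
        map_mul, ← PhiForm_conj hlam (i _) (i _), smul_eq_mul])
    (fun u v v' => by
      have i := inSobolev_halfSmoothing
      rw [map_add, PhiForm_add_right hθ hlam (i _) (i _) (i _)])
    (fun a u v => by
      have i := inSobolev_halfSmoothing
      rw [map_smul, PhiForm_smul_right hlam a (i _) (i _), RingHom.id_apply, smul_eq_mul])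

/-- The form of the charges is solvable on `H^{1/2}` for large `λ`. -/
theorem exists_solvableForm_PhiForm (β : ℝ) (hθ : CutoffHypothesis θ) (hγ : gammaC < γ) :
    ∃ δ > 0, ∃ lam0 > 0, ∀ lam : ℝ, lam0 < lam →
      ∃ R, SolvableForm {ξ : L2 R3 | InSobolev (1 / 2) ξ} (PhiForm β γ θ lam) 0 δ R := by
  obtain ⟨δ, hδ, lam0, hlam0, hco⟩ := PhiForm_coercive β hθ hγ
  refine ⟨δ, hδ, lam0, hlam0, fun lam hl => ?_⟩
  have hlam : 0 < lam := hlam0.trans hl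
  obtain ⟨C, hC0, hC⟩ := exists_norm_PhiForm_le β γ hθ hlam
  set S := LinearMap.mkContinuous₂ (smoothedForm β γ hθ hlam) (2 * C)
    (norm_le_of_le_sum_sq _ hC) with hS
  -- The operator of a bounded form acts on the first argument of the scalar product; the adjoint
  -- moves it to the second.
  set A := (InnerProductSpace.continuousLinearMapOfBilin S).adjoint with hA
  have hinner : ∀ u v, inner ℂ u (A v) =
      PhiForm β γ θ lam (halfSmoothing u) (halfSmoothing v) := by
    intro u v
    rw [hA, ContinuousLinearMap.adjoint_inner_right,
      InnerProductSpace.continuousLinearMapOfBilin_apply]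
    rfl
  have hsolve := exists_solution_of_coercive A hδ fun u => by
    rw [hinner]
    have h := hco lam hl _ (inSobolev_halfSmoothing u)
    rwa [halfEnergy_halfSmoothing, ENNReal.toReal_ofReal (by positivity)] at h
  choose Ainv hAinv using hsolve
  -- With S the smoothing map, Φ(S u, S v) = (u, A v), so Φ(S u, ξ) = (S u, f) = (u, S f) is solved
  -- by ξ = S A⁻¹ S f.
  refine ⟨fun f => halfSmoothing (Ainv (halfSmoothing f)), ?_⟩
  constructor
  · exact fun u hu v hv => InSobolev.sub (by norm_num) hu hv
  · exact fun u hu v hv => PhiForm_conj hlam hv hu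
  · intro v hv a ha b hb
    have h1 : InSobolev (1 / 2) ((-1 : ℂ) • b) := InSobolev.smul (by norm_num) _ hb
    rw [sub_eq_add_neg, ← neg_one_smul ℂ b, PhiForm_add_right hθ hlam hv ha h1,
      PhiForm_smul_right hlam _ hv hb]
    ring
  · intro v hv
    have h1 := hco lam hl v hv
    have h2 := ENNReal.toReal_mono ((inSobolev_half_iff v).1 hv).ne
      (ofReal_norm_sq_le_halfEnergy v)
    rw [ENNReal.toReal_ofReal (by positivity)] at h2
    have h3 := mul_le_mul_of_nonneg_left h2 hδ.le
    linarith
  · exact hδ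
  · exact fun f => inSobolev_halfSmoothing _
  · intro v hv f
    obtain ⟨u, rfl⟩ := exists_halfSmoothing_eq hv
    rw [Complex.ofReal_zero, zero_mul, add_zero, ← hinner, hAinv, inner_halfSmoothing]
  · intro f g hfg
    have h1 := halfSmoothing_injective hfg
    have h2 := congrArg A h1
    rw [hAinv, hAinv] at h2
    exact halfSmoothing_injective h2

end ChargeResolvent
-- Momentum-space symmetries, potentials and uniqueness of the charge
section Potentials

open Set Filter Topology

variable {lam : ℝ}

/-! ### Integration over `ℝ⁶` and symmetries in momentum space -/

theorem measurePreserving_toLp_R6 :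
    MeasurePreserving (WithLp.toLp 2 : R3 × R3 → R6) volume volume :=
  WithLp.volume_preserving_toLp R3 R3

theorem measurableEmbedding_toLp_R6 : MeasurableEmbedding (WithLp.toLp 2 : R3 × R3 → R6) :=
  (MeasurableEquiv.toLp 2 (R3 × R3)).measurableEmbedding

theorem lintegral_R6 (F : R6 → ℝ≥0∞) :
    ∫⁻ z, F z = ∫⁻ w : R3 × R3, F (WithLp.toLp 2 w) :=
  (measurePreserving_toLp_R6.lintegral_comp_emb measurableEmbedding_toLp_R6 F).symm

theorem integral_R6 (F : R6 → ℂ) : ∫ z, F z = ∫ w : R3 × R3, F (WithLp.toLp 2 w) :=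
  (measurePreserving_toLp_R6.integral_comp measurableEmbedding_toLp_R6 F).symm

theorem integrable_R6 {F : R6 → ℂ} (hF : Integrable F) :
    Integrable fun w : R3 × R3 => F (WithLp.toLp 2 w) :=
  measurePreserving_toLp_R6.integrable_comp_of_integrable hF

theorem norm_sq_R6 (z : R6) : ‖z‖ ^ 2 = ‖z.fst‖ ^ 2 + ‖z.snd‖ ^ 2 :=
  WithLp.prod_norm_sq_eq_of_L2 z

theorem reflection_comp_self : reflection ∘ₗ reflection = LinearMap.id :=
  LinearMap.ext fun z => R6.ext (by simp [reflection]) (by simp [reflection])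

theorem exchange_comp_self : exchange ∘ₗ exchange = LinearMap.id :=
  LinearMap.ext fun z => R6.ext
    (by simp only [exchange, LinearMap.comp_apply, LinearMap.coe_mk, AddHom.coe_mk,
          WithLp.toLp_fst, WithLp.toLp_snd, LinearMap.id_apply]
        module)
    (by simp only [exchange, LinearMap.comp_apply, LinearMap.coe_mk, AddHom.coe_mk,
          WithLp.toLp_fst, WithLp.toLp_snd, LinearMap.id_apply]
        module)

theorem momentumExchange_comp_self : momentumExchange ∘ₗ momentumExchange = LinearMap.id :=
  LinearMap.ext fun z => R6.ext
    (by simp only [momentumExchange, LinearMap.comp_apply, LinearMap.coe_mk, AddHom.coe_mk,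
          WithLp.toLp_fst, WithLp.toLp_snd, LinearMap.id_apply]
        module)
    (by simp only [momentumExchange, LinearMap.comp_apply, LinearMap.coe_mk, AddHom.coe_mk,
          WithLp.toLp_fst, WithLp.toLp_snd, LinearMap.id_apply]
        module)

theorem inner_reflection (z z' : R6) :
    inner ℝ (reflection z) z' = inner ℝ z (reflection z') := by
  simp [reflection, WithLp.prod_inner_apply]

theorem inner_exchange (z z' : R6) :
    inner ℝ (exchange z) z' = inner ℝ z (momentumExchange z') := by
  change inner ℝ ((1 / 2 : ℝ) • z.fst + z.snd) z'.fst +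
      inner ℝ ((3 / 4 : ℝ) • z.fst - (1 / 2 : ℝ) • z.snd) z'.snd =
    inner ℝ z.fst ((1 / 2 : ℝ) • z'.fst + (3 / 4 : ℝ) • z'.snd) +
      inner ℝ z.snd (z'.fst - (1 / 2 : ℝ) • z'.snd)
  simp only [inner_add_left, inner_add_right, inner_sub_left, inner_sub_right, inner_smul_left,
    inner_smul_right, conj_trivial]
  ring

/-- `u ↦ u(k/2 + 3p/4, k - p/2)`. -/
def exchangeOp : L2 R6 →ₗᵢ[ℂ] L2 R6 :=
  Lp.compMeasurePreservingₗᵢ ℂ momentumExchange measurePreserving_momentumExchange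

/-- `u ↦ u(-k, p)`. -/
def reflectionOp : L2 R6 →ₗᵢ[ℂ] L2 R6 :=
  Lp.compMeasurePreservingₗᵢ ℂ reflection measurePreserving_reflection

theorem coeFn_exchangeOp (u : L2 R6) :
    exchangeOp u =ᵐ[volume] fun z => u (momentumExchange z) :=
  Lp.coeFn_compMeasurePreserving u measurePreserving_momentumExchange

theorem coeFn_reflectionOp (u : L2 R6) :
    reflectionOp u =ᵐ[volume] fun z => u (reflection z) :=
  Lp.coeFn_compMeasurePreserving u measurePreserving_reflection

theorem ae_momentumExchange {P : R6 → Prop} (h : ∀ᵐ z, P z) : ∀ᵐ z, P (momentumExchange z) :=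
  measurePreserving_momentumExchange.quasiMeasurePreserving.ae h

theorem ae_reflection {P : R6 → Prop} (h : ∀ᵐ z, P z) : ∀ᵐ z, P (reflection z) :=
  measurePreserving_reflection.quasiMeasurePreserving.ae h

/-- The Fourier transform carries a linear involution to its transpose: the reflection is its own,
that of the exchange is the momentum exchange. -/
theorem mem_L2sym_iff (ψ : L2 R6) :
    ψ ∈ L2sym ↔ reflectionOp (ft ψ) = ft ψ ∧ exchangeOp (ft ψ) = ft ψ := by
  have h1 : ft.symm (reflectionOp (ft ψ)) =
      Lp.compMeasurePreserving reflection measurePreserving_reflection ψ := by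
    have := ft_symm_compMeasurePreserving reflection reflection reflection_comp_self
      reflection_comp_self inner_reflection (ft ψ)
    rwa [LinearIsometryEquiv.symm_apply_apply] at this
  have h2 : ft.symm (exchangeOp (ft ψ)) =
      Lp.compMeasurePreserving exchange measurePreserving_exchange ψ := by
    have := ft_symm_compMeasurePreserving exchange momentumExchange exchange_comp_self
      momentumExchange_comp_self inner_exchange (ft ψ)
    rwa [LinearIsometryEquiv.symm_apply_apply] at this
  have key : ∀ {T : R6 → R6} (hT : MeasurePreserving T volume volume),
      (∀ᵐ z, ψ (T z) = ψ z) ↔ Lp.compMeasurePreserving T hT ψ = ψ := by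
    intro T hT
    have hc := Lp.coeFn_compMeasurePreserving ψ hT
    constructor
    · intro h
      refine Lp.ext ?_
      filter_upwards [h, hc] with z a b
      rw [b, Function.comp_apply, a]
    · intro h
      rw [h] at hc
      filter_upwards [hc] with z b
      rw [b, Function.comp_apply]
  rw [← LinearIsometryEquiv.symm_apply_eq, ← LinearIsometryEquiv.symm_apply_eq]
  change (∀ᵐ z, ψ (reflection z) = ψ z) ∧ (∀ᵐ z, ψ (exchange z) = ψ z) ↔ _
  rw [key measurePreserving_reflection, key measurePreserving_exchange, ← h1, ← h2]

/-! ### Potentials -/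

theorem ft_potential_ae (hlam : 0 < lam) (ξ : L2 R3) :
    ft (potential hlam ξ) =ᵐ[volume] potentialFun lam (ft ξ) := by
  rw [potential, LinearIsometryEquiv.apply_symm_apply]
  exact MemLp.coeFn_toLp _

theorem ft_G23 (hlam : 0 < lam) (ξ : L2 R3) : ft (G23 hlam ξ) = layerLp hlam (ft ξ) :=
  LinearIsometryEquiv.apply_symm_apply _ _

theorem ft_G23_ae (hlam : 0 < lam) (ξ : L2 R3) :
    ft (G23 hlam ξ) =ᵐ[volume] layer lam (ft ξ) := by
  rw [ft_G23]
  exact coeFn_layerLp hlam _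

/-- The layers on the other two planes are images of the first under the symmetries, because the
free symbol is invariant. Estimates and scalar products thereby reduce to a single layer. -/
theorem ft_potential (hlam : 0 < lam) (ξ : L2 R3) :
    ft (potential hlam ξ) = ft (G23 hlam ξ) + exchangeOp (ft (G23 hlam ξ)) +
      reflectionOp (exchangeOp (ft (G23 hlam ξ))) := by
  have h := ft_G23_ae hlam ξ
  refine Lp.ext ?_
  filter_upwards [ft_potential_ae hlam ξ, h, ae_momentumExchange h,
    ae_reflection (ae_momentumExchange h), coeFn_exchangeOp (ft (G23 hlam ξ)),
    ae_reflection (coeFn_exchangeOp (ft (G23 hlam ξ))),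
    coeFn_reflectionOp (exchangeOp (ft (G23 hlam ξ))),
    Lp.coeFn_add (ft (G23 hlam ξ) + exchangeOp (ft (G23 hlam ξ)))
      (reflectionOp (exchangeOp (ft (G23 hlam ξ)))),
    Lp.coeFn_add (ft (G23 hlam ξ)) (exchangeOp (ft (G23 hlam ξ)))]
    with z h0 h1 h2 h3 h4 h5 h6 h7 h8
  rw [h7, Pi.add_apply, h8, Pi.add_apply, h6, h5, h4, h3, h2, h1, h0]
  simp only [layer, freeSymbol_momentumExchange, freeSymbol_reflection, potentialFun]
  simp only [momentumExchange, reflection, LinearMap.coe_mk, AddHom.coe_mk, WithLp.toLp_fst,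
    WithLp.toLp_snd]
  ring

theorem potential_sub (hlam : 0 < lam) (ξ ζ : L2 R3) :
    potential hlam (ξ - ζ) = potential hlam ξ - potential hlam ζ := by
  apply ft.injective
  rw [map_sub, ft_potential, ft_potential, ft_potential]
  simp only [map_sub]
  abel

theorem potential_smul (hlam : 0 < lam) (a : ℂ) (ξ : L2 R3) :
    potential hlam (a • ξ) = a • potential hlam ξ := by
  apply ft.injective
  rw [map_smul, ft_potential, ft_potential]
  simp only [map_smul, smul_add]

theorem norm_potential_le (hlam : 0 < lam) (ξ : L2 R3) :
    ‖potential hlam ξ‖ ≤ 3 * ‖G23 hlam‖ * ‖ξ‖ := by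
  have h := (G23 hlam).le_opNorm ξ
  rw [← (ft : L2 R6 ≃ₗᵢ[ℂ] L2 R6).norm_map (potential hlam ξ), ft_potential]
  refine (norm_add₃_le).trans ?_
  simp only [LinearIsometry.norm_map, LinearIsometryEquiv.norm_map]
  linarith

theorem potentialFun_reflection (u : R3 → ℂ) (z : R6) :
    potentialFun lam u (reflection z) = potentialFun lam u z := by
  simp only [potentialFun, freeSymbol_reflection]
  simp only [reflection, LinearMap.coe_mk, AddHom.coe_mk, WithLp.toLp_fst, WithLp.toLp_snd,
    neg_neg]
  ring

/-- The momentum exchange swaps the arguments p and k - p/2 of the charge and fixes -k - p/2. -/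
theorem potentialFun_momentumExchange (u : R3 → ℂ) (z : R6) :
    potentialFun lam u (momentumExchange z) = potentialFun lam u z := by
  simp only [potentialFun, freeSymbol_momentumExchange]
  simp only [momentumExchange, LinearMap.coe_mk, AddHom.coe_mk, WithLp.toLp_fst, WithLp.toLp_snd]
  have e1 : (1 / 2 : ℝ) • z.fst + (3 / 4 : ℝ) • z.snd -
      (1 / 2 : ℝ) • (z.fst - (1 / 2 : ℝ) • z.snd) = z.snd := by module
  have e2 : -((1 / 2 : ℝ) • z.fst + (3 / 4 : ℝ) • z.snd) -
      (1 / 2 : ℝ) • (z.fst - (1 / 2 : ℝ) • z.snd) = -z.fst - (1 / 2 : ℝ) • z.snd := by module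
  rw [e1, e2]
  ring

theorem potential_mem_L2sym (hlam : 0 < lam) (ξ : L2 R3) : potential hlam ξ ∈ L2sym := by
  have h := ft_potential_ae hlam ξ
  rw [mem_L2sym_iff]
  constructor
  · refine Lp.ext ?_
    filter_upwards [coeFn_reflectionOp (ft (potential hlam ξ)), h, ae_reflection h] with z a b c
    rw [a, b, c, potentialFun_reflection]
  · refine Lp.ext ?_
    filter_upwards [coeFn_exchangeOp (ft (potential hlam ξ)), h, ae_momentumExchange h]
      with z a b c
    rw [a, b, c, potentialFun_momentumExchange]

/-- On symmetric functions the three layers contribute equally. -/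
theorem inner_potential (hlam : 0 < lam) (ξ : L2 R3) {g : L2 R6} (hg : g ∈ L2sym) :
    inner ℂ (potential hlam ξ) g = 3 * inner ℂ (G23 hlam ξ) g := by
  obtain ⟨h1, h2⟩ := (mem_L2sym_iff g).1 hg
  rw [← inner_ft, ft_potential, inner_add_left, inner_add_left, ← inner_ft (G23 hlam ξ)]
  -- The transform of g is fixed by the symmetry, which is isometric, so the symmetry can be removed
  -- from the layer.
  have e1 : ∀ u, inner ℂ (exchangeOp u) (ft g) = inner ℂ u (ft g) := fun u => by
    nth_rw 1 [← h2]
    rw [LinearIsometry.inner_map_map]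
  have e2 : ∀ u, inner ℂ (reflectionOp u) (ft g) = inner ℂ u (ft g) := fun u => by
    nth_rw 1 [← h1]
    rw [LinearIsometry.inner_map_map]
  rw [e2, e1]
  ring

/-! ### Uniqueness of the decomposition -/

/-- The divergence behind the uniqueness of the charge: in polar coordinates the integrand k²/(k² +
c) is at least 1/2 beyond √c. -/
theorem lintegral_inv_norm_sq_add {c : ℝ} (hc : 0 < c) :
    ∫⁻ k : R3, ENNReal.ofReal (1 / (‖k‖ ^ 2 + c)) = ∞ := by
  by_contra hne
  have hm : Continuous fun k : R3 => 1 / (‖k‖ ^ 2 + c) := by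
    refine Continuous.div (by fun_prop) (by fun_prop) fun k => ?_
    positivity
  have hi : Integrable fun k : R3 => 1 / (‖k‖ ^ 2 + c) := by
    refine ⟨hm.aestronglyMeasurable, ?_⟩
    rw [hasFiniteIntegral_iff_ofReal (Eventually.of_forall fun k => by positivity)]
    exact lt_top_iff_ne_top.2 hne
  rw [integrable_fun_norm_addHaar volume (f := fun y => 1 / (y ^ 2 + c))] at hi
  have h2 : IntegrableOn (fun _ : ℝ => (1 / 2 : ℝ)) (Ioi (√c)) := by
    refine Integrable.mono' (hi.mono_set (Ioi_subset_Ioi (Real.sqrt_nonneg c)))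
      (by fun_prop) ((ae_restrict_iff' measurableSet_Ioi).2 (Eventually.of_forall fun y hy => ?_))
    have hy1 : √c < y := hy
    have hy0 : 0 < y := (Real.sqrt_nonneg c).trans_lt hy1
    have hy2 : c < y ^ 2 := (Real.sqrt_lt' hy0).1 hy1
    have hd : Module.finrank ℝ R3 - 1 = 2 := by simp
    rw [hd, smul_eq_mul, Real.norm_of_nonneg (by norm_num), mul_one_div,
      div_le_div_iff₀ (by norm_num) (by positivity)]
    linarith
  rw [integrableOn_const_iff] at h2
  simp at h2

theorem enorm_add_three_sq_le (a b c : ℂ) :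
    ‖a‖ₑ ^ 2 ≤ 3 * (‖a + b + c‖ₑ ^ 2 + ‖b‖ₑ ^ 2 + ‖c‖ₑ ^ 2) := by
  have h : ‖a‖ ^ 2 ≤ 3 * (‖a + b + c‖ ^ 2 + ‖b‖ ^ 2 + ‖c‖ ^ 2) := by
    have h1 : ‖a‖ ≤ ‖a + b + c‖ + ‖b‖ + ‖c‖ := by
      calc ‖a‖ = ‖a + b + c - b - c‖ := by congr 1; ring
        _ ≤ _ := (norm_sub_le _ _).trans (add_le_add (norm_sub_le _ _) le_rfl)
    have h2 : ‖a‖ ^ 2 ≤ (‖a + b + c‖ + ‖b‖ + ‖c‖) ^ 2 := by gcongr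
    nlinarith [sq_nonneg (‖a + b + c‖ - ‖b‖), sq_nonneg (‖a + b + c‖ - ‖c‖),
      sq_nonneg (‖b‖ - ‖c‖)]
  have h3 := ENNReal.ofReal_le_ofReal h
  rw [ENNReal.ofReal_mul (by norm_num), ENNReal.ofReal_add (by positivity) (by positivity),
    ENNReal.ofReal_add (by positivity) (by positivity)] at h3
  simpa [ENNReal.ofReal_pow, ofReal_norm] using h3

/-- A charge whose potential has finite kinetic energy vanishes. -/
theorem eq_zero_of_inSobolev_potential (hlam : 0 < lam) {ζ : L2 R3}
    (h : InSobolev 1 (potential hlam ζ)) : ζ = 0 := by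
  set u := ft ζ with hu
  have hum : AEMeasurable (fun p => ‖u p‖ₑ ^ 2) volume := (Lp.memLp u).1.enorm.pow_const 2
  have hu2 : ∫⁻ p, ‖u p‖ₑ ^ 2 ≠ ∞ := by
    rw [lintegral_enorm_sq]
    exact ENNReal.ofReal_ne_top
  set A : R3 × R3 → ℝ≥0∞ := fun w =>
    ENNReal.ofReal (1 / (freeSymbol (WithLp.toLp 2 w) + lam)) with hA
  have hAm : Measurable A := by
    have h1 : Continuous fun w : R3 × R3 => freeSymbol (WithLp.toLp 2 w) :=
      continuous_freeSymbol.comp (by fun_prop)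
    have h2 := h1.measurable
    simp only [hA]
    fun_prop
  have hA1 : ∀ w, A w ≤ ENNReal.ofReal (1 / lam) := fun w => by
    refine ENNReal.ofReal_le_ofReal ?_
    have := freeSymbol_nonneg (WithLp.toLp 2 w)
    gcongr
    linarith
  set S : R3 × R3 → ℂ := fun w =>
    u w.2 + u (w.1 - (1 / 2 : ℝ) • w.2) + u (-w.1 - (1 / 2 : ℝ) • w.2) with hS
  -- Membership in H¹ compensates one of the two denominators in |potential|², leaving a single
  -- power of 1/(k² + 3p²/4 + λ).
  have hfin : ∫⁻ w, A w * ‖S w‖ₑ ^ 2 < ∞ := by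
    rw [inSobolev_iff zero_le_one, memLp_two_iff_lintegral] at h
    · have h1 : ∫⁻ z, ENNReal.ofReal (1 / (freeSymbol z + lam)) *
          ‖u z.snd + u (z.fst - (1 / 2 : ℝ) • z.snd) + u (-z.fst - (1 / 2 : ℝ) • z.snd)‖ₑ ^ 2 ≤
          ENNReal.ofReal ((1 + lam) * (Real.pi / 2)) *
            ∫⁻ z, ‖(bessel 1 z : ℂ) * ft (potential hlam ζ) z‖ₑ ^ 2 := by
        rw [← lintegral_const_mul' _ _ ENNReal.ofReal_ne_top]
        refine lintegral_mono_ae ?_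
        filter_upwards [ft_potential_ae hlam ζ] with z hz
        have ha := freeSymbol_nonneg z
        have hb : bessel 1 z ^ 2 = 1 + ‖z‖ ^ 2 := by
          unfold bessel
          rw [← Real.sqrt_eq_rpow, Real.sq_sqrt (by positivity)]
        have hle : freeSymbol z + lam ≤ (1 + lam) * (1 + ‖z‖ ^ 2) := by
          rw [norm_sq_R6, freeSymbol]
          nlinarith [sq_nonneg ‖z.fst‖, sq_nonneg ‖z.snd‖,
            mul_nonneg hlam.le (sq_nonneg ‖z.fst‖), mul_nonneg hlam.le (sq_nonneg ‖z.snd‖)]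
        have hp : potentialFun lam u z = ((√(2 / Real.pi) / (freeSymbol z + lam) : ℝ) : ℂ) *
            (u z.snd + u (z.fst - (1 / 2 : ℝ) • z.snd) + u (-z.fst - (1 / 2 : ℝ) • z.snd)) := by
          rw [potentialFun]
          push_cast
          ring
        rw [hz, hp, enorm_ofReal_mul_sq (bessel_pos _ _).le, enorm_ofReal_mul_sq (by positivity),
          ← mul_assoc, ← mul_assoc, ← ENNReal.ofReal_mul (by positivity),
          ← ENNReal.ofReal_mul (by positivity)]
        gcongr
        rw [hb, div_pow, Real.sq_sqrt (by positivity)]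
        have hpi := Real.pi_pos
        calc 1 / (freeSymbol z + lam) = (freeSymbol z + lam) * (1 / (freeSymbol z + lam) ^ 2) := by
              field_simp
          _ ≤ (1 + lam) * (1 + ‖z‖ ^ 2) * (1 / (freeSymbol z + lam) ^ 2) := by gcongr
          _ = _ := by field_simp
      rw [lintegral_R6] at h1
      exact h1.trans_lt (ENNReal.mul_lt_top ENNReal.ofReal_lt_top h)
    · exact ((Complex.continuous_ofReal.comp (continuous_bessel _)).aestronglyMeasurable).mul
        (Lp.memLp _).1
  -- Restriction to bounded p makes the two other charges harmless: at fixed p they are translates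
  -- of u in k, with finite square integral.
  have hball : ∀ N : ℕ, ∀ᵐ p, p ∈ Metric.ball (0 : R3) N → u p = 0 := by
    intro N
    set B := Metric.ball (0 : R3) N with hB
    -- Measurability of the sum S is read off from that of the potential, of which it is a
    -- continuous multiple.
    have hS1 : AEMeasurable (fun w : R3 × R3 => A w * ‖S w‖ₑ ^ 2) volume := by
      have q1 : AEStronglyMeasurable (fun w : R3 × R3 => potentialFun lam u (WithLp.toLp 2 w))
          volume := (memLp_potentialFun hlam (Lp.memLp u)).1.comp_measurePreserving
            measurePreserving_toLp_R6
      have q2 : (fun w : R3 × R3 => A w * ‖S w‖ₑ ^ 2) = fun w => A w *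
          (ENNReal.ofReal ((freeSymbol (WithLp.toLp 2 w) + lam) ^ 2 * (Real.pi / 2)) *
            ‖potentialFun lam u (WithLp.toLp 2 w)‖ₑ ^ 2) := by
        funext w
        have ha := freeSymbol_nonneg (WithLp.toLp 2 w)
        have hp : potentialFun lam u (WithLp.toLp 2 w) =
            ((√(2 / Real.pi) / (freeSymbol (WithLp.toLp 2 w) + lam) : ℝ) : ℂ) * S w := by
          change (√(2 / Real.pi) : ℂ) * S w / ((freeSymbol (WithLp.toLp 2 w) + lam : ℝ) : ℂ) = _
          push_cast
          ring
        have hpi := Real.pi_pos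
        have e : (freeSymbol (WithLp.toLp 2 w) + lam) ^ 2 * (Real.pi / 2) *
            (√(2 / Real.pi) / (freeSymbol (WithLp.toLp 2 w) + lam)) ^ 2 = 1 := by
          rw [div_pow, Real.sq_sqrt (by positivity)]
          field_simp
        have hnn : 0 ≤ (freeSymbol (WithLp.toLp 2 w) + lam) ^ 2 * (Real.pi / 2) := by positivity
        rw [hp, enorm_ofReal_mul_sq (by positivity), ← mul_assoc (ENNReal.ofReal (_ * _)),
          ← ENNReal.ofReal_mul hnn, e, ENNReal.ofReal_one, one_mul]
      rw [q2]
      have h1 : Continuous fun w : R3 × R3 => freeSymbol (WithLp.toLp 2 w) :=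
        continuous_freeSymbol.comp (by fun_prop)
      have h2 := h1.measurable
      exact hAm.aemeasurable.mul (AEMeasurable.mul
        (((h2.add_const lam).pow_const 2).mul_const _).ennreal_ofReal.aemeasurable
        (q1.enorm.pow_const 2))
    have hsum : ∫⁻ p in B, ∫⁻ k, A (k, p) * ‖u p‖ₑ ^ 2 < ∞ := by
      have hle : ∀ p k : R3, A (k, p) * ‖u p‖ₑ ^ 2 ≤ 3 * (A (k, p) * ‖S (k, p)‖ₑ ^ 2) +
          3 * ENNReal.ofReal (1 / lam) * (‖u (k - (1 / 2 : ℝ) • p)‖ₑ ^ 2 +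
            ‖u (-k - (1 / 2 : ℝ) • p)‖ₑ ^ 2) := by
        intro p k
        have h1 := enorm_add_three_sq_le (u p) (u (k - (1 / 2 : ℝ) • p))
          (u (-k - (1 / 2 : ℝ) • p))
        calc A (k, p) * ‖u p‖ₑ ^ 2
            ≤ A (k, p) * (3 * (‖S (k, p)‖ₑ ^ 2 + ‖u (k - (1 / 2 : ℝ) • p)‖ₑ ^ 2 +
              ‖u (-k - (1 / 2 : ℝ) • p)‖ₑ ^ 2)) := mul_le_mul_right h1 _
          _ = 3 * (A (k, p) * ‖S (k, p)‖ₑ ^ 2) + 3 * A (k, p) *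
              (‖u (k - (1 / 2 : ℝ) • p)‖ₑ ^ 2 + ‖u (-k - (1 / 2 : ℝ) • p)‖ₑ ^ 2) := by ring
          _ ≤ _ := by
            gcongr
            exact hA1 _
      have t1 : ∀ p : R3, ∫⁻ k, ‖u (k - (1 / 2 : ℝ) • p)‖ₑ ^ 2 = ∫⁻ k, ‖u k‖ₑ ^ 2 := fun p =>
        lintegral_sub_right_eq_self (fun k => ‖u k‖ₑ ^ 2) _
      have t2 : ∀ p : R3, ∫⁻ k, ‖u (-k - (1 / 2 : ℝ) • p)‖ₑ ^ 2 = ∫⁻ k, ‖u k‖ₑ ^ 2 := fun p => by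
        rw [lintegral_neg_eq_self (fun k => ‖u (k - (1 / 2 : ℝ) • p)‖ₑ ^ 2), t1]
      have t3 : ∀ p : R3, AEMeasurable (fun k : R3 => ‖u (k - (1 / 2 : ℝ) • p)‖ₑ ^ 2) volume :=
        fun p => hum.comp_quasiMeasurePreserving
          (measurePreserving_sub_right volume ((1 / 2 : ℝ) • p)).quasiMeasurePreserving
      calc ∫⁻ p in B, ∫⁻ k, A (k, p) * ‖u p‖ₑ ^ 2
          ≤ ∫⁻ p in B, ((∫⁻ k, 3 * (A (k, p) * ‖S (k, p)‖ₑ ^ 2)) +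
              3 * ENNReal.ofReal (1 / lam) * (2 * ∫⁻ k, ‖u k‖ₑ ^ 2)) := by
            refine lintegral_mono fun p => (lintegral_mono (hle p)).trans ?_
            have t4 : AEMeasurable (fun k : R3 => 3 * ENNReal.ofReal (1 / lam) *
                (‖u (k - (1 / 2 : ℝ) • p)‖ₑ ^ 2 + ‖u (-k - (1 / 2 : ℝ) • p)‖ₑ ^ 2)) volume :=
              ((t3 p).add ((t3 p).comp_quasiMeasurePreserving
                (Measure.measurePreserving_neg volume).quasiMeasurePreserving)).const_mul _
            rw [lintegral_add_right' _ t4, lintegral_const_mul' _ _ (by finiteness),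
              lintegral_const_mul' _ _ (by finiteness), lintegral_add_left' (t3 p), t1, t2,
              two_mul]
        _ = (∫⁻ p in B, ∫⁻ k, 3 * (A (k, p) * ‖S (k, p)‖ₑ ^ 2)) +
              3 * ENNReal.ofReal (1 / lam) * (2 * ∫⁻ k, ‖u k‖ₑ ^ 2) * volume B := by
            rw [lintegral_add_right' _ aemeasurable_const, setLIntegral_const]
        _ ≤ 3 * (∫⁻ w, A w * ‖S w‖ₑ ^ 2) +
              3 * ENNReal.ofReal (1 / lam) * (2 * ∫⁻ k, ‖u k‖ₑ ^ 2) * volume B := by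
            gcongr
            refine (setLIntegral_le_lintegral _ _).trans (le_of_eq ?_)
            rw [Measure.volume_eq_prod, lintegral_prod_symm _ hS1,
              ← lintegral_const_mul' _ _ (by norm_num)]
            refine lintegral_congr fun p => ?_
            rw [lintegral_const_mul' _ _ (by norm_num)]
        _ < ∞ := by
            have hBt : volume B ≠ ∞ := measure_ball_lt_top.ne
            have := hfin.ne
            finiteness
    -- The surviving term is |u(p)|² times a divergent integral in k, so finiteness forces u(p) = 0.
    have hinf : ∀ p : R3, ∫⁻ k : R3, A (k, p) = ∞ := by
      intro p
      have e : ∀ k : R3, A (k, p) = ENNReal.ofReal (1 / (‖k‖ ^ 2 + (3 / 4 * ‖p‖ ^ 2 + lam))) := by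
        intro k
        change ENNReal.ofReal (1 / (‖k‖ ^ 2 + 3 / 4 * ‖p‖ ^ 2 + lam)) = _
        rw [add_assoc]
      simp_rw [e]
      exact lintegral_inv_norm_sq_add (by positivity)
    have e2 : ∀ p : R3, ∫⁻ k, A (k, p) * ‖u p‖ₑ ^ 2 = ∞ * ‖u p‖ₑ ^ 2 := by
      intro p
      rw [lintegral_mul_const' _ _ (by finiteness), hinf]
    simp_rw [e2] at hsum
    have h3 := ae_lt_top' (hum.restrict.const_mul ∞) hsum.ne
    rw [ae_restrict_iff' measurableSet_ball] at h3
    filter_upwards [h3] with p hp hpB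
    by_contra h0
    have h4 := hp hpB
    rw [ENNReal.top_mul (by simpa using h0)] at h4
    exact lt_irrefl _ h4
  have hu0 : u = 0 := by
    refine Lp.ext ?_
    filter_upwards [ae_all_iff.2 hball, Lp.coeFn_zero ℂ 2 (volume : Measure R3)] with p hp h0
    rw [h0, Pi.zero_apply]
    obtain ⟨N, hN⟩ := exists_nat_gt ‖p‖
    exact hp N (by simpa using hN)
  exact (map_eq_zero_iff _ ft.injective).1 hu0

/-- The difference of two charges has a potential equal to a difference of regular parts, hence in
H¹. -/
theorem IsDecomposition.unique (hlam : 0 < lam) {ψ w w' : L2 R6} {ξ ξ' : L2 R3}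
    (h : IsDecomposition hlam ψ w ξ) (h' : IsDecomposition hlam ψ w' ξ') : w = w' ∧ ξ = ξ' := by
  have h1 : potential hlam (ξ - ξ') = w' - w := by
    rw [potential_sub, sub_eq_sub_iff_add_eq_add, add_comm, ← h.2.2, h'.2.2, add_comm]
  have h2 : ξ - ξ' = 0 := by
    refine eq_zero_of_inSobolev_potential hlam ?_
    rw [h1]
    exact h'.1.sub zero_le_one h.1
  have h3 : ξ = ξ' := sub_eq_zero.1 h2
  refine ⟨?_, h3⟩
  have h4 := h.2.2.symm.trans h'.2.2
  rw [h3] at h4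
  exact add_right_cancel h4

end Potentials
-- The free resolvent, its form and its trace
section FreeResolvent

open Set Filter Topology

variable {lam mu : ℝ}

theorem InSobolev.mono {E : Type} [NormedAddCommGroup E] [InnerProductSpace ℝ E]
    [FiniteDimensional ℝ E] [MeasurableSpace E] [BorelSpace E] {s t : ℝ} (hs : 0 ≤ s)
    (hst : s ≤ t) {u : L2 E} (hu : InSobolev t u) : InSobolev s u := by
  rw [inSobolev_iff (hs.trans hst)] at hu
  rw [inSobolev_iff hs]
  refine memLp_mul_of_le (Lp.memLp (ft u)).1 (continuous_bessel s).aestronglyMeasurable (C := 1)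
    (fun x => ?_) hu
  rw [abs_of_pos (bessel_pos _ _), abs_of_pos (bessel_pos _ _), one_mul]
  unfold bessel
  exact Real.rpow_le_rpow_of_exponent_le (by nlinarith [sq_nonneg ‖x‖]) (by linarith)

theorem freeSymbol_add_pos (hlam : 0 < lam) (z : R6) : 0 < freeSymbol z + lam := by
  linarith [freeSymbol_nonneg z]

theorem freeSymbol_add_le (hlam : 0 < lam) (z : R6) :
    freeSymbol z + lam ≤ (1 + lam) * (1 + ‖z‖ ^ 2) := by
  rw [norm_sq_R6, freeSymbol]
  nlinarith [sq_nonneg ‖z.fst‖, sq_nonneg ‖z.snd‖,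
    mul_nonneg hlam.le (sq_nonneg ‖z.fst‖), mul_nonneg hlam.le (sq_nonneg ‖z.snd‖)]

theorem one_add_norm_sq_le (hlam : 0 < lam) (z : R6) :
    1 + ‖z‖ ^ 2 ≤ (4 / 3 + 1 / lam) * (freeSymbol z + lam) := by
  have h1 : 1 / lam * (freeSymbol z + lam) = 1 / lam * freeSymbol z + 1 := by field_simp
  have h2 : 0 ≤ 1 / lam * freeSymbol z := mul_nonneg (by positivity) (freeSymbol_nonneg z)
  rw [norm_sq_R6, add_mul, h1]
  unfold freeSymbol at *
  nlinarith [sq_nonneg ‖z.fst‖, sq_nonneg ‖z.snd‖]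

theorem bessel_two (z : R6) : bessel 2 z = 1 + ‖z‖ ^ 2 := by
  unfold bessel
  norm_num

theorem bessel_one_sq_R6 (z : R6) : bessel 1 z ^ 2 = 1 + ‖z‖ ^ 2 := by
  rw [sq, bessel_add, one_add_one_eq_two, bessel_two]

theorem continuous_freeSymbol_add (lam : ℝ) : Continuous fun z => freeSymbol z + lam :=
  continuous_freeSymbol.add continuous_const

theorem inSobolev_two_iff (hlam : 0 < lam) (w : L2 R6) :
    InSobolev 2 w ↔ MemLp (fun z => ((freeSymbol z + lam : ℝ) : ℂ) * ft w z) 2 volume := by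
  rw [inSobolev_iff zero_le_two]
  constructor
  · intro h
    refine memLp_mul_of_le (Lp.memLp (ft w)).1
      (continuous_freeSymbol_add lam).aestronglyMeasurable (C := 1 + lam) (fun z => ?_) h
    rw [abs_of_pos (freeSymbol_add_pos hlam z), abs_of_pos (bessel_pos _ _), bessel_two]
    exact freeSymbol_add_le hlam z
  · intro h
    refine memLp_mul_of_le (Lp.memLp (ft w)).1
      (continuous_bessel 2).aestronglyMeasurable (C := 4 / 3 + 1 / lam) (fun z => ?_) h
    rw [abs_of_pos (freeSymbol_add_pos hlam z), abs_of_pos (bessel_pos _ _), bessel_two]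
    exact one_add_norm_sq_le hlam z

theorem ft_freeResolvent_ae (hlam : 0 < lam) (f : L2 R6) :
    ft (freeResolvent hlam f) =ᵐ[volume] fun z => ft f z / ((freeSymbol z + lam : ℝ) : ℂ) := by
  rw [freeResolvent, LinearIsometryEquiv.apply_symm_apply]
  exact MemLp.coeFn_toLp _

theorem freeSymbol_add_ne (hlam : 0 < lam) (z : R6) : ((freeSymbol z + lam : ℝ) : ℂ) ≠ 0 :=
  Complex.ofReal_ne_zero.2 (freeSymbol_add_pos hlam z).ne'

theorem mul_ft_freeResolvent_ae (hlam : 0 < lam) (f : L2 R6) :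
    (fun z => ((freeSymbol z + lam : ℝ) : ℂ) * ft (freeResolvent hlam f) z) =ᵐ[volume] ft f := by
  filter_upwards [ft_freeResolvent_ae hlam f] with z hz
  rw [hz, mul_div_cancel₀ _ (freeSymbol_add_ne hlam z)]

theorem inSobolev_two_freeResolvent (hlam : 0 < lam) (f : L2 R6) :
    InSobolev 2 (freeResolvent hlam f) := by
  rw [inSobolev_two_iff hlam]
  exact (memLp_congr_ae (mul_ft_freeResolvent_ae hlam f)).2 (Lp.memLp _)

theorem inSobolev_one_freeResolvent (hlam : 0 < lam) (f : L2 R6) :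
    InSobolev 1 (freeResolvent hlam f) :=
  (inSobolev_two_freeResolvent hlam f).mono zero_le_one one_le_two

theorem freeResolvent_injective (hlam : 0 < lam) : Function.Injective (freeResolvent hlam) := by
  intro f g h
  apply ft.injective
  have h1 := mul_ft_freeResolvent_ae hlam f
  rw [h] at h1
  exact Lp.ext (h1.symm.trans (mul_ft_freeResolvent_ae hlam g))

/-- The free symbol is invariant under both symmetries and never vanishes after adding λ, so
division by it neither creates nor destroys symmetry. -/
theorem freeResolvent_mem_L2sym_iff (hlam : 0 < lam) {g : L2 R6} :
    freeResolvent hlam g ∈ L2sym ↔ g ∈ L2sym := by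
  have h := ft_freeResolvent_ae hlam g
  rw [mem_L2sym_iff, mem_L2sym_iff]
  have key : ∀ {S : L2 R6 →ₗᵢ[ℂ] L2 R6} {T : R6 → R6}
      (_ : ∀ u : L2 R6, S u =ᵐ[volume] fun z => u (T z))
      (_ : ∀ {P : R6 → Prop}, (∀ᵐ z, P z) → ∀ᵐ z, P (T z))
      (_ : ∀ z, freeSymbol (T z) = freeSymbol z),
      S (ft (freeResolvent hlam g)) = ft (freeResolvent hlam g) ↔ S (ft g) = ft g := by
    intro S T hS hT ha
    constructor
    · intro hR
      have h1 := hS (ft (freeResolvent hlam g))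
      rw [hR] at h1
      refine Lp.ext ?_
      filter_upwards [hS (ft g), h1, h, hT h] with z a b c d
      rw [c, d, ha, div_left_inj' (freeSymbol_add_ne hlam z)] at b
      rw [a, b]
    · intro hR
      have h1 := hS (ft g)
      rw [hR] at h1
      refine Lp.ext ?_
      filter_upwards [hS (ft (freeResolvent hlam g)), h1, h, hT h] with z a b c d
      rw [a, d, c, ha, b]
  rw [key coeFn_reflectionOp ae_reflection freeSymbol_reflection,
    key coeFn_exchangeOp ae_momentumExchange freeSymbol_momentumExchange]

theorem exists_freeResolvent_eq (hlam : 0 < lam) {w : L2 R6} (hw : InSobolev 2 w) :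
    ∃ g, w = freeResolvent hlam g := by
  rw [inSobolev_two_iff hlam] at hw
  refine ⟨ft.symm hw.toLp, ft.injective (Lp.ext ?_)⟩
  have h := ft_freeResolvent_ae hlam (ft.symm hw.toLp)
  rw [LinearIsometryEquiv.apply_symm_apply] at h
  filter_upwards [h, MemLp.coeFn_toLp hw] with z h1 h2
  rw [h1, h2, mul_div_cancel_left₀ _ (freeSymbol_add_ne hlam z)]

/-- `H₀ R₀ g = g - λ R₀ g`. -/
theorem H0_freeResolvent (hlam : 0 < lam) (g : L2 R6) :
    ∃ hw : freeResolvent hlam g ∈ H0.domain,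
      H0 ⟨freeResolvent hlam g, hw⟩ = g - (lam : ℂ) • freeResolvent hlam g := by
  have hm : freeResolvent hlam g ∈ freeDomain := by
    change MemLp _ 2 volume
    refine (memLp_congr_ae ?_).1 ((Lp.memLp (ft g)).sub
      ((Lp.memLp (ft (freeResolvent hlam g))).const_mul (lam : ℂ)))
    filter_upwards [mul_ft_freeResolvent_ae hlam g] with z hz
    rw [Pi.sub_apply, ← hz]
    push_cast
    ring
  refine ⟨hm, ?_⟩
  change ft.symm (freeMul ⟨freeResolvent hlam g, hm⟩) = _
  rw [LinearIsometryEquiv.symm_apply_eq]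
  refine Lp.ext ?_
  rw [map_sub, map_smul]
  filter_upwards [MemLp.coeFn_toLp (memLp_of_mem_freeDomain hm), mul_ft_freeResolvent_ae hlam g,
    Lp.coeFn_sub (ft g) ((lam : ℂ) • ft (freeResolvent hlam g)),
    Lp.coeFn_smul (lam : ℂ) (ft (freeResolvent hlam g))] with z h1 h2 h3 h4
  rw [h3, Pi.sub_apply, h4, Pi.smul_apply, smul_eq_mul, ← h2]
  refine h1.trans ?_
  push_cast
  ring

/-! ### The form of the free Hamiltonian -/

theorem freeForm_conj (lam : ℝ) (v w : L2 R6) : freeForm lam v w = conj (freeForm lam w v) := by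
  rw [freeForm, freeForm, ← integral_conj]
  congr 1
  ext z
  simp only [map_mul, Complex.conj_conj, Complex.conj_ofReal]
  ring

theorem freeForm_freeResolvent (hlam : 0 < lam) (v g : L2 R6) :
    freeForm lam v (freeResolvent hlam g) = inner ℂ v g := by
  rw [← inner_ft, inner_eq_integral, freeForm]
  refine integral_congr_ae ?_
  filter_upwards [mul_ft_freeResolvent_ae hlam g] with z hz
  rw [← hz]
  ring

theorem integrable_conj_mul {X : Type} [MeasurableSpace X] {μ : Measure X} {f g : X → ℂ}
    (hf : MemLp f 2 μ) (hg : MemLp g 2 μ) : Integrable (fun x => conj (f x) * g x) μ := by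
  have h : MemLp (fun x => conj (f x)) 2 μ :=
    hf.of_le (Complex.continuous_conj.comp_aestronglyMeasurable hf.1)
      (Eventually.of_forall fun x => by rw [RCLike.norm_conj])
  exact MemLp.integrable_mul h hg

theorem integrable_freeForm (hlam : 0 < lam) {v w : L2 R6} (hv : InSobolev 1 v)
    (hw : InSobolev 1 w) :
    Integrable fun z => ((freeSymbol z + lam : ℝ) : ℂ) * (conj (ft v z) * ft w z) := by
  have key : ∀ {u : L2 R6}, InSobolev 1 u →
      MemLp (fun z => ((√(freeSymbol z + lam) : ℝ) : ℂ) * ft u z) 2 volume := by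
    intro u hu
    rw [inSobolev_iff zero_le_one] at hu
    refine memLp_mul_of_le (Lp.memLp (ft u)).1
      (continuous_freeSymbol_add lam).sqrt.aestronglyMeasurable (C := 1 + lam) (fun z => ?_) hu
    rw [abs_of_nonneg (Real.sqrt_nonneg _), abs_of_pos (bessel_pos _ _), Real.sqrt_le_left
      (mul_nonneg (by linarith) (bessel_pos _ _).le), mul_pow, bessel_one_sq_R6]
    refine (freeSymbol_add_le hlam z).trans ?_
    gcongr
    nlinarith
  refine (integrable_conj_mul (key hv) (key hw)).congr (Eventually.of_forall fun z => ?_)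
  simp only [map_mul, Complex.conj_ofReal]
  have h : ((√(freeSymbol z + lam) : ℝ) : ℂ) * ((√(freeSymbol z + lam) : ℝ) : ℂ) =
      ((freeSymbol z + lam : ℝ) : ℂ) := by
    rw [← Complex.ofReal_mul, Real.mul_self_sqrt (freeSymbol_add_pos hlam z).le]
  rw [← h]
  ring

theorem freeForm_add_right (hlam : 0 < lam) {v w w' : L2 R6} (hv : InSobolev 1 v)
    (hw : InSobolev 1 w) (hw' : InSobolev 1 w') :
    freeForm lam v (w + w') = freeForm lam v w + freeForm lam v w' := by
  rw [freeForm, freeForm, freeForm,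
    ← integral_add (integrable_freeForm hlam hv hw) (integrable_freeForm hlam hv hw')]
  refine integral_congr_ae ?_
  filter_upwards [ft_add_ae w w'] with z hz
  rw [hz]
  ring

theorem freeForm_smul_right (lam : ℝ) (a : ℂ) (v w : L2 R6) :
    freeForm lam v (a • w) = a * freeForm lam v w := by
  rw [freeForm, freeForm, ← integral_const_mul]
  refine integral_congr_ae ?_
  filter_upwards [ft_smul_ae a w] with z hz
  rw [hz]
  ring

theorem freeForm_add_left (hlam : 0 < lam) {v v' w : L2 R6} (hv : InSobolev 1 v)
    (hv' : InSobolev 1 v') (hw : InSobolev 1 w) :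
    freeForm lam (v + v') w = freeForm lam v w + freeForm lam v' w := by
  rw [freeForm_conj, freeForm_add_right hlam hw hv hv', map_add, ← freeForm_conj,
    ← freeForm_conj]

theorem freeForm_change (hlam : 0 < lam) (mu : ℝ) {v w : L2 R6} (hv : InSobolev 1 v)
    (hw : InSobolev 1 w) :
    freeForm mu v w = freeForm lam v w + ((mu - lam : ℝ) : ℂ) * inner ℂ v w := by
  have hi := integrable_conj_mul (Lp.memLp (ft v)) (Lp.memLp (ft w))
  rw [← inner_ft, inner_eq_integral, freeForm, freeForm, ← integral_const_mul,
    ← integral_add (integrable_freeForm hlam hv hw) (hi.const_mul _)]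
  congr 1
  ext z
  push_cast
  ring

theorem freeForm_self_ge (hlam : 0 < lam) {w : L2 R6} (hw : InSobolev 1 w) :
    lam * ‖w‖ ^ 2 ≤ (freeForm lam w w).re := by
  have h1 := integrable_freeForm hlam hw hw
  have e : ∀ z, ((freeSymbol z + lam : ℝ) : ℂ) * (conj (ft w z) * ft w z) =
      (((freeSymbol z + lam) * ‖ft w z‖ ^ 2 : ℝ) : ℂ) := by
    intro z
    rw [Complex.conj_mul']
    push_cast
    ring
  have iN : Integrable fun p => ‖ft w p‖ ^ 2 :=
    (memLp_two_iff_integrable_sq_norm (Lp.memLp (ft w)).1).1 (Lp.memLp _)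
  rw [freeForm]
  simp_rw [e] at h1 ⊢
  rw [integral_complex_ofReal, Complex.ofReal_re, ← (ft : L2 R6 ≃ₗᵢ[ℂ] L2 R6).norm_map w,
    norm_sq_eq_integral, ← integral_const_mul]
  refine integral_mono (iN.const_mul _)
    (by simpa only [RCLike.re_to_complex, Complex.ofReal_re] using h1.re) fun z => ?_
  have := freeSymbol_nonneg z
  simp only
  gcongr
  linarith

/-! ### The adjoint of the single layer operator and the trace -/

theorem sq_lintegral_mul_le {X : Type} [MeasurableSpace X] {μ : Measure X} {f g : X → ℝ≥0∞}
    (hf : AEMeasurable f μ) (hg : AEMeasurable g μ) :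
    (∫⁻ x, f x * g x ∂μ) ^ 2 ≤ (∫⁻ x, f x ^ 2 ∂μ) * ∫⁻ x, g x ^ 2 ∂μ := by
  have h := ENNReal.lintegral_mul_le_Lp_mul_Lq μ Real.HolderConjugate.two_two hf hg
  have h2 := pow_le_pow_left' h 2
  simp only [Pi.mul_apply, ENNReal.rpow_ofNat] at h2
  refine h2.trans (le_of_eq ?_)
  rw [mul_pow, ← ENNReal.rpow_natCast, ← ENNReal.rpow_natCast, ← ENNReal.rpow_mul,
    ← ENNReal.rpow_mul]
  norm_num

/-- The restriction of the resolvent to the plane `x = 0`, in momentum space and up to a factor. -/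
def traceFun (lam : ℝ) (g : L2 R6) (p : R3) : ℂ :=
  ∫ k : R3, ft g (WithLp.toLp 2 (k, p)) / ((freeSymbol (WithLp.toLp 2 (k, p)) + lam : ℝ) : ℂ)

/-- Cauchy–Schwarz in k at fixed p: (k² + λ)⁻¹ is square integrable in three dimensions, uniformly
in p. -/
theorem memLp_traceFun (hlam : 0 < lam) (g : L2 R6) : MemLp (traceFun lam g) 2 volume := by
  have hm : AEStronglyMeasurable (fun w : R3 × R3 => ft g (WithLp.toLp 2 w)) volume :=
    (Lp.memLp (ft g)).1.comp_measurePreserving measurePreserving_toLp_R6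
  have hm2 : AEStronglyMeasurable (fun w : R3 × R3 => ft g (WithLp.toLp 2 w) /
      ((freeSymbol (WithLp.toLp 2 w) + lam : ℝ) : ℂ)) volume :=
    ((memLp_freeResolvent hlam (Lp.memLp (ft g))).1).comp_measurePreserving
      measurePreserving_toLp_R6
  have hT : AEStronglyMeasurable (traceFun lam g) volume := by
    have h1 : AEStronglyMeasurable (fun w : R3 × R3 => ft g (WithLp.toLp 2 w.swap) /
        ((freeSymbol (WithLp.toLp 2 w.swap) + lam : ℝ) : ℂ)) (volume.prod volume) :=
      hm2.comp_measurePreserving Measure.measurePreserving_swap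
    exact h1.integral_prod_right'
  rw [memLp_two_iff_lintegral hT]
  have hC : ∫⁻ k : R3, ENNReal.ofReal ((‖k‖ ^ 2 + lam)⁻¹) ^ 2 ≠ ∞ := by
    have h1 := (integrable_inv_sq hlam).2
    rw [hasFiniteIntegral_iff_ofReal (Eventually.of_forall fun k => by positivity)] at h1
    refine ne_of_lt (lt_of_le_of_lt (le_of_eq ?_) h1)
    refine lintegral_congr fun k => ?_
    rw [ENNReal.ofReal_pow (by positivity)]
  have hslice : ∀ᵐ p : R3, AEStronglyMeasurable (fun k : R3 => ft g (WithLp.toLp 2 (k, p)))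
      volume := by
    have h1 : AEStronglyMeasurable (fun w : R3 × R3 => ft g (WithLp.toLp 2 w.swap))
        (volume.prod volume) := hm.comp_measurePreserving Measure.measurePreserving_swap
    exact h1.prodMk_left
  have hle : ∀ᵐ p : R3, ‖traceFun lam g p‖ₑ ^ 2 ≤
      (∫⁻ k : R3, ENNReal.ofReal ((‖k‖ ^ 2 + lam)⁻¹) ^ 2) *
        ∫⁻ k : R3, ‖ft g (WithLp.toLp 2 (k, p))‖ₑ ^ 2 := by
    filter_upwards [hslice] with p hp
    refine le_trans ?_ (sq_lintegral_mul_le (by fun_prop) hp.enorm)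
    refine pow_le_pow_left' ((enorm_integral_le_lintegral_enorm _).trans
      (lintegral_mono fun k => ?_)) 2
    have ha := freeSymbol_add_pos hlam (WithLp.toLp 2 (k, p))
    have e : ft g (WithLp.toLp 2 (k, p)) / ((freeSymbol (WithLp.toLp 2 (k, p)) + lam : ℝ) : ℂ) =
        (((freeSymbol (WithLp.toLp 2 (k, p)) + lam)⁻¹ : ℝ) : ℂ) * ft g (WithLp.toLp 2 (k, p)) := by
      push_cast
      ring
    rw [e, enorm_mul, ← ofReal_norm ((_ : ℝ) : ℂ), Complex.norm_real,
      Real.norm_of_nonneg (inv_nonneg.2 ha.le)]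
    gcongr
    change ‖k‖ ^ 2 ≤ ‖k‖ ^ 2 + 3 / 4 * ‖p‖ ^ 2
    nlinarith [sq_nonneg ‖p‖]
  refine (lintegral_mono_ae hle).trans_lt ?_
  rw [lintegral_const_mul' _ _ hC]
  refine ENNReal.mul_lt_top (lt_top_iff_ne_top.2 hC) ?_
  have h2 : ∫⁻ p : R3, ∫⁻ k : R3, ‖ft g (WithLp.toLp 2 (k, p))‖ₑ ^ 2 =
      ENNReal.ofReal (‖ft g‖ ^ 2) := by
    rw [← lintegral_enorm_sq, lintegral_R6, Measure.volume_eq_prod, lintegral_prod_symm]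
    exact hm.enorm.pow_const 2
  rw [h2]
  exact ENNReal.ofReal_lt_top

theorem ft_adjoint_G23_ae (hlam : 0 < lam) (g : L2 R6) :
    ft ((G23 hlam).adjoint g) =ᵐ[volume] fun p => (√(2 / Real.pi) : ℂ) * traceFun lam g p := by
  have hT := (memLp_traceFun hlam g).const_mul (√(2 / Real.pi) : ℂ)
  have h : (G23 hlam).adjoint g = ft.symm hT.toLp := by
    refine ext_inner_left ℂ fun η => ?_
    rw [ContinuousLinearMap.adjoint_inner_right, ← inner_ft, ← inner_ft η,
      LinearIsometryEquiv.apply_symm_apply, inner_eq_integral, inner_eq_integral]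
    have e1 : ∫ z, conj (ft (G23 hlam η) z) * ft g z =
        ∫ z : R6, conj (layer lam (ft η) z) * ft g z := by
      refine integral_congr_ae ?_
      filter_upwards [ft_G23_ae hlam η] with z hz
      rw [hz]
    have hi := integrable_conj_mul (memLp_layer hlam (Lp.memLp (ft η))) (Lp.memLp (ft g))
    rw [e1, integral_R6, Measure.volume_eq_prod, integral_prod_symm _ (integrable_R6 hi)]
    refine integral_congr_ae ?_
    filter_upwards [MemLp.coeFn_toLp hT] with p hp
    rw [hp, traceFun, ← integral_const_mul, ← integral_const_mul]
    congr 1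
    ext k
    have hsnd : (WithLp.toLp 2 (k, p) : R6).snd = p := rfl
    simp only [layer, map_div₀, map_mul, Complex.conj_ofReal, hsnd]
    ring
  rw [h, LinearIsometryEquiv.apply_symm_apply]
  exact MemLp.coeFn_toLp hT

theorem trace_constant : 1 / (4 * Real.pi) * √(2 / Real.pi) = (2 * Real.pi) ^ (-(3 / 2) : ℝ) := by
  have hpi := Real.pi_pos
  have h1 : (2 * Real.pi) ^ (-(3 / 2) : ℝ) = (2 * Real.pi) ^ (-2 : ℝ) * √(2 * Real.pi) := by
    rw [Real.sqrt_eq_rpow, ← Real.rpow_add (by positivity)]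
    norm_num
  have h2 : √(2 / Real.pi) = √(2 * Real.pi) / Real.pi := by
    rw [eq_div_iff hpi.ne', ← Real.sqrt_sq hpi.le, ← Real.sqrt_mul (by positivity),
      Real.sqrt_sq hpi.le]
    congr 1
    field_simp
  rw [h1, h2, Real.rpow_neg (by positivity)]
  norm_num
  field_simp
  norm_num

/-- Both the trace of the free resolvent and G* g integrate ĝ/(k² + 3p²/4 + λ) over k; they differ
only by the constants (2π)^{-3/2} and √(2/π). Their ratio is the 1/(4π) of the resolvent formula. -/
theorem isTrace23_freeResolvent_iff (hlam : 0 < lam) (g : L2 R6) (τ : L2 R3) :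
    IsTrace23 (freeResolvent hlam g) τ ↔
      τ = (1 / (4 * (Real.pi : ℂ))) • (G23 hlam).adjoint g := by
  have hslice : ∀ᵐ p : R3, ∫ k : R3, ft (freeResolvent hlam g) (WithLp.toLp 2 (k, p)) =
      traceFun lam g p := by
    have h1 : ∀ᵐ w : R3 × R3, ft (freeResolvent hlam g) (WithLp.toLp 2 w.swap) =
        ft g (WithLp.toLp 2 w.swap) / ((freeSymbol (WithLp.toLp 2 w.swap) + lam : ℝ) : ℂ) :=
      Measure.measurePreserving_swap.quasiMeasurePreserving.ae
        (measurePreserving_toLp_R6.quasiMeasurePreserving.ae (ft_freeResolvent_ae hlam g))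
    filter_upwards [Measure.ae_ae_of_ae_prod h1] with p hp
    exact integral_congr_ae hp
  have hconst : (1 / (4 * (Real.pi : ℂ))) * (√(2 / Real.pi) : ℂ) =
      (((2 * Real.pi) ^ (-(3 / 2) : ℝ) : ℝ) : ℂ) := by
    rw [← trace_constant]
    push_cast
    ring
  have hR : ∀ᵐ p, ft ((1 / (4 * (Real.pi : ℂ))) • (G23 hlam).adjoint g) p =
      (((2 * Real.pi) ^ (-(3 / 2) : ℝ) : ℝ) : ℂ) *
        ∫ k : R3, ft (freeResolvent hlam g) (WithLp.toLp 2 (k, p)) := by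
    filter_upwards [hslice, ft_smul_ae (1 / (4 * (Real.pi : ℂ))) ((G23 hlam).adjoint g),
      ft_adjoint_G23_ae hlam g] with p h1 h2 h3
    rw [h1, h2, h3, ← hconst]
    ring
  constructor
  · intro h
    apply ft.injective
    refine Lp.ext ?_
    filter_upwards [h, hR] with p h1 h2
    rw [h1, h2]
  · rintro rfl
    exact hR

end FreeResolvent
-- Independence of the spectral parameter
section ChangeOfParameter

open Set Filter Topology

variable {β γ : ℝ} {θ : ℝ → ℝ} {lam mu : ℝ}

/-- The resolvent identity. The difference is in H², so a change of λ alters the regular part of a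
vector but not its charge. -/
theorem potential_sub_potential (hlam : 0 < lam) (hmu : 0 < mu) (ξ : L2 R3) :
    potential hlam ξ - potential hmu ξ =
      ((mu - lam : ℝ) : ℂ) • freeResolvent hmu (potential hlam ξ) := by
  apply ft.injective
  refine Lp.ext ?_
  rw [map_sub, map_smul]
  filter_upwards [ft_potential_ae hlam ξ, ft_potential_ae hmu ξ,
    ft_freeResolvent_ae hmu (potential hlam ξ),
    Lp.coeFn_sub (ft (potential hlam ξ)) (ft (potential hmu ξ)),
    Lp.coeFn_smul ((mu - lam : ℝ) : ℂ) (ft (freeResolvent hmu (potential hlam ξ)))]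
    with z h1 h2 h3 h4 h5
  rw [h4, Pi.sub_apply, h5, Pi.smul_apply, smul_eq_mul, h3, h1, h2, potentialFun, potentialFun]
  have n1 := freeSymbol_add_ne hlam z
  have n2 := freeSymbol_add_ne hmu z
  have e : ((mu - lam : ℝ) : ℂ) = ((freeSymbol z + mu : ℝ) : ℂ) - ((freeSymbol z + lam : ℝ) : ℂ) := by
    push_cast
    ring
  rw [e]
  field_simp

theorem conj_layer_mul_layer (lam mu : ℝ) (u v : R3 → ℂ) (z z' : R6)
    (h : freeSymbol z' = freeSymbol z) :
    conj (layer lam u z) * layer mu v z' = (2 / Real.pi : ℂ) * (conj (u z.snd) * v z'.snd *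
      ((1 / ((freeSymbol z + lam) * (freeSymbol z + mu)) : ℝ) : ℂ)) := by
  have hs : (√(2 / Real.pi) : ℂ) * (√(2 / Real.pi) : ℂ) = 2 / Real.pi := by
    rw [← Complex.ofReal_mul, Real.mul_self_sqrt (by positivity)]
    push_cast
    rfl
  rw [← hs]
  simp only [layer, map_div₀, map_mul, Complex.conj_ofReal, h]
  push_cast
  rw [one_div, mul_inv]
  ring

/-- The diagonal term: a layer against the layer on the same plane. -/
theorem kineticForm_sub (hlam : 0 < lam) (hmu : 0 < mu) (hne : lam ≠ mu) {η ξ : L2 R3}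
    (hη : InSobolev (1 / 2) η) (hξ : InSobolev (1 / 2) ξ) :
    ((mu - lam : ℝ) : ℂ) * inner ℂ (ft (G23 hlam η)) (ft (G23 hmu ξ)) =
      4 * Real.pi * (kineticForm mu η ξ - kineticForm lam η ξ) := by
  have hi := integrable_conj_mul (memLp_layer hlam (Lp.memLp (ft η)))
    (memLp_layer hmu (Lp.memLp (ft ξ)))
  have e1 : inner ℂ (ft (G23 hlam η)) (ft (G23 hmu ξ)) =
      ∫ z : R6, conj (layer lam (ft η) z) * layer mu (ft ξ) z := by
    rw [inner_eq_integral]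
    refine integral_congr_ae ?_
    filter_upwards [ft_G23_ae hlam η, ft_G23_ae hmu ξ] with z h1 h2
    rw [h1, h2]
  rw [e1, integral_R6, Measure.volume_eq_prod, integral_prod_symm _ (integrable_R6 hi),
    kineticForm, kineticForm,
    ← integral_sub (integrable_kineticForm hmu hη hξ) (integrable_kineticForm hlam hη hξ),
    ← integral_const_mul, ← integral_const_mul]
  congr 1
  ext p
  set a := √(3 / 4 * ‖p‖ ^ 2 + lam) with ha
  set b := √(3 / 4 * ‖p‖ ^ 2 + mu) with hb
  have ha0 : 0 < a := Real.sqrt_pos.2 (by positivity)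
  have hb0 : 0 < b := Real.sqrt_pos.2 (by positivity)
  have ha2 : a ^ 2 = 3 / 4 * ‖p‖ ^ 2 + lam := Real.sq_sqrt (by positivity)
  have hb2 : b ^ 2 = 3 / 4 * ‖p‖ ^ 2 + mu := Real.sq_sqrt (by positivity)
  have hab : a ≠ b := fun h => hne (by rw [h] at ha2; linarith)
  have e2 : ∀ k : R3, conj (layer lam (ft η) (WithLp.toLp 2 (k, p))) *
      layer mu (ft ξ) (WithLp.toLp 2 (k, p)) =
      (2 / Real.pi : ℂ) * (conj (ft η p) * ft ξ p) *
        ((1 / ((‖k‖ ^ 2 + a ^ 2) * (‖k‖ ^ 2 + b ^ 2)) : ℝ) : ℂ) := by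
    intro k
    have hk : freeSymbol (WithLp.toLp 2 (k, p)) = ‖k‖ ^ 2 + 3 / 4 * ‖p‖ ^ 2 := rfl
    have hp : (WithLp.toLp 2 (k, p) : R6).snd = p := rfl
    rw [conj_layer_mul_layer _ _ _ _ _ _ rfl, ha2, hb2, ← add_assoc, ← add_assoc, hk, hp]
    ring
  simp_rw [e2]
  rw [integral_const_mul, integral_complex_ofReal, (integral_inv_mul_inv ha0 hb0 hab).2]
  -- The k-integral is 2π²/(a + b), and μ - λ = b² - a² cancels the denominator, leaving the
  -- difference b - a of the symbols.
  have e3 : mu - lam = (b - a) * (a + b) := by linarith [hb2, ha2]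
  have hab0 : (a : ℂ) + (b : ℂ) ≠ 0 := by
    rw [← Complex.ofReal_add, Complex.ofReal_ne_zero]
    positivity
  have hpi : (Real.pi : ℂ) ≠ 0 := Complex.ofReal_ne_zero.2 Real.pi_ne_zero
  rw [e3]
  push_cast
  field_simp
  ring

/-- The off-diagonal term: a layer against the layer on a different plane. -/
theorem exchangeForm_sub (hlam : 0 < lam) (hmu : 0 < mu) {η ξ : L2 R3}
    (hη : InSobolev (1 / 2) η) (hξ : InSobolev (1 / 2) ξ) :
    ((mu - lam : ℝ) : ℂ) * inner ℂ (ft (G23 hlam η)) (exchangeOp (ft (G23 hmu ξ))) =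
      2 / Real.pi * (exchangeForm lam η ξ - exchangeForm mu η ξ) := by
  have hi := integrable_conj_mul (memLp_layer hlam (Lp.memLp (ft η)))
    ((memLp_layer hmu (Lp.memLp (ft ξ))).comp_measurePreserving measurePreserving_momentumExchange)
  have e1 : inner ℂ (ft (G23 hlam η)) (exchangeOp (ft (G23 hmu ξ))) =
      ∫ z : R6, conj (layer lam (ft η) z) * (layer mu (ft ξ) ∘ momentumExchange) z := by
    rw [inner_eq_integral]
    refine integral_congr_ae ?_
    filter_upwards [ft_G23_ae hlam η, coeFn_exchangeOp (ft (G23 hmu ξ)),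
      ae_momentumExchange (ft_G23_ae hmu ξ)] with z h1 h2 h3
    rw [h1, h2, h3, Function.comp_apply]
  have hx : Integrable (fun w : R3 × R3 =>
      conj (ft η w.1) * (((1 / (pairForm w.1 w.2 + lam) : ℝ) : ℂ) * ft ξ w.2) -
        conj (ft η w.1) * (((1 / (pairForm w.1 w.2 + mu) : ℝ) : ℂ) * ft ξ w.2)) volume :=
    (integrable_exchangeForm hlam hη hξ).sub (integrable_exchangeForm hmu hη hξ)
  rw [e1, integral_R6, Measure.volume_eq_prod, integral_prod_symm _ (integrable_R6 hi),
    exchangeForm, exchangeForm,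
    ← integral_sub (integrable_exchangeForm hlam hη hξ) (integrable_exchangeForm hmu hη hξ),
    Measure.volume_eq_prod, integral_prod _ hx, ← integral_const_mul, ← integral_const_mul]
  congr 1
  ext p
  -- The shift k = q + p/2 turns k² + 3p²/4 into Q(p, q), and the exchanged charge is evaluated at k
  -- - p/2 = q.
  rw [← integral_add_right_eq_self _ ((1 / 2 : ℝ) • p), ← integral_const_mul,
    ← integral_const_mul]
  congr 1
  ext q
  have hQ : freeSymbol (WithLp.toLp 2 (q + (1 / 2 : ℝ) • p, p)) = pairForm p q := by
    change ‖q + (1 / 2 : ℝ) • p‖ ^ 2 + 3 / 4 * ‖p‖ ^ 2 = _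
    rw [norm_add_smul_sq, pairForm]
    ring
  have hq : (momentumExchange (WithLp.toLp 2 (q + (1 / 2 : ℝ) • p, p))).snd = q := by
    change q + (1 / 2 : ℝ) • p - (1 / 2 : ℝ) • p = q
    abel
  have hp : (WithLp.toLp 2 (q + (1 / 2 : ℝ) • p, p) : R6).snd = p := rfl
  rw [Function.comp_apply, conj_layer_mul_layer _ _ _ _ _ _ (freeSymbol_momentumExchange _), hq,
    hp, hQ]
  have hQ0 := pairForm_nonneg p q
  have e2 : (mu - lam) * (1 / ((pairForm p q + lam) * (pairForm p q + mu))) =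
      1 / (pairForm p q + lam) - 1 / (pairForm p q + mu) := by
    field_simp
    ring
  have e3 := congrArg (fun x : ℝ => (x : ℂ)) e2
  simp only [Complex.ofReal_mul, Complex.ofReal_sub] at e3
  rw [Complex.ofReal_sub]
  linear_combination (2 / Real.pi : ℂ) * conj (ft η p) * ft ξ q * e3

theorem reflectionOp_ft_G23 (hlam : 0 < lam) (ξ : L2 R3) :
    reflectionOp (ft (G23 hlam ξ)) = ft (G23 hlam ξ) := by
  refine Lp.ext ?_
  filter_upwards [coeFn_reflectionOp (ft (G23 hlam ξ)), ft_G23_ae hlam ξ,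
    ae_reflection (ft_G23_ae hlam ξ)] with z h1 h2 h3
  rw [h1, h2, h3, layer, layer, freeSymbol_reflection]
  rfl

/-- By symmetry the overlap of two potentials is three times that of one layer with all three: one
diagonal term, worth 4π times the change of the kinetic form, and two equal off-diagonal ones, each
worth -2/π times the change of the exchange form. The three-body term does not depend on λ. -/
theorem PhiForm_sub_PhiForm (hlam : 0 < lam) (hmu : 0 < mu)
    {η ξ : L2 R3} (hη : InSobolev (1 / 2) η) (hξ : InSobolev (1 / 2) ξ) :
    12 * (Real.pi : ℂ) * (PhiForm β γ θ mu η ξ - PhiForm β γ θ lam η ξ) =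
      ((mu - lam : ℝ) : ℂ) * inner ℂ (potential hlam η) (potential hmu ξ) := by
  rcases eq_or_ne lam mu with rfl | hne
  · simp
  have hpi : (Real.pi : ℂ) ≠ 0 := Complex.ofReal_ne_zero.2 Real.pi_ne_zero
  rw [inner_potential hlam η (potential_mem_L2sym hmu ξ), ← inner_ft, ft_potential,
    inner_add_right, inner_add_right]
  have e : inner ℂ (ft (G23 hlam η)) (reflectionOp (exchangeOp (ft (G23 hmu ξ)))) =
      inner ℂ (ft (G23 hlam η)) (exchangeOp (ft (G23 hmu ξ))) := by
    nth_rw 1 [← reflectionOp_ft_G23 hlam η]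
    rw [LinearIsometry.inner_map_map]
  have h1 := kineticForm_sub hlam hmu hne hη hξ
  have h2 := exchangeForm_sub hlam hmu hη hξ
  have h3 : (Real.pi : ℂ) * (2 / Real.pi) = 2 := by field_simp
  have h4 : (Real.pi : ℂ) * (1 / Real.pi ^ 2) = 1 / Real.pi := by field_simp
  rw [e, PhiForm_eq hmu hη hξ, PhiForm_eq hlam hη hξ]
  linear_combination (-3) * h1 - 6 * h2 + 12 * (exchangeForm lam η ξ - exchangeForm mu η ξ) * h4

/-! ### The form of the Hamiltonian -/

theorem exists_isDecomposition_change (hlam : 0 < lam) (hmu : 0 < mu) {ψ w : L2 R6} {ξ : L2 R3}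
    (h : IsDecomposition hlam ψ w ξ) :
    IsDecomposition hmu ψ (w + ((mu - lam : ℝ) : ℂ) • freeResolvent hmu (potential hlam ξ)) ξ := by
  refine ⟨h.1.add zero_le_one ((inSobolev_one_freeResolvent hmu _).smul zero_le_one _), h.2.1, ?_⟩
  rw [← potential_sub_potential, h.2.2]
  abel

theorem formDomain_eq (hlam : 0 < lam) (hmu : 0 < mu) : formDomain hlam = formDomain hmu := by
  have key : ∀ {l m : ℝ} (hl : 0 < l) (hm : 0 < m), formDomain hl ⊆ formDomain hm :=
    fun hl hm ψ ⟨w, ξ, h⟩ => ⟨_, ξ, exists_isDecomposition_change hl hm h⟩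
  exact (key hlam hmu).antisymm (key hmu hlam)

theorem IsDecomposition.charge_eq (hlam : 0 < lam) {ψ : L2sym} {w : L2 R6} {ξ : L2 R3}
    (h : IsDecomposition hlam (ψ : L2 R6) w ξ) :
    charge hlam ψ = ξ ∧ regularPart hlam ψ = w := by
  have hw : (ψ : L2 R6) - potential hlam ξ = w := by rw [h.2.2, add_sub_cancel_right]
  have h1 : IsDecomposition hlam (ψ : L2 R6) (ψ - potential hlam (charge hlam ψ))
      (charge hlam ψ) :=
    Classical.epsilon_spec (p := fun ξ => IsDecomposition hlam (ψ : L2 R6)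
      (ψ - potential hlam ξ) ξ) ⟨ξ, by rwa [hw]⟩
  obtain ⟨h2, h3⟩ := h1.unique hlam h
  exact ⟨h3, h2⟩

theorem energyForm_eq (hlam : 0 < lam) {v ψ : L2sym} {w w' : L2 R6} {ξ ξ' : L2 R3}
    (hv : IsDecomposition hlam (v : L2 R6) w ξ) (hψ : IsDecomposition hlam (ψ : L2 R6) w' ξ') :
    energyForm β γ θ hlam v ψ = freeForm lam w w' - (lam : ℂ) * inner ℂ v ψ +
      12 * (Real.pi : ℂ) * PhiForm β γ θ lam ξ ξ' := by
  obtain ⟨h1, h2⟩ := hv.charge_eq hlam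
  obtain ⟨h3, h4⟩ := hψ.charge_eq hlam
  rw [energyForm, h1, h2, h3, h4]

/-- The form of the Hamiltonian does not depend on the parameter. -/
theorem energyForm_change (hlam : 0 < lam) (hmu : 0 < mu) {v ψ : L2sym}
    (hv : v ∈ formDomain hlam) (hψ : ψ ∈ formDomain hlam) :
    energyForm β γ θ hmu v ψ = energyForm β γ θ hlam v ψ := by
  obtain ⟨w, ξ, h⟩ := hv
  obtain ⟨w', ξ', h'⟩ := hψ
  set c : ℂ := ((mu - lam : ℝ) : ℂ) with hc
  set D := freeResolvent hmu (potential hlam ξ) with hD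
  set D' := freeResolvent hmu (potential hlam ξ') with hD'
  have hm : IsDecomposition hmu (v : L2 R6) (w + c • D) ξ := exists_isDecomposition_change hlam hmu h
  have hm' : IsDecomposition hmu (ψ : L2 R6) (w' + c • D') ξ' :=
    exists_isDecomposition_change hlam hmu h'
  have sD : InSobolev 1 (c • D) := (inSobolev_one_freeResolvent hmu _).smul zero_le_one _
  have sD' : InSobolev 1 (c • D') := (inSobolev_one_freeResolvent hmu _).smul zero_le_one _
  have hcc : conj c = c := Complex.conj_ofReal _
  have f1 : freeForm mu w (c • D') = c * inner ℂ w (potential hlam ξ') := by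
    rw [freeForm_smul_right, freeForm_freeResolvent]
  have f2 : freeForm mu (c • D) (w' + c • D') =
      c * inner ℂ (potential hlam ξ) (w' + c • D') := by
    rw [freeForm_conj, freeForm_smul_right, freeForm_freeResolvent, map_mul, hcc,
      inner_conj_symm]
  have f3 : freeForm mu (w + c • D) (w' + c • D') = freeForm lam w w' + c * inner ℂ w w' +
      c * inner ℂ w (potential hlam ξ') + c * inner ℂ (potential hlam ξ) (w' + c • D') := by
    rw [freeForm_add_left hmu h.1 sD hm'.1, freeForm_add_right hmu h.1 h'.1 sD', f1, f2,
      freeForm_change hlam mu h.1 h'.1]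
  -- The second vector is decomposed with λ when paired with w and with μ when paired with the
  -- potential, so that the mixed overlap of potentials in `PhiForm_sub_PhiForm` appears.
  have i1 : inner ℂ v ψ = inner ℂ w w' + inner ℂ w (potential hlam ξ') +
      inner ℂ (potential hlam ξ) (w' + c • D') +
      inner ℂ (potential hlam ξ) (potential hmu ξ') := by
    have e1 : (inner ℂ v ψ : ℂ) = inner ℂ (v : L2 R6) (ψ : L2 R6) := rfl
    have e2 : (inner ℂ (v : L2 R6) (ψ : L2 R6) : ℂ) =
        inner ℂ w (ψ : L2 R6) + inner ℂ (potential hlam ξ) (ψ : L2 R6) := by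
      nth_rw 1 [h.2.2]
      rw [inner_add_left]
    have e3 : (inner ℂ w (ψ : L2 R6) : ℂ) = inner ℂ w w' + inner ℂ w (potential hlam ξ') := by
      rw [h'.2.2, inner_add_right]
    have e4 : (inner ℂ (potential hlam ξ) (ψ : L2 R6) : ℂ) =
        inner ℂ (potential hlam ξ) (w' + c • D') +
          inner ℂ (potential hlam ξ) (potential hmu ξ') := by
      rw [hm'.2.2, inner_add_right]
    rw [e1, e2, e3, e4]
    ring
  have hΦ := PhiForm_sub_PhiForm (β := β) (γ := γ) (θ := θ) hlam hmu h.2.1 h'.2.1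
  have hcm : c = (mu : ℂ) - lam := by rw [hc, Complex.ofReal_sub]
  rw [← hc] at hΦ
  rw [energyForm_eq hmu hm hm', energyForm_eq hlam h h', f3]
  linear_combination hΦ - c * i1 + (inner ℂ v ψ : ℂ) * hcm

end ChangeOfParameter
-- The Hamiltonian, its resolvent and its domain
section Hamiltonian

variable {β γ : ℝ} {θ : ℝ → ℝ} {lam mu δ : ℝ}

theorem IsDecomposition.sub (hlam : 0 < lam) {ψ ψ' w w' : L2 R6} {ξ ξ' : L2 R3}
    (h : IsDecomposition hlam ψ w ξ) (h' : IsDecomposition hlam ψ' w' ξ') :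
    IsDecomposition hlam (ψ - ψ') (w - w') (ξ - ξ') := by
  refine ⟨h.1.sub zero_le_one h'.1, h.2.1.sub (by norm_num) h'.2.1, ?_⟩
  rw [potential_sub, h.2.2, h'.2.2]
  abel

theorem IsDecomposition.coe_sub (hlam : 0 < lam) {a b : L2sym} {w w' : L2 R6} {ξ ξ' : L2 R3}
    (h : IsDecomposition hlam (a : L2 R6) w ξ) (h' : IsDecomposition hlam (b : L2 R6) w' ξ') :
    IsDecomposition hlam ((a - b : L2sym) : L2 R6) (w - w') (ξ - ξ') := by
  rw [AddSubgroupClass.coe_sub]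
  exact IsDecomposition.sub hlam h h'

theorem freeForm_sub_right (hlam : 0 < lam) {v w w' : L2 R6} (hv : InSobolev 1 v)
    (hw : InSobolev 1 w) (hw' : InSobolev 1 w') :
    freeForm lam v (w - w') = freeForm lam v w - freeForm lam v w' := by
  have h : w - w' = w + (-1 : ℂ) • w' := by rw [neg_one_smul, sub_eq_add_neg]
  rw [h, freeForm_add_right hlam hv hw (hw'.smul zero_le_one _), freeForm_smul_right]
  ring

theorem IsDecomposition.inner_eq (hlam : 0 < lam) {v : L2sym} {w : L2 R6} {ξ : L2 R3}
    (h : IsDecomposition hlam (v : L2 R6) w ξ) (f : L2sym) :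
    (inner ℂ v f : ℂ) = inner ℂ w (f : L2 R6) + inner ℂ (potential hlam ξ) (f : L2 R6) := by
  rw [Submodule.coe_inner, h.2.2, inner_add_left]

/-- The resolvent of the Hamiltonian, given the inverse of the operator of the charges. -/
def resolventMap (hlam : 0 < lam) (Γinv : L2 R3 →L[ℂ] L2 R3) (f : L2sym) : L2sym :=
  ⟨freeResolvent hlam f + (1 / (4 * (Real.pi : ℂ))) •
      potential hlam (Γinv ((G23 hlam).adjoint (f : L2 R6))),
    L2sym.add_mem ((freeResolvent_mem_L2sym_iff hlam).2 f.2)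
      (L2sym.smul_mem _ (potential_mem_L2sym hlam _))⟩

theorem isDecomposition_resolventMap (hlam : 0 < lam) {Γinv : L2 R3 →L[ℂ] L2 R3}
    (hΓ : ∀ ζ, InSobolev (1 / 2) (Γinv ζ)) (f : L2sym) :
    IsDecomposition hlam (resolventMap hlam Γinv f : L2 R6) (freeResolvent hlam f)
      ((1 / (4 * (Real.pi : ℂ))) • Γinv ((G23 hlam).adjoint (f : L2 R6))) :=
  ⟨inSobolev_one_freeResolvent hlam _, (hΓ _).smul (by norm_num) _, by
    rw [potential_smul]
    rfl⟩

/-- The λ-terms cancel. The free form yields (w, f), and 12π Φ^λ yields 12π/(4π) (ξ, G* f) = 3 (Gξ,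
f), which is (𝒢ξ, f) since f is symmetric. -/
theorem energyForm_resolventMap (hlam : 0 < lam) {RΓ : L2 R3 → L2 R3}
    (hΓ : SolvableForm {ξ : L2 R3 | InSobolev (1 / 2) ξ} (PhiForm β γ θ lam) 0 δ RΓ) {v : L2sym}
    (hv : v ∈ formDomain hlam) (f : L2sym) :
    energyForm β γ θ hlam v (resolventMap hlam hΓ.solution f) +
      lam * inner ℂ v (resolventMap hlam hΓ.solution f) = inner ℂ v f := by
  obtain ⟨w, ξ, h⟩ := hv
  have hm : ∀ ζ, InSobolev (1 / 2) (hΓ.solution ζ) := hΓ.mem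
  have hpi0 : (Real.pi : ℂ) ≠ 0 := Complex.ofReal_ne_zero.2 Real.pi_ne_zero
  have h1 : PhiForm β γ θ lam ξ (hΓ.solution ((G23 hlam).adjoint (f : L2 R6))) =
      inner ℂ ξ ((G23 hlam).adjoint (f : L2 R6)) := by
    have h2 := hΓ.solve ξ h.2.1 ((G23 hlam).adjoint (f : L2 R6))
    rwa [Complex.ofReal_zero, zero_mul, add_zero] at h2
  have h2 : PhiForm β γ θ lam ξ
      ((1 / (4 * (Real.pi : ℂ))) • hΓ.solution ((G23 hlam).adjoint (f : L2 R6))) =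
      1 / (4 * (Real.pi : ℂ)) * inner ℂ (G23 hlam ξ) (f : L2 R6) := by
    rw [PhiForm_smul_right hlam _ h.2.1 (hm _), h1, ContinuousLinearMap.adjoint_inner_right]
  have h3 := energyForm_eq (β := β) (γ := γ) (θ := θ) hlam h
    (isDecomposition_resolventMap hlam hm f)
  have h4 := h.inner_eq hlam f
  rw [inner_potential hlam ξ f.2] at h4
  have h5 : 12 * (Real.pi : ℂ) * (1 / (4 * (Real.pi : ℂ)) * inner ℂ (G23 hlam ξ) (f : L2 R6)) =
      3 * inner ℂ (G23 hlam ξ) (f : L2 R6) := by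
    field_simp
    ring
  rw [h2, h5] at h3
  have h6 := freeForm_freeResolvent hlam w (f : L2 R6)
  linear_combination h3 + h6 - h4

/-- After adding λ‖v‖² only the free form of w and 12π Φ^λ of ξ remain; both are coercive in L², and
𝒢^λ is bounded. -/
theorem energyForm_coercive (hlam : 0 < lam) {RΓ : L2 R3 → L2 R3}
    (hΓ : SolvableForm {ξ : L2 R3 | InSobolev (1 / 2) ξ} (PhiForm β γ θ lam) 0 δ RΓ) :
    ∃ c > 0, ∀ v ∈ formDomain hlam,
      c * ‖v‖ ^ 2 ≤ (energyForm β γ θ hlam v v).re + lam * ‖v‖ ^ 2 := by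
  have hpi := Real.pi_pos
  have hδ := hΓ.pos
  set C := 3 * ‖G23 hlam‖ with hC
  have hC0 : 0 ≤ C := by positivity
  -- Chosen for ‖v‖² ≤ 2‖w‖² + 2C²‖ξ‖²; the added 1 keeps the denominator positive when C = 0.
  set c := min (lam / 2) (12 * Real.pi * δ / (2 * C ^ 2 + 1)) with hc
  have hc0 : 0 < c := lt_min (by positivity) (by positivity)
  refine ⟨c, hc0, ?_⟩
  rintro v ⟨w, ξ, h⟩
  have h1 := freeForm_self_ge hlam h.1
  have h2 := hΓ.coercive ξ h.2.1
  have h3 : ‖v‖ ≤ ‖w‖ + C * ‖ξ‖ := by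
    change ‖(v : L2 R6)‖ ≤ _
    rw [h.2.2]
    exact (norm_add_le _ _).trans (add_le_add le_rfl (norm_potential_le hlam ξ))
  have h4 : ‖v‖ ^ 2 ≤ 2 * ‖w‖ ^ 2 + 2 * C ^ 2 * ‖ξ‖ ^ 2 := by
    have : ‖v‖ ^ 2 ≤ (‖w‖ + C * ‖ξ‖) ^ 2 := by gcongr
    nlinarith [sq_nonneg (‖w‖ - C * ‖ξ‖)]
  have h5 : (energyForm β γ θ hlam v v).re + lam * ‖v‖ ^ 2 =
      (freeForm lam w w).re + 12 * Real.pi * (PhiForm β γ θ lam ξ ξ).re := by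
    have e1 : ((lam : ℂ) * inner ℂ v v).re = lam * ‖v‖ ^ 2 := by
      rw [Complex.re_ofReal_mul]
      congr 1
      exact inner_self_eq_norm_sq (𝕜 := ℂ) v
    have e2 : (12 * (Real.pi : ℂ) * PhiForm β γ θ lam ξ ξ).re =
        12 * Real.pi * (PhiForm β γ θ lam ξ ξ).re := by
      have : (12 * (Real.pi : ℂ)) = ((12 * Real.pi : ℝ) : ℂ) := by push_cast; ring
      rw [this, Complex.re_ofReal_mul]
    rw [energyForm_eq hlam h h, Complex.add_re, Complex.sub_re, e1, e2]
    ring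
  rw [h5]
  have h6 : c * (2 * ‖w‖ ^ 2) ≤ lam * ‖w‖ ^ 2 := by
    have : c ≤ lam / 2 := min_le_left _ _
    nlinarith [mul_le_mul_of_nonneg_right this (sq_nonneg ‖w‖)]
  have h7 : c * (2 * C ^ 2) ≤ 12 * Real.pi * δ := by
    have : c ≤ 12 * Real.pi * δ / (2 * C ^ 2 + 1) := min_le_right _ _
    rw [le_div_iff₀ (by positivity)] at this
    linarith
  have h8 := mul_le_mul_of_nonneg_right h7 (sq_nonneg ‖ξ‖)
  have h9 := mul_le_mul_of_nonneg_left h4 hc0.le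
  have h10 := mul_le_mul_of_nonneg_left h2 (by positivity : 0 ≤ 12 * Real.pi)
  nlinarith

theorem exists_solvableForm_energyForm (hlam : 0 < lam) {RΓ : L2 R3 → L2 R3}
    (hΓ : SolvableForm {ξ : L2 R3 | InSobolev (1 / 2) ξ} (PhiForm β γ θ lam) 0 δ RΓ) :
    ∃ c, SolvableForm (formDomain hlam) (energyForm β γ θ hlam) lam c
      (resolventMap hlam hΓ.solution) := by
  obtain ⟨c, hc0, hc⟩ := energyForm_coercive hlam hΓ
  have hdec := isDecomposition_resolventMap (Γinv := hΓ.solution) hlam hΓ.mem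
  refine ⟨c, ?_, ?_, ?_, hc, hc0, ?_, ?_, ?_⟩
  · exact fun u ⟨w, ξ, h⟩ v ⟨w', ξ', h'⟩ => ⟨_, _, h.coe_sub hlam h'⟩
  · rintro u ⟨w, ξ, h⟩ v ⟨w', ξ', h'⟩
    rw [energyForm_eq hlam h' h, energyForm_eq hlam h h', freeForm_conj,
      PhiForm_conj hlam h'.2.1 h.2.1, ← inner_conj_symm v u]
    simp only [map_add, map_sub, map_mul, Complex.conj_ofReal, map_ofNat]
  · rintro v ⟨w, ξ, h⟩ a ⟨w1, ξ1, h1⟩ b ⟨w2, ξ2, h2⟩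
    have h12 := energyForm_eq (β := β) (γ := γ) (θ := θ) hlam h (h1.coe_sub hlam h2)
    rw [hΓ.sub_right ξ h.2.1 ξ1 h1.2.1 ξ2 h2.2.1, freeForm_sub_right hlam h.1 h1.1 h2.1,
      inner_sub_right] at h12
    linear_combination h12 - energyForm_eq (β := β) (γ := γ) (θ := θ) hlam h h1 +
      energyForm_eq (β := β) (γ := γ) (θ := θ) hlam h h2
  · exact fun f => ⟨_, _, hdec f⟩
  · exact fun v hv f => energyForm_resolventMap hlam hΓ hv f
  -- The regular part of the solution is R₀f. It is unique, and R₀ is injective.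
  · intro f g hfg
    have h1 := hdec f
    rw [hfg] at h1
    exact Subtype.ext (freeResolvent_injective hlam (h1.unique hlam (hdec g)).1)

theorem IsOperatorOfForm.congr {K : Type} [NormedAddCommGroup K] [InnerProductSpace ℂ K]
    {D D' : Set K} {B B' : K → K → ℂ} {T : K →ₗ.[ℂ] K} (h : IsOperatorOfForm D B T) (hD : D' = D)
    (hB : ∀ v ∈ D, ∀ ψ ∈ D, B' v ψ = B v ψ) : IsOperatorOfForm D' B' T := by
  subst hD
  intro ψ f
  rw [h ψ f]
  exact and_congr_right fun hψ => forall₂_congr fun v hv => by rw [hB v hv ψ hψ]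

theorem mem_domain_iff {K : Type} [NormedAddCommGroup K] [InnerProductSpace ℂ K]
    {D : Set K} {B : K → K → ℂ} {μ c : ℝ} {R : K → K} (h : SolvableForm D B μ c R) (ψ : K) :
    ψ ∈ h.operator.domain ↔ ∃ f, ψ = R f :=
  ⟨fun ⟨f, hf⟩ => ⟨f, hf.symm⟩, fun ⟨f, hf⟩ => ⟨f, hf.symm⟩⟩

theorem operator_apply {K : Type} [NormedAddCommGroup K] [InnerProductSpace ℂ K]
    {D : Set K} {B : K → K → ℂ} {μ c : ℝ} {R : K → K} (h : SolvableForm D B μ c R)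
    (ψ : h.operator.domain) {f : K} (hf : (ψ : K) = R f) :
    h.operator ψ = f - (μ : ℂ) • (ψ : K) := by
  obtain ⟨ψ, hψ⟩ := ψ
  obtain rfl : ψ = R f := hf
  exact opOfResolvent_apply h.solution h.injective μ f hψ

theorem coe_solution (hlam : 0 < lam) {RΓ : L2 R3 → L2 R3} {c : ℝ}
    (hΓ : SolvableForm {ξ : L2 R3 | InSobolev (1 / 2) ξ} (PhiForm β γ θ lam) 0 δ RΓ)
    (h : SolvableForm (formDomain hlam) (energyForm β γ θ hlam) lam c
      (resolventMap hlam hΓ.solution)) (f : L2sym) :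
    (h.solution f : L2 R6) = freeResolvent hlam f + (1 / (4 * (Real.pi : ℂ))) •
      potential hlam (hΓ.solution ((G23 hlam).adjoint (f : L2 R6))) := rfl

/-- The domain is the range of the resolvent. The regular parts R₀g exhaust H², and the charge
(4π)⁻¹ (Γ^λ)⁻¹ G* g is characterized by Γ^λ ξ being the trace of R₀g. -/
theorem mem_operator_domain_iff (hlam : 0 < lam) {RΓ : L2 R3 → L2 R3} {c : ℝ}
    (hΓ : SolvableForm {ξ : L2 R3 | InSobolev (1 / 2) ξ} (PhiForm β γ θ lam) 0 δ RΓ)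
    (h : SolvableForm (formDomain hlam) (energyForm β γ θ hlam) lam c
      (resolventMap hlam hΓ.solution)) (ψ : L2sym) :
    ψ ∈ h.operator.domain ↔ ∃ (w : L2 R6) (ξ : L2 R3), IsDecomposition hlam ψ w ξ ∧
      InSobolev 2 w ∧ ∃ hξ : ξ ∈ hΓ.operator.domain, IsTrace23 w (hΓ.operator ⟨ξ, hξ⟩) := by
  have hdec := isDecomposition_resolventMap (Γinv := hΓ.solution) hlam hΓ.mem
  rw [mem_domain_iff]
  constructor
  · rintro ⟨g, rfl⟩
    have hmem : (1 / (4 * (Real.pi : ℂ))) • hΓ.solution ((G23 hlam).adjoint (g : L2 R6)) ∈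
        hΓ.operator.domain := by
      rw [mem_domain_iff]
      exact ⟨_, (map_smul hΓ.solution _ _).symm⟩
    refine ⟨_, _, hdec g, inSobolev_two_freeResolvent hlam _, hmem, ?_⟩
    rw [isTrace23_freeResolvent_iff, operator_apply hΓ _ (map_smul hΓ.solution _ _).symm]
    simp
  · rintro ⟨w, ξ, hd, hw, hξ, htr⟩
    obtain ⟨g, rfl⟩ := exists_freeResolvent_eq hlam hw
    -- The regular part is the difference of ψ and a potential, both symmetric; hence so is its
    -- preimage under R₀.
    have hg : g ∈ L2sym := by
      rw [← freeResolvent_mem_L2sym_iff hlam, ← sub_eq_of_eq_add hd.2.2]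
      exact L2sym.sub_mem ψ.2 (potential_mem_L2sym hlam ξ)
    rw [isTrace23_freeResolvent_iff] at htr
    refine ⟨⟨g, hg⟩, Subtype.ext ?_⟩
    have h2 := hΓ.isBoundedInverse.2 ⟨ξ, hξ⟩
    rw [htr] at h2
    simp only [Complex.ofReal_zero, zero_smul, add_zero, map_smul] at h2
    rw [hd.2.2, (hdec ⟨g, hg⟩).2.2, h2]

/-- With ψ the resolvent applied to g, Hψ = g - λψ while H₀w = g - λw; the difference is the
potential term. -/
theorem operator_apply_eq (hlam : 0 < lam) {RΓ : L2 R3 → L2 R3} {c : ℝ}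
    (hΓ : SolvableForm {ξ : L2 R3 | InSobolev (1 / 2) ξ} (PhiForm β γ θ lam) 0 δ RΓ)
    (h : SolvableForm (formDomain hlam) (energyForm β γ θ hlam) lam c
      (resolventMap hlam hΓ.solution)) (ψ : h.operator.domain) {w : L2 R6} {ξ : L2 R3}
    (hd : IsDecomposition hlam (ψ : L2sym) w ξ) :
    ∃ hw : w ∈ H0.domain,
      (h.operator ψ : L2 R6) = H0 ⟨w, hw⟩ - (lam : ℂ) • potential hlam ξ := by
  have hdec := isDecomposition_resolventMap (Γinv := hΓ.solution) hlam hΓ.mem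
  obtain ⟨g, hg⟩ := (mem_domain_iff h _).1 ψ.2
  have hdg := hdec g
  rw [← hg] at hdg
  obtain ⟨rfl, rfl⟩ := hd.unique hlam hdg
  obtain ⟨hw, hH⟩ := H0_freeResolvent hlam (g : L2 R6)
  refine ⟨hw, ?_⟩
  rw [hH, operator_apply h ψ hg]
  change (g : L2 R6) - (lam : ℂ) • ((ψ : L2sym) : L2 R6) = _
  rw [hd.2.2, smul_add]
  abel

/-- The operator is built at one large λ; the invariance of domain and form makes it the operator of
the form for every λ > 0, even where Φ^λ need not be coercive. -/
theorem exists_hamiltonian (hθ : CutoffHypothesis θ) (hγ : gammaC < γ) :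
    ∃ H : L2sym →ₗ.[ℂ] L2sym, IsSelfAdjoint H ∧ (∃ m : ℝ, IsBoundedBelowBy H m) ∧
      ∀ (lam : ℝ) (hlam : 0 < lam),
        IsOperatorOfForm (formDomain hlam) (energyForm β γ θ hlam) H := by
  obtain ⟨δ, hδ, lam0, hlam0, hR⟩ := exists_solvableForm_PhiForm β hθ hγ
  have hl1 : lam0 < lam0 + 1 := lt_add_one _
  have hpos : 0 < lam0 + 1 := hlam0.trans hl1
  obtain ⟨R1, hR1⟩ := hR _ hl1
  obtain ⟨c1, h1⟩ := exists_solvableForm_energyForm hpos hR1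
  exact ⟨h1.operator, h1.isSelfAdjoint, ⟨_, h1.isBoundedBelowBy⟩, fun lam hlam =>
    h1.isOperatorOfForm.congr (formDomain_eq hlam hpos)
      fun v hv ψ hψ => energyForm_change hpos hlam hv hψ⟩

end Hamiltonian

end ThreeBosons

end

set_option maxHeartbeats 1000000 in
theorem theorem2p2 (β γ : ℝ) (θ : ℝ → ℝ) (hθ : CutoffHypothesis θ) (hγ : gammaC < γ) :
    -- the decomposition of the elements of the form domain is unique
    (∀ (lam : ℝ) (hlam : 0 < lam) (ψ : L2sym) (w w' : L2 R6) (ξ ξ' : L2 R3),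
      IsDecomposition hlam ψ w ξ → IsDecomposition hlam ψ w' ξ' → w = w' ∧ ξ = ξ') ∧
    -- the Hamiltonian associated with the form
    ∃ H : L2sym →ₗ.[ℂ] L2sym,
      IsSelfAdjoint H ∧ (∃ m : ℝ, IsBoundedBelowBy H m) ∧
      (∀ (lam : ℝ) (hlam : 0 < lam),
        IsOperatorOfForm (formDomain hlam) (energyForm β γ θ hlam) H) ∧
      ∃ lam0 : ℝ, 0 < lam0 ∧ ∀ (lam : ℝ) (hlam : 0 < lam), lam0 < lam →
        -- the operator associated with `Φ^λ`
        ∃ Γ : L2 R3 →ₗ.[ℂ] L2 R3,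
          IsSelfAdjoint Γ ∧ (∃ c : ℝ, 0 < c ∧ IsBoundedBelowBy Γ c) ∧
          IsOperatorOfForm {ξ | InSobolev (1 / 2) ξ} (PhiForm β γ θ lam) Γ ∧
          -- domain of the Hamiltonian
          (∀ ψ : L2sym, ψ ∈ H.domain ↔
            ∃ (w : L2 R6) (ξ : L2 R3), IsDecomposition hlam ψ w ξ ∧ InSobolev 2 w ∧
              ∃ hξ : ξ ∈ Γ.domain, IsTrace23 w (Γ ⟨ξ, hξ⟩)) ∧
          -- action of the Hamiltonian
          (∀ (ψ : H.domain) (w : L2 R6) (ξ : L2 R3), IsDecomposition hlam (ψ : L2sym) w ξ →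
            ∃ hw : w ∈ H0.domain,
              (H ψ : L2 R6) = H0 ⟨w, hw⟩ - (lam : ℂ) • potential hlam ξ) ∧
          -- resolvent of the Hamiltonian
          ∃ (Γinv : L2 R3 →L[ℂ] L2 R3) (R : L2sym →L[ℂ] L2sym),
            IsBoundedInverse Γ 0 Γinv ∧ IsBoundedInverse H lam R ∧
            ∀ f : L2sym, (R f : L2 R6) = freeResolvent hlam f +
              (1 / (4 * (Real.pi : ℂ))) •
                potential hlam (Γinv ((G23 hlam).adjoint (f : L2 R6))) := by
  refine ⟨fun lam hlam ψ w w' ξ ξ' h h' => h.unique hlam h', ?_⟩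
  obtain ⟨δ, hδ, lam0, hlam0, hR⟩ := exists_solvableForm_PhiForm β hθ hγ
  obtain ⟨H, hsa, hbd, hform⟩ := exists_hamiltonian (β := β) hθ hγ
  refine ⟨H, hsa, hbd, hform, lam0, hlam0, fun lam hlam hl => ?_⟩
  obtain ⟨RΓ, hΓ⟩ := hR lam hl
  obtain ⟨c, h⟩ := exists_solvableForm_energyForm hlam hΓ
  -- The operator built from the resolvent at the present λ is associated with the same form, hence
  -- equals H; its domain, action and inverse can be read off there.
  obtain rfl : H = h.operator := eq_of_isOperatorOfForm (hform lam hlam) h.isOperatorOfForm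
  have hpos : IsBoundedBelowBy hΓ.operator δ := by
    have h2 := hΓ.isBoundedBelowBy
    rwa [sub_zero] at h2
  exact ⟨hΓ.operator, hΓ.isSelfAdjoint, ⟨δ, hδ, hpos⟩, hΓ.isOperatorOfForm,
    mem_operator_domain_iff hlam hΓ h, fun ψ w ξ => operator_apply_eq hlam hΓ h ψ,
    hΓ.solution, h.solution, hΓ.isBoundedInverse, h.isBoundedInverse, coe_solution hlam hΓ h⟩
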